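/- For $d\in\mathbb R$ let $S^d_{\rho,\delta}=S^d_{\rho,\delta}(\mathbb R^n\times\mathbb R^n)$ be the set of $a\in C^\infty(\mathbb R^n\times\mathbb R^n)$ with $|D^\alpha_\xi D^\beta_x a(x,\xi)|\le C_{\alpha\beta}(1+|\xi|)^{d-\rho|\alpha|+\delta|\beta|}$ for all $\alpha,\beta$, and let $\operatorname{OP}(S^\infty_{\rho,\delta})=\bigcup_d\{\operatorname{OP}(a)\mid a\in S^d_{\rho,\delta}\}$, where for Schwartz functions $u$ $$\operatorname{OP}(a)u(x)=a(x,D)u(x)=(2\pi)^{-n}\int e^{i x\cdot\xi}a(x,\xi)\hat u(\xi)\,d\xi .$$ Let $\mathcal F^{-1}\mathcal E'(\mathbb R^n)$ be the space of $u\in\mathcal S'(\mathbb R^n)$ for which $\hat u$ has compact support. Let $\Psi\in C^\infty(\mathbb R^n,\mathbb R)$ with $\Psi(\xi)=1$ for $|\xi|\le\frac{11}{10}$ and $\Psi(\xi)=0$ for $|\xi|\ge\frac{13}{10}$; put $\Psi_j=\Psi(2^{-j}\cdot)$ for $j\ge0$, $\Psi_j=0$ for $j<0$, $\Phi_j=\Psi_j-\Psi_{j-1}$,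 $\tilde\Phi_j=\Phi_{j-1}+\Phi_j+\Phi_{j+1}$, $a_{j,k}(x,\eta)=\mathcal F^{-1}_{\xi\to x}(\Phi_j\hat a(\cdot,\eta))\tilde\Phi_k(\eta)$ with $\hat a(\xi,\eta)=\mathcal F_{x\to\xi}a(x,\eta)$, and $u_k=\mathcal F^{-1}(\Phi_k\hat u)$. For $u\in\mathcal S'(\mathbb R^n)$ set $$a_{j,k}(x,D)u_k=\int K_{j,k}(x,y)u_k(y)\,dy,\qquad K_{j,k}(x,y)=(2\pi)^{-n}\int e^{i(x-y)\cdot\eta}a_{j,k}(x,\eta)\,d\eta .$$ **Proposition.** Let $A\in\operatorname{OP}(S^\infty_{1,1})$. There is a linear map $\tilde A\colon\mathcal F^{-1}\mathcal E'(\mathbb R^n)\to\mathcal S'(\mathbb R^n)$ such that: 1. $\tilde Au=Au$ for every Schwartz function $u$ in $\mathcal F^{-1}\mathcal E'(\mathbb R^n)$. 2. Whenever $A=\operatorname{OP}(a)$ with $a\in S^d_{1,1}$ for some $d\in\mathbb R$, then for every $\Psi$ as above and every $u\in\mathcal F^{-1}\mathcal E'(\mathbb R^n)$ the three series $$a^{(1)}(x,D)u=\sum_{k=2}^\infty\sum_{j=0}^{k-2}a_{j,k}(x,D)u_k,\qquad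 a^{(2)}(x,D)u=\sum_{k=0}^\infty\ \sum_{j,l\in\{0,1\},\ j+l\le1}a_{k-j,k-l}(x,D)u_{k-l},\qquad a^{(3)}(x,D)u=\sum_{j=2}^\infty\sum_{k=0}^{j-2}a_{j,k}(x,D)u_k$$ converge in $\mathcal S'(\mathbb R^n)$ (as series indexed by the outer summation variable), and $\tilde Au=a^{(1)}(x,D)u+a^{(2)}(x,D)u+a^{(3)}(x,D)u$. 3. If $A\in\operatorname{OP}(S^\infty_{1,0})$, then $A$ has an extension to a continuous linear operator $T\colon\mathcal S'(\mathbb R^n)\to\mathcal S'(\mathbb R^n)$, and $\tilde Au=Tu$ for every such $T$ and every $u\in\mathcal F^{-1}\mathcal E'(\mathbb R^n)$. Here $\mathcal S'(\mathbb R^n)$ carries the weak-$*$ topology. -/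

import Mathlib

open MeasureTheory SchwartzMap FourierTransform Filter Topology
open scoped ContDiff

namespace TypeOneOne

/-- Euclidean space `ℝⁿ`. -/
abbrev Rn (n : ℕ) := EuclideanSpace ℝ (Fin n)

/-! ### Symbols and operators -/

/-- `a ∈ S^d_{ρ,δ}(ℝⁿ × ℝⁿ)`: `a(x,ξ)` is smooth, and for all orders `p`, `q` the `ξ`-derivatives
of order `p` of the `x`-derivatives of order `q` are bounded by a constant times
`(1 + |ξ|)^(d - ρ p + δ q)`. The derivatives of a given order are collected in `iteratedFDeriv`,
whose norm is equivalent to the maximum over the multi-indices of that order. -/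
def IsSymbol {n : ℕ} (d ρ δ : ℝ) (a : Rn n → Rn n → ℂ) : Prop :=
  ContDiff ℝ ∞ (fun z : Rn n × Rn n => a z.1 z.2) ∧
  ∀ p q : ℕ, ∃ C : ℝ, ∀ x ξ : Rn n,
    ‖iteratedFDeriv ℝ p (fun η => iteratedFDeriv ℝ q (fun y => a y η) x) ξ‖
      ≤ C * (1 + ‖ξ‖) ^ (d - ρ * p + δ * q)

/-- The Fourier transform `f̂(ξ) = ∫ e^{-i y·ξ} f(y) dy`. -/
noncomputable def fourierHat {n : ℕ} (f : Rn n → ℂ) (ξ : Rn n) : ℂ :=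
  ∫ y, Complex.exp (-(Complex.I * (inner ℝ y ξ : ℝ))) * f y

/-- The inverse Fourier transform `(2π)⁻ⁿ ∫ e^{i x·ξ} g(ξ) dξ`. -/
noncomputable def fourierCheck {n : ℕ} (g : Rn n → ℂ) (x : Rn n) : ℂ :=
  ((2 * Real.pi : ℝ) : ℂ)⁻¹ ^ n * ∫ ξ, Complex.exp (Complex.I * (inner ℝ x ξ : ℝ)) * g ξ

/-- The operator `OP(a) = a(x,D)` on Schwartz functions,
`a(x,D)u(x) = (2π)⁻ⁿ ∫ e^{i x·ξ} a(x,ξ) û(ξ) dξ`. -/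
noncomputable def op {n : ℕ} (a : Rn n → Rn n → ℂ) (u : 𝓢(Rn n, ℂ)) (x : Rn n) : ℂ :=
  fourierCheck (fun ξ => a x ξ * fourierHat u ξ) x

/-- `OP(S^∞_{ρ,δ}) = ⋃_d OP(S^d_{ρ,δ})`, a set of operators defined on the Schwartz space. -/
def OPInfty (n : ℕ) (ρ δ : ℝ) : Set (𝓢(Rn n, ℂ) → Rn n → ℂ) :=
  {A | ∃ (d : ℝ) (a : Rn n → Rn n → ℂ), IsSymbol d ρ δ a ∧ A = op a}

/-! ### Tempered distributions -/

/-- The tempered distribution `w` is (given by) the function `f`. -/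
def Represents {n : ℕ} (w : 𝓢'(Rn n, ℂ)) (f : Rn n → ℂ) : Prop :=
  ∀ φ : 𝓢(Rn n, ℂ), Integrable (fun x => φ x * f x) ∧ w φ = ∫ x, φ x * f x

/-- The space `F⁻¹E'(ℝⁿ)` of the tempered distributions with compactly supported Fourier
transform. Mathlib's normalization of the Fourier transform differs from `fourierHat` by a dilation
and a constant factor, which does not affect this notion. -/
noncomputable def FinvE' (n : ℕ) : Submodule ℂ (𝓢'(Rn n, ℂ)) where
  carrier := {u | IsCompact (Distribution.dsupport (𝓕 u : 𝓢'(Rn n, ℂ)))}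
  zero_mem' := by
    have h : Distribution.dsupport (𝓕 (0 : 𝓢'(Rn n, ℂ)) : 𝓢'(Rn n, ℂ)) = ∅ := by
      ext x
      simp only [Set.mem_empty_iff_false, iff_false, Distribution.notMem_dsupport_iff]
      exact ⟨Set.univ, fun φ _ => rfl, isOpen_univ, Set.mem_univ _⟩
    simp only [Set.mem_ofPred_eq, h, isCompact_empty]
  add_mem' := by
    intro u v hu hv
    refine (hu.union hv).of_isClosed_subset Distribution.isClosed_dsupport ?_
    intro x hx
    by_contra hxn
    simp only [Set.mem_union, not_or, Distribution.notMem_dsupport_iff] at hxn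
    obtain ⟨⟨s, hs, hso, hxs⟩, ⟨t, ht, hto, hxt⟩⟩ := hxn
    refine (Distribution.notMem_dsupport_iff (f := (𝓕 (u + v) : 𝓢'(Rn n, ℂ))) x).2
      ⟨s ∩ t, ?_, hso.inter hto, hxs, hxt⟩ hx
    intro φ hφ
    have h1 := hs φ (hφ.trans Set.inter_subset_left)
    have h2 := ht φ (hφ.trans Set.inter_subset_right)
    simp only [TemperedDistribution.fourier_apply] at h1 h2 ⊢
    change u (𝓕 φ) + v (𝓕 φ) = 0
    rw [h1, h2, add_zero]
  smul_mem' := by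
    intro c u hu
    refine hu.of_isClosed_subset Distribution.isClosed_dsupport ?_
    refine Distribution.dsupport_subset_dsupport fun s _ hs φ hφ => ?_
    have h1 := hs φ hφ
    simp only [TemperedDistribution.fourier_apply] at h1 ⊢
    change c * u (𝓕 φ) = 0
    rw [h1, mul_zero]

/-- `T` is a continuous, globally defined extension `S'(ℝⁿ) → S'(ℝⁿ)` of the operator `A`. -/
def IsGlobalExtension {n : ℕ} (A : 𝓢(Rn n, ℂ) → Rn n → ℂ)
    (T : 𝓢'(Rn n, ℂ) →L[ℂ] 𝓢'(Rn n, ℂ)) : Prop :=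
  ∀ v : 𝓢(Rn n, ℂ), Represents (T (v : 𝓢'(Rn n, ℂ))) (A v)

/-! ### Littlewood-Paley partitions of unity -/

/-- A smooth cut-off function `Ψ`, equal to `1` for `|ξ| ≤ 11/10` and to `0` for `|ξ| ≥ 13/10`. -/
structure Cutoff (n : ℕ) where
  toFun : Rn n → ℝ
  smooth : ContDiff ℝ ∞ toFun
  eq_one : ∀ ξ, ‖ξ‖ ≤ 11 / 10 → toFun ξ = 1
  eq_zero : ∀ ξ, 13 / 10 ≤ ‖ξ‖ → toFun ξ = 0

namespace Cutoff

variable {n : ℕ}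

instance : Nonempty (Cutoff n) := by
  let f : ContDiffBump (0 : Rn n) := ⟨11 / 10, 13 / 10, by norm_num, by norm_num⟩
  exact ⟨⟨f, f.contDiff, fun ξ h => f.one_of_mem_closedBall (by simpa using h),
    fun ξ h => f.zero_of_le_dist (by simpa using h)⟩⟩

/-- `Ψ_j(ξ) = Ψ(2^{-j} ξ)` for `j ≥ 0`, and `Ψ_j = 0` for `j < 0`. -/
noncomputable def dilate (Ψ : Cutoff n) (j : ℤ) (ξ : Rn n) : ℂ :=
  if j < 0 then 0 else (Ψ.toFun ((2 : ℝ) ^ (-j) • ξ) : ℂ)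

/-- `Φ_j = Ψ_j - Ψ_{j-1}`, so that `1 = ∑_{j ≥ 0} Φ_j`; here `Φ_j = 0` for `j < 0`. -/
noncomputable def part (Ψ : Cutoff n) (j : ℤ) (ξ : Rn n) : ℂ :=
  Ψ.dilate j ξ - Ψ.dilate (j - 1) ξ

/-- `Φ̃_j = Φ_{j-1} + Φ_j + Φ_{j+1}`. -/
noncomputable def fatPart (Ψ : Cutoff n) (j : ℤ) (ξ : Rn n) : ℂ :=
  Ψ.part (j - 1) ξ + Ψ.part j ξ + Ψ.part (j + 1) ξ

theorem dilate_contDiff (Ψ : Cutoff n) (j : ℤ) : ContDiff ℝ ∞ (Ψ.dilate j) := by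
  unfold dilate
  split_ifs
  · exact contDiff_const
  · exact Complex.ofRealCLM.contDiff.comp (Ψ.smooth.comp (contDiff_const_smul _))

theorem dilate_eq_zero (Ψ : Cutoff n) (j : ℤ) (ξ : Rn n) (h : 13 / 10 * (2 : ℝ) ^ j ≤ ‖ξ‖) :
    Ψ.dilate j ξ = 0 := by
  unfold dilate
  split_ifs
  · rfl
  · rw [Ψ.eq_zero, Complex.ofReal_zero]
    have h2 : (0 : ℝ) < 2 ^ j := by positivity
    rw [norm_smul, zpow_neg, norm_inv, Real.norm_of_nonneg h2.le, ← div_eq_inv_mul,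
      le_div_iff₀ h2]
    exact h

theorem part_eq_zero (Ψ : Cutoff n) (j : ℤ) (ξ : Rn n) (h : 13 / 10 * (2 : ℝ) ^ j ≤ ‖ξ‖) :
    Ψ.part j ξ = 0 := by
  unfold part
  rw [Ψ.dilate_eq_zero j ξ h, Ψ.dilate_eq_zero (j - 1) ξ, sub_zero]
  refine le_trans ?_ h
  gcongr
  · norm_num
  · omega

theorem part_scaled_hasCompactSupport (Ψ : Cutoff n) (j : ℤ) :
    HasCompactSupport (fun ξ => Ψ.part j ((2 * Real.pi) • ξ)) := by
  refine HasCompactSupport.intro (isCompact_closedBall (0 : Rn n) (13 / 10 * (2 : ℝ) ^ j)) ?_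
  intro ξ hξ
  apply Ψ.part_eq_zero
  simp only [Metric.mem_closedBall, dist_zero_right, not_le] at hξ
  have h1 : (1 : ℝ) ≤ 2 * Real.pi := by linarith [Real.pi_gt_three]
  rw [norm_smul, Real.norm_of_nonneg (by positivity)]
  nlinarith [norm_nonneg ξ]

theorem part_scaled_contDiff (Ψ : Cutoff n) (j : ℤ) :
    ContDiff ℝ ∞ (fun ξ => Ψ.part j ((2 * Real.pi) • ξ)) :=
  ((Ψ.dilate_contDiff j).sub (Ψ.dilate_contDiff (j - 1))).comp (contDiff_const_smul _)

/-- The inverse Fourier transform `F⁻¹Φ_j` as a Schwartz function; the factor `2π` accounts for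
Mathlib's normalization of the Fourier transform, see `kernel_eq`. -/
noncomputable def kernel (Ψ : Cutoff n) (j : ℤ) : 𝓢(Rn n, ℂ) :=
  𝓕⁻ ((Ψ.part_scaled_hasCompactSupport j).toSchwartzMap (Ψ.part_scaled_contDiff j))

theorem kernel_eq (Ψ : Cutoff n) (j : ℤ) (x : Rn n) :
    Ψ.kernel j x = fourierCheck (Ψ.part j) x := by
  have h := Measure.integral_comp_smul (volume : Measure (Rn n))
    (fun ξ => Complex.exp (Complex.I * (inner ℝ x ξ : ℝ)) * Ψ.part j ξ) (2 * Real.pi)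
  unfold kernel fourierCheck
  rw [SchwartzMap.fourierInv_coe, Real.fourierInv_eq']
  have hpos : (0 : ℝ) < ((2 * Real.pi) ^ n)⁻¹ := by positivity
  rw [finrank_euclideanSpace_fin, abs_of_pos hpos] at h
  rw [inv_pow, ← Complex.ofReal_pow, ← Complex.ofReal_inv, ← Complex.real_smul, ← h]
  refine integral_congr_ae (Eventually.of_forall fun ξ => ?_)
  simp only [HasCompactSupport.toSchwartzMap_toFun, smul_eq_mul, inner_smul_right,
    real_inner_comm x ξ]
  congr 2
  push_cast
  ring

end Cutoff

/-! ### The paradifferential definition of `a(x,D)u` -/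

section Splitting

variable {n : ℕ}

/-- The function `u_k = Φ_k(D)u = F⁻¹(Φ_k û)` for a tempered distribution `u`, that is,
`u_k(y) = ⟨u, F⁻¹Φ_k(y - ·)⟩`. -/
noncomputable def dyadicPiece (Ψ : Cutoff n) (u : 𝓢'(Rn n, ℂ)) (k : ℤ) (y : Rn n) : ℂ :=
  u ((compCLMOfContinuousLinearEquiv ℂ (ContinuousLinearEquiv.neg ℝ) (Ψ.kernel k)).compSubConstCLM
    ℂ y)

theorem dyadicPiece_testFunction (Ψ : Cutoff n) (k : ℤ) (y z : Rn n) :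
    ((compCLMOfContinuousLinearEquiv ℂ (ContinuousLinearEquiv.neg ℝ)
      (Ψ.kernel k)).compSubConstCLM ℂ y) z = Ψ.kernel k (y - z) := by
  simp

/-- `a_{j,k}(x,η) = F⁻¹_{ξ→x}(Φ_j â(·,η)) Φ̃_k(η)`, where the first factor is the convolution of
the bounded function `a(·,η)` with `F⁻¹Φ_j`. -/
noncomputable def symbolPiece (Ψ : Cutoff n) (a : Rn n → Rn n → ℂ) (j k : ℤ) (x η : Rn n) : ℂ :=
  (∫ y, Ψ.kernel j y * a (x - y) η) * Ψ.fatPart k η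

/-- The distribution kernel `K_{j,k}(x,y) = (2π)⁻ⁿ ∫ e^{i (x-y)·η} a_{j,k}(x,η) dη` of
`a_{j,k}(x,D)`. -/
noncomputable def pieceKernel (Ψ : Cutoff n) (a : Rn n → Rn n → ℂ) (j k : ℤ) (x y : Rn n) : ℂ :=
  fourierCheck (fun η => symbolPiece Ψ a j k x η) (x - y)

/-- The function `a_{j,k}(x,D)u_k(x) = ∫ K_{j,k}(x,y) u_k(y) dy`. -/
noncomputable def term (Ψ : Cutoff n) (a : Rn n → Rn n → ℂ) (u : 𝓢'(Rn n, ℂ)) (j k : ℤ)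
    (x : Rn n) : ℂ :=
  ∫ y, pieceKernel Ψ a j k x y * dyadicPiece Ψ u k y

/-- The series of functions `∑_{m ≥ 0} g m` converges to `w` in `S'(ℝⁿ)`: every `g m` defines a
tempered distribution, and the partial sums of these converge to `w`. -/
def SeriesConvergesTo (g : ℕ → Rn n → ℂ) (w : 𝓢'(Rn n, ℂ)) : Prop :=
  ∃ G : ℕ → 𝓢'(Rn n, ℂ), (∀ m, Represents (G m) (g m)) ∧
    Tendsto (fun N => ∑ m ∈ Finset.range N, G m) atTop (𝓝 w)

/-- `a^{(1)}(x,D)u = ∑_{k ≥ 2} ∑_{j=0}^{k-2} a_{j,k}(x,D)u_k`: the summand with `k = m + 2`. -/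
noncomputable def summand₁ (Ψ : Cutoff n) (a : Rn n → Rn n → ℂ) (u : 𝓢'(Rn n, ℂ)) (m : ℕ)
    (x : Rn n) : ℂ :=
  ∑ j ∈ Finset.range (m + 1), term Ψ a u j (m + 2) x

/-- `a^{(2)}(x,D)u = ∑_{k ≥ 0} ∑_{j,l ∈ {0,1}, j+l ≤ 1} a_{k-j,k-l}(x,D)u_{k-l}`: the summand with
`k = m`. For `m = 0` only `a_{0,0}(x,D)u_0` is non-zero, for `Φ_{-1} = 0`. -/
noncomputable def summand₂ (Ψ : Cutoff n) (a : Rn n → Rn n → ℂ) (u : 𝓢'(Rn n, ℂ)) (m : ℕ)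
    (x : Rn n) : ℂ :=
  term Ψ a u m m x + term Ψ a u (m - 1) m x + term Ψ a u m (m - 1) x

/-- `a^{(3)}(x,D)u = ∑_{j ≥ 2} ∑_{k=0}^{j-2} a_{j,k}(x,D)u_k`: the summand with `j = m + 2`. -/
noncomputable def summand₃ (Ψ : Cutoff n) (a : Rn n → Rn n → ℂ) (u : 𝓢'(Rn n, ℂ)) (m : ℕ)
    (x : Rn n) : ℂ :=
  ∑ k ∈ Finset.range (m + 1), term Ψ a u (m + 2) k x

/-- The three series converge in `S'(ℝⁿ)`, and
`w = a^{(1)}(x,D)u + a^{(2)}(x,D)u + a^{(3)}(x,D)u`. -/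
def IsParadifferentialSum (Ψ : Cutoff n) (a : Rn n → Rn n → ℂ) (u w : 𝓢'(Rn n, ℂ)) : Prop :=
  ∃ w₁ w₂ w₃ : 𝓢'(Rn n, ℂ), SeriesConvergesTo (summand₁ Ψ a u) w₁ ∧
    SeriesConvergesTo (summand₂ Ψ a u) w₂ ∧ SeriesConvergesTo (summand₃ Ψ a u) w₃ ∧
    w = w₁ + w₂ + w₃

end Splitting

end TypeOneOne

/-!
Only the values of a symbol `a` near the spectrum of `u` should matter, so for `û` of compact
support `a(x,D)u` is defined directly as the function
`x ↦ ⟨û, e^{i x·ξ} a(x,ξ) Ψ_N(ξ)⟩` (`localizedOp`), which does not depend on the cut-off once `Ψ_N`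
is `1` near the support of `û` (`localizedOp_congr`). Joint derivatives of a symbol of type `1,1`
are polynomially bounded (`IsSymbol.hasTemperateGrowth`), and hence so is this function; it is a
tempered distribution, linear in `u` (`exists_extension`). For Schwartz functions it is the integral
that defines `OP(a)` (`localizedOp_eq_op`). As `OP(a)` determines `a` (`op_injective`), the choice
of the symbol plays no role.

The analytic tool is `CompactFamily.apply_eq_integral`: a tempered distribution commutes with
integrals of smooth families of test functions with a common compact support. By the Hahn-Banach
theorem the distribution is a bounded functional of finitely many weighted derivatives
(`exists_eq_comp_jetPi`), so that this reduces to integrals with values in a Banach space.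

With this tool, used twice, `a_{j,k}(x,D)u_k` becomes
`∫ F⁻¹Φ_j(z) ⟨û, e^{i x·ξ} a(x-z,ξ) Φ_k(ξ)⟩ dz` (`term_eq`). This vanishes for large `k`, so the
first two series are finite sums. The sum of the terms with `j, k ≤ M` is, for large `M`,
`∫ F⁻¹Ψ_M(z) ⟨û, e^{i x·ξ} a(x-z,ξ) Ψ_N(ξ)⟩ dz` with `N` fixed (`sum_term_eq`). Since
`F⁻¹Ψ_M = 2^{Mn} F⁻¹Ψ_0(2^M ·)` is an approximate identity, this tends to the value of the
translate `z = 0`, which is `localizedOp`, and does so within a fixed polynomial bound; so the third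
series converges as well (`isParadifferentialSum_of_represents`).

For type `1,0`, the transposed operator maps `φ` to the Fourier transform of
`ξ ↦ ∫ φ(x) e^{i x·ξ} b(x,ξ) dx`. All derivatives of `b` grow like one fixed power of `|ξ|`, so
this function is again a Schwartz function, depending continuously on `φ` (`oscIntegralCLM`): at
`ξ` it is a value of the inverse Fourier transform of `b(·,ξ) φ`, and its derivatives are functions
of the same form. Duality gives an extension to `S'` (`dualOp`). It is the only one, because the
Schwartz functions are weak-* dense (`continuousLinearMap_ext_of_schwartz`), and it agrees with
`localizedOp` by one more exchange of `û` with an integral (`eq_dualOp_of_represents`).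

The proofs use Mathlib's Fourier transform, with the characters `e^{2πi x·ξ}` (`planeWave`), whence
the arguments `2πξ` of symbols and cut-offs.
-/

namespace TypeOneOne

/-! ### Partial derivatives and differentiation under the integral sign -/

universe u

section Partial

variable {X : Type*} {E V : Type u} [NormedAddCommGroup X] [NormedSpace ℝ X]
  [NormedAddCommGroup E] [NormedSpace ℝ E] [NormedAddCommGroup V] [NormedSpace ℝ V]

theorem iteratedFDeriv_prodMk_left {f : X × E → V} (hf : ContDiff ℝ ∞ f) (l : ℕ) (x : X) (ξ : E) :
    iteratedFDeriv ℝ l (fun η => f (x, η)) ξ =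
      (iteratedFDeriv ℝ l f (x, ξ)).compContinuousLinearMap
        (fun _ => ContinuousLinearMap.inr ℝ X E) := by
  have h1 : (fun η => f (x, η)) =
      (fun z => f ((x, 0) + z)) ∘ ContinuousLinearMap.inr ℝ X E := by
    ext η; simp
  have h2 : ContDiff ℝ ∞ (fun z => f ((x, 0) + z)) := hf.comp (contDiff_const.add contDiff_id)
  rw [h1, (ContinuousLinearMap.inr ℝ X E).iteratedFDeriv_comp_right h2 ξ
    (by exact_mod_cast le_top), iteratedFDeriv_comp_add_left]
  simp

theorem iteratedFDeriv_prodMk_right {f : X × E → V} (hf : ContDiff ℝ ∞ f) (l : ℕ) (x : X)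
    (ξ : E) :
    iteratedFDeriv ℝ l (fun y => f (y, ξ)) x =
      (iteratedFDeriv ℝ l f (x, ξ)).compContinuousLinearMap
        (fun _ => ContinuousLinearMap.inl ℝ X E) := by
  have h1 : (fun y => f (y, ξ)) =
      (fun z => f ((0, ξ) + z)) ∘ ContinuousLinearMap.inl ℝ X E := by
    ext η; simp
  have h2 : ContDiff ℝ ∞ (fun z => f ((0, ξ) + z)) := hf.comp (contDiff_const.add contDiff_id)
  rw [h1, (ContinuousLinearMap.inl ℝ X E).iteratedFDeriv_comp_right h2 x
    (by exact_mod_cast le_top), iteratedFDeriv_comp_add_left]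
  simp

theorem norm_iteratedFDeriv_prodMk_left_le {f : X × E → V} (hf : ContDiff ℝ ∞ f) (l : ℕ) (x : X)
    (ξ : E) :
    ‖iteratedFDeriv ℝ l (fun η => f (x, η)) ξ‖ ≤ ‖iteratedFDeriv ℝ l f (x, ξ)‖ := by
  rw [iteratedFDeriv_prodMk_left hf]
  refine (ContinuousMultilinearMap.norm_compContinuousLinearMap_le _ _).trans ?_
  refine mul_le_of_le_one_right (norm_nonneg _) (Finset.prod_le_one (fun _ _ => norm_nonneg _) ?_)
  exact fun _ _ => ContinuousLinearMap.norm_inr_le_one ℝ X E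

theorem norm_iteratedFDeriv_prodMk_right_le {f : X × E → V} (hf : ContDiff ℝ ∞ f) (l : ℕ) (x : X)
    (ξ : E) :
    ‖iteratedFDeriv ℝ l (fun y => f (y, ξ)) x‖ ≤ ‖iteratedFDeriv ℝ l f (x, ξ)‖ := by
  rw [iteratedFDeriv_prodMk_right hf]
  refine (ContinuousMultilinearMap.norm_compContinuousLinearMap_le _ _).trans ?_
  refine mul_le_of_le_one_right (norm_nonneg _) (Finset.prod_le_one (fun _ _ => norm_nonneg _) ?_)
  exact fun _ _ => ContinuousLinearMap.norm_inl_le_one ℝ X E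

theorem continuous_iteratedFDeriv_prodMk_left {f : X × E → V} (hf : ContDiff ℝ ∞ f) (l : ℕ) :
    Continuous (fun z : X × E => iteratedFDeriv ℝ l (fun η => f (z.1, η)) z.2) := by
  simp_rw [iteratedFDeriv_prodMk_left hf]
  exact (ContinuousMultilinearMap.compContinuousLinearMapL (F := V)
    (fun _ : Fin l => ContinuousLinearMap.inr ℝ X E)).continuous.comp
    (hf.continuous_iteratedFDeriv (by exact_mod_cast le_top))

/-- A smooth family of functions of `ξ`, depending on a parameter `x`, all of whose derivatives are
dominated by integrable functions of `x`, locally uniformly in `ξ`. -/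
def DominatedFamily [MeasurableSpace X] (μ : Measure X) (f : X × E → V) : Prop :=
  ContDiff ℝ ∞ f ∧ ∀ (l : ℕ) (R : ℝ), ∃ w : X → ℝ, Integrable w μ ∧
    ∀ x ξ, ‖ξ‖ ≤ R → ‖iteratedFDeriv ℝ l f (x, ξ)‖ ≤ w x

namespace DominatedFamily

variable [MeasurableSpace X] {μ : Measure X} {f : X × E → V}

theorem partialFDeriv (hf : DominatedFamily μ f) :
    DominatedFamily μ (fun z => (fderiv ℝ f z).comp (ContinuousLinearMap.inr ℝ X E)) := by
  let L : (X × E →L[ℝ] V) →L[ℝ] (E →L[ℝ] V) :=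
    (ContinuousLinearMap.compL ℝ E (X × E) V).flip (ContinuousLinearMap.inr ℝ X E)
  have hL : (fun z => (fderiv ℝ f z).comp (ContinuousLinearMap.inr ℝ X E)) =
    L ∘ fderiv ℝ f := rfl
  have hD : ContDiff ℝ ∞ (fderiv ℝ f) := hf.1.fderiv_right (by simp)
  rw [hL]
  refine ⟨L.contDiff.comp hD, fun l R => ?_⟩
  obtain ⟨w, hw, hb⟩ := hf.2 (l + 1) R
  refine ⟨fun x => ‖L‖ * w x, hw.const_mul _, fun x ξ hξ => ?_⟩
  refine (L.norm_iteratedFDeriv_comp_left hD.contDiffAt (by exact_mod_cast le_top)).trans ?_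
  refine mul_le_mul_of_nonneg_left ?_ (norm_nonneg L)
  rw [norm_iteratedFDeriv_fderiv]
  exact hb x ξ hξ

variable [BorelSpace X] [SecondCountableTopology X]

theorem integrable_iteratedFDeriv (hf : DominatedFamily μ f) (l : ℕ) (ξ : E) :
    Integrable (fun x => iteratedFDeriv ℝ l (fun η => f (x, η)) ξ) μ := by
  obtain ⟨w, hw, hb⟩ := hf.2 l ‖ξ‖
  refine hw.mono' ?_ (Eventually.of_forall fun x =>
    (norm_iteratedFDeriv_prodMk_left_le hf.1 l x ξ).trans (hb x ξ le_rfl))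
  exact ((continuous_iteratedFDeriv_prodMk_left hf.1 l).comp
    (Continuous.prodMk_left ξ)).aestronglyMeasurable

theorem integrable (hf : DominatedFamily μ f) (ξ : E) : Integrable (fun x => f (x, ξ)) μ := by
  refine (integrable_norm_iff ?_).1 ?_
  · exact (hf.1.continuous.comp (Continuous.prodMk_left ξ)).aestronglyMeasurable
  · simpa using (hf.integrable_iteratedFDeriv 0 ξ).norm

theorem hasFDerivAt_integral (hf : DominatedFamily μ f) (ξ : E) :
    HasFDerivAt (fun ξ => ∫ x, f (x, ξ) ∂μ)
      (∫ x, (fderiv ℝ f (x, ξ)).comp (ContinuousLinearMap.inr ℝ X E) ∂μ) ξ := by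
  obtain ⟨w, hw, hb⟩ := hf.partialFDeriv.2 0 (‖ξ‖ + 1)
  refine hasFDerivAt_integral_of_dominated_of_fderiv_le
    (F' := fun ξ x => (fderiv ℝ f (x, ξ)).comp (ContinuousLinearMap.inr ℝ X E))
    (Metric.ball_mem_nhds ξ one_pos) (Eventually.of_forall fun η => ?_) (hf.integrable ξ)
    ?_ ?_ hw ?_
  · exact (hf.integrable η).aestronglyMeasurable
  · exact (hf.partialFDeriv.integrable ξ).aestronglyMeasurable
  · refine Eventually.of_forall fun x η hη => ?_
    have := hb x η (by
      have h1 : ‖η - ξ‖ < 1 := by simpa [dist_eq_norm] using hη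
      have := norm_le_norm_add_norm_sub ξ η
      rw [norm_sub_rev] at this
      linarith)
    simpa using this
  · refine Eventually.of_forall fun x η _ => ?_
    have h1 : HasFDerivAt f (fderiv ℝ f (x, η)) (x, η) :=
      (hf.1.differentiable (by simp) _).hasFDerivAt
    have h2 : HasFDerivAt (fun η : E => (x, η)) (ContinuousLinearMap.inr ℝ X E) η :=
      hasFDerivAt_prodMk_right x η
    exact h1.comp η h2

/-- The class of dominated families is closed under the derivative in `ξ`, so that the formula
iterates. -/
theorem fderiv_integral (hf : DominatedFamily μ f) :
    fderiv ℝ (fun ξ => ∫ x, f (x, ξ) ∂μ) =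
      fun ξ => ∫ x, (fderiv ℝ f (x, ξ)).comp (ContinuousLinearMap.inr ℝ X E) ∂μ :=
  funext fun ξ => (hf.hasFDerivAt_integral ξ).fderiv

theorem contDiff_integral_nat (hf : DominatedFamily μ f) (m : ℕ) :
    ContDiff ℝ m (fun ξ => ∫ x, f (x, ξ) ∂μ) := by
  induction m generalizing V with
  | zero =>
    exact contDiff_zero.2 (continuous_iff_continuousAt.2 fun ξ =>
      (hf.hasFDerivAt_integral ξ).continuousAt)
  | succ m ih =>
    rw [Nat.cast_add, Nat.cast_one, contDiff_succ_iff_fderiv, hf.fderiv_integral]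
    exact ⟨fun ξ => (hf.hasFDerivAt_integral ξ).differentiableAt, by simp, ih hf.partialFDeriv⟩

theorem contDiff_integral (hf : DominatedFamily μ f) : ContDiff ℝ ∞ (fun ξ => ∫ x, f (x, ξ) ∂μ) :=
  contDiff_infty.2 fun m => hf.contDiff_integral_nat m

theorem iteratedFDeriv_integral [CompleteSpace V] (hf : DominatedFamily μ f) (l : ℕ) (ξ : E) :
    iteratedFDeriv ℝ l (fun ξ => ∫ x, f (x, ξ) ∂μ) ξ =
      ∫ x, iteratedFDeriv ℝ l (fun η => f (x, η)) ξ ∂μ := by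
  induction l generalizing V with
  | zero =>
    ext m
    rw [ContinuousMultilinearMap.integral_apply (hf.integrable_iteratedFDeriv 0 ξ)]
    simp
  | succ l ih =>
    have hx : ∀ x, fderiv ℝ (fun η => f (x, η)) =
        fun η => (fderiv ℝ f (x, η)).comp (ContinuousLinearMap.inr ℝ X E) := fun x =>
      funext fun η => ((hf.1.differentiable (by simp) (x, η)).hasFDerivAt.comp η
        (hasFDerivAt_prodMk_right x η)).fderiv
    let e := (continuousMultilinearCurryRightEquiv' ℝ l E V).symm
    rw [iteratedFDeriv_succ_eq_comp_right, Function.comp_apply, hf.fderiv_integral,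
      ih hf.partialFDeriv]
    simp_rw [iteratedFDeriv_succ_eq_comp_right, Function.comp_apply, hx]
    exact (e.toContinuousLinearEquiv.toContinuousLinearMap.integral_comp_comm
      (hf.partialFDeriv.integrable_iteratedFDeriv l ξ)).symm

end DominatedFamily

theorem integrable_one_add_norm_pow_mul_iteratedFDeriv [MeasurableSpace X] [BorelSpace X]
    [SecondCountableTopology X] (μ : Measure X) [μ.HasTemperateGrowth] (φ : 𝓢(X, V)) (k l : ℕ) :
    Integrable (fun x => (1 + ‖x‖) ^ k * ‖iteratedFDeriv ℝ l φ x‖) μ := by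
  simp_rw [add_comm (1 : ℝ), add_pow, one_pow, mul_one, Finset.sum_mul]
  refine integrable_finsetSum _ fun i _ => ?_
  simp_rw [mul_right_comm _ _ ‖iteratedFDeriv ℝ l φ _‖]
  exact (φ.integrable_pow_mul_iteratedFDeriv μ i l).mul_const _

theorem integrable_one_add_norm_pow_mul [MeasurableSpace X] [BorelSpace X]
    [SecondCountableTopology X] (μ : Measure X) [μ.HasTemperateGrowth] (φ : 𝓢(X, V)) (k : ℕ) :
    Integrable (fun x => (1 + ‖x‖) ^ k * ‖φ x‖) μ := by
  simpa using integrable_one_add_norm_pow_mul_iteratedFDeriv μ φ k 0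

end Partial

/-! ### Families of test functions with compact support -/

section Families

variable {X : Type*} {E : Type} [NormedAddCommGroup X] [NormedSpace ℝ X]
  [NormedAddCommGroup E] [NormedSpace ℝ E]

theorem one_add_norm_prodMk_le {X E : Type*} [NormedAddCommGroup X] [NormedAddCommGroup E]
    {x : X} {ξ : E} {R : ℝ} (hξ : ‖ξ‖ ≤ R) :
    1 + ‖(x, ξ)‖ ≤ (1 + R) * (1 + ‖x‖) := by
  have hR : 0 ≤ R := (norm_nonneg ξ).trans hξ
  have := norm_nonneg x
  rw [Prod.norm_mk]
  rcases max_cases ‖x‖ ‖ξ‖ with h | h <;> rw [h.1] <;> nlinarith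

/-- A Schwartz function of the parameter compensates for the temperate growth of a family. -/
theorem dominatedFamily_mul [MeasurableSpace X] [BorelSpace X]
    [SecondCountableTopology X] (μ : Measure X) [μ.HasTemperateGrowth] (φ : 𝓢(X, ℂ))
    {c : X × E → ℂ} (hc : c.HasTemperateGrowth) :
    DominatedFamily μ (fun z => φ z.1 * c z) := by
  have hφ : ContDiff ℝ ∞ (fun z : X × E => φ z.1) := (φ.smooth ⊤).comp contDiff_fst
  refine ⟨hφ.mul hc.1, fun l R => ?_⟩
  obtain ⟨k, C, hC, hb⟩ := hc.norm_iteratedFDeriv_le_uniform l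
  refine ⟨fun x => ∑ i ∈ Finset.range (l + 1), (l.choose i * (C * (1 + R) ^ k)) *
    ((1 + ‖x‖) ^ k * ‖iteratedFDeriv ℝ i φ x‖), ?_, fun x ξ hξ => ?_⟩
  · exact integrable_finsetSum _ fun i _ =>
      (integrable_one_add_norm_pow_mul_iteratedFDeriv μ φ k i).const_mul _
  · refine (norm_iteratedFDeriv_mul_le hφ hc.1 (x, ξ) (by exact_mod_cast le_top)).trans
      (Finset.sum_le_sum fun i _ => ?_)
    have h1 : ‖iteratedFDeriv ℝ i (fun z : X × E => φ z.1) (x, ξ)‖ ≤ ‖iteratedFDeriv ℝ i φ x‖ := by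
      have h := (ContinuousLinearMap.fst ℝ X E).iteratedFDeriv_comp_right (φ.smooth ⊤) (x, ξ)
        (i := i) (by exact_mod_cast le_top)
      change iteratedFDeriv ℝ i (fun z : X × E => φ z.1) (x, ξ) = _ at h
      rw [h]
      refine (ContinuousMultilinearMap.norm_compContinuousLinearMap_le _ _).trans ?_
      exact mul_le_of_le_one_right (norm_nonneg _) (Finset.prod_le_one (fun _ _ => norm_nonneg _)
        fun _ _ => ContinuousLinearMap.norm_fst_le _ _ _)
    have h2 : ‖iteratedFDeriv ℝ (l - i) c (x, ξ)‖ ≤ C * (1 + R) ^ k * (1 + ‖x‖) ^ k := by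
      refine (hb _ (Nat.sub_le _ _) _).trans ?_
      rw [mul_assoc, ← mul_pow]
      gcongr
      exact one_add_norm_prodMk_le hξ
    calc _ ≤ l.choose i * ‖iteratedFDeriv ℝ i φ x‖ * (C * (1 + R) ^ k * (1 + ‖x‖) ^ k) := by
          gcongr
      _ = _ := by ring

variable (X E) in
/-- A family `b(x, ·)` of test functions depending on a parameter `x`: the function `b` and its
derivatives are polynomially bounded, and the supports of all `b(x, ·)` lie in one compact set. -/
structure CompactFamily where
  toFun : X × E → ℂ
  temperate : toFun.HasTemperateGrowth
  carrier : Set E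
  isCompact_carrier : IsCompact carrier
  eq_zero : ∀ x ξ, ξ ∉ carrier → toFun (x, ξ) = 0

namespace CompactFamily

variable (b : CompactFamily X E)

/-- The member `b(x, ·)` of the family, as a Schwartz function. -/
noncomputable def slice (x : X) : 𝓢(E, ℂ) :=
  HasCompactSupport.toSchwartzMap (f := fun ξ => b.toFun (x, ξ))
    (HasCompactSupport.intro b.isCompact_carrier (b.eq_zero x))
    (b.temperate.1.comp (contDiff_prodMk_right x))

@[simp]
theorem slice_apply (x : X) (ξ : E) : b.slice x ξ = b.toFun (x, ξ) := rfl

theorem iteratedFDeriv_eq_zero (l : ℕ) (x : X) {ξ : E} (hξ : ξ ∉ b.carrier) :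
    iteratedFDeriv ℝ l (b.slice x) ξ = 0 := by
  by_contra h
  have h1 : ξ ∈ Function.support (iteratedFDeriv ℝ l (b.slice x)) := h
  have h2 := support_iteratedFDeriv_subset l h1
  refine hξ (closure_minimal ?_ b.isCompact_carrier.isClosed h2)
  intro η hη
  by_contra hη'
  exact hη (b.eq_zero x η hη')

/-- Continuity in the Schwartz topology: the derivatives are jointly continuous, hence uniformly
close to each other on the common compact support. -/
theorem continuous_slice : Continuous b.slice := by
  refine continuous_iff_continuousAt.2 fun x₀ => ?_
  refine ((schwartz_withSeminorms ℂ E ℂ).tendsto_nhds _ _).2 fun i ε hε => ?_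
  have hcont : Continuous (fun z : X × E => ‖z.2‖ ^ i.1 *
      ‖iteratedFDeriv ℝ i.2 (fun η => b.toFun (z.1, η)) z.2 -
        iteratedFDeriv ℝ i.2 (fun η => b.toFun (x₀, η)) z.2‖) := by
    have h := continuous_iteratedFDeriv_prodMk_left b.temperate.1 i.2
    have h' : Continuous (fun z : X × E =>
        iteratedFDeriv ℝ i.2 (fun η => b.toFun (x₀, η)) z.2) :=
      h.comp (continuous_const.prodMk continuous_snd)
    fun_prop
  have hK := b.isCompact_carrier.eventually_forall_of_forall_eventually (x₀ := x₀)
    (P := fun x ξ => ‖ξ‖ ^ i.1 * ‖iteratedFDeriv ℝ i.2 (fun η => b.toFun (x, η)) ξ -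
        iteratedFDeriv ℝ i.2 (fun η => b.toFun (x₀, η)) ξ‖ < ε / 2) (fun ξ _ => by
      refine hcont.continuousAt.eventually_lt continuousAt_const ?_
      simpa using half_pos hε)
  filter_upwards [hK] with x hx
  refine lt_of_le_of_lt (SchwartzMap.seminorm_le_bound ℂ i.1 i.2 _ (half_pos hε).le
    fun ξ => ?_) (half_lt_self hε)
  have hsub : iteratedFDeriv ℝ i.2 (b.slice x - b.slice x₀) ξ =
      iteratedFDeriv ℝ i.2 (b.slice x) ξ - iteratedFDeriv ℝ i.2 (b.slice x₀) ξ :=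
    iteratedFDeriv_sub_apply ((b.slice x).contDiffAt i.2) ((b.slice x₀).contDiffAt i.2)
  by_cases hξ : ξ ∈ b.carrier
  · change ‖ξ‖ ^ i.1 * ‖iteratedFDeriv ℝ i.2 (b.slice x - b.slice x₀) ξ‖ ≤ _
    rw [hsub]
    exact (hx ξ hξ).le
  · change ‖ξ‖ ^ i.1 * ‖iteratedFDeriv ℝ i.2 (b.slice x - b.slice x₀) ξ‖ ≤ _
    rw [hsub, b.iteratedFDeriv_eq_zero _ _ hξ, b.iteratedFDeriv_eq_zero _ _ hξ]
    simpa using (half_pos hε).le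

theorem seminorm_slice_le (k l : ℕ) : ∃ (C : ℝ) (M : ℕ), 0 ≤ C ∧
    ∀ x, SchwartzMap.seminorm ℂ k l (b.slice x) ≤ C * (1 + ‖x‖) ^ M := by
  obtain ⟨R, hR, hb⟩ := b.isCompact_carrier.isBounded.exists_pos_norm_le
  obtain ⟨M, C, hC, hM⟩ := b.temperate.norm_iteratedFDeriv_le_uniform l
  refine ⟨R ^ k * (C * (1 + R) ^ M), M, by positivity, fun x => ?_⟩
  refine SchwartzMap.seminorm_le_bound ℂ k l _ (by positivity) fun ξ => ?_
  by_cases hξ : ξ ∈ b.carrier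
  · have h1 := (norm_iteratedFDeriv_prodMk_left_le b.temperate.1 l x ξ).trans (hM l le_rfl (x, ξ))
    have h2 : (1 + ‖(x, ξ)‖) ^ M ≤ ((1 + R) * (1 + ‖x‖)) ^ M :=
      pow_le_pow_left₀ (by positivity) (one_add_norm_prodMk_le (hb ξ hξ)) M
    calc ‖ξ‖ ^ k * ‖iteratedFDeriv ℝ l (b.slice x) ξ‖
        ≤ R ^ k * (C * ((1 + R) * (1 + ‖x‖)) ^ M) := by
          gcongr
          · exact hb ξ hξ
          · exact h1.trans (mul_le_mul_of_nonneg_left h2 hC)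
      _ = _ := by rw [mul_pow]; ring
  · rw [b.iteratedFDeriv_eq_zero _ _ hξ, norm_zero, mul_zero]
    positivity

theorem sup_seminorm_slice_le (s : Finset (ℕ × ℕ)) : ∃ (C : ℝ) (M : ℕ), 0 ≤ C ∧
    ∀ x, s.sup (schwartzSeminormFamily ℂ E ℂ) (b.slice x) ≤ C * (1 + ‖x‖) ^ M := by
  classical
  induction s using Finset.induction_on with
  | empty => exact ⟨0, 0, le_rfl, fun x => by simp⟩
  | insert i s _ ih =>
    obtain ⟨C₁, M₁, h₁, hb₁⟩ := b.seminorm_slice_le i.1 i.2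
    obtain ⟨C₂, M₂, h₂, hb₂⟩ := ih
    refine ⟨max C₁ C₂, max M₁ M₂, h₁.trans (le_max_left _ _), fun x => ?_⟩
    have hx : 1 ≤ 1 + ‖x‖ := by simp
    rw [Finset.sup_insert, Seminorm.sup_apply]
    refine max_le ((hb₁ x).trans ?_) ((hb₂ x).trans ?_) <;> gcongr
    all_goals first | exact hx | exact le_max_left _ _ | exact le_max_right _ _

end CompactFamily

/-- A tempered distribution is bounded by finitely many Schwartz seminorms. -/
theorem exists_norm_apply_le (F : 𝓢'(E, ℂ)) : ∃ (s : Finset (ℕ × ℕ)) (C : ℝ), 0 ≤ C ∧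
    ∀ g, ‖F g‖ ≤ C * s.sup (schwartzSeminormFamily ℂ E ℂ) g := by
  have hF : Continuous fun g => F g := ContinuousLinearMap.continuous (F : 𝓢(E, ℂ) →L[ℂ] ℂ)
  obtain ⟨s, C, -, h⟩ := Seminorm.bound_of_continuous (schwartz_withSeminorms ℂ E ℂ)
    ((normSeminorm ℂ ℂ).comp (ContinuousLinearMap.toLinearMap (F : 𝓢(E, ℂ) →L[ℂ] ℂ))) hF.norm
  exact ⟨s, C, C.2, fun g => h g⟩

namespace CompactFamily

variable (b : CompactFamily X E) (F : 𝓢'(E, ℂ))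

theorem continuous_apply_slice : Continuous fun x => F (b.slice x) :=
  (ContinuousLinearMap.continuous (F : 𝓢(E, ℂ) →L[ℂ] ℂ)).comp b.continuous_slice

theorem norm_apply_slice_le : ∃ (C : ℝ) (M : ℕ), 0 ≤ C ∧
    ∀ x, ‖F (b.slice x)‖ ≤ C * (1 + ‖x‖) ^ M := by
  obtain ⟨s, C, hC, h⟩ := exists_norm_apply_le F
  obtain ⟨C', M, hC', h'⟩ := b.sup_seminorm_slice_le s
  refine ⟨C * C', M, by positivity, fun x => (h _).trans ?_⟩
  rw [mul_assoc]
  exact mul_le_mul_of_nonneg_left (h' x) hC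

end CompactFamily

end Families

/-! ### Interchanging a tempered distribution with an integral -/

section Exchange

variable {X : Type*} {E : Type} [NormedAddCommGroup X] [NormedSpace ℝ X]
  [NormedAddCommGroup E] [NormedSpace ℝ E]

variable (E) in
/-- The map `g ↦ |ξ|ᵏ Dˡg(ξ)` into the bounded continuous functions. Its norm is the Schwartz
seminorm with indices `k` and `l`. -/
noncomputable def weightedJet (k l : ℕ) :
    𝓢(E, ℂ) →L[ℂ] BoundedContinuousFunction E (E [×l]→L[ℝ] ℂ) :=
  SchwartzMap.mkCLMtoNormedSpace (𝕜 := ℂ) (𝕜' := ℂ) (σ := RingHom.id ℂ) (D := E) (E := ℂ)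
    (G := BoundedContinuousFunction E (E [×l]→L[ℝ] ℂ))
    (fun g => BoundedContinuousFunction.ofNormedAddCommGroup
      (fun ξ => ‖ξ‖ ^ k • iteratedFDeriv ℝ l g ξ)
      ((continuous_norm (E := E) |>.pow k).smul
        ((g.smooth ⊤).continuous_iteratedFDeriv (by exact_mod_cast le_top)))
      (SchwartzMap.seminorm ℂ k l g) (fun ξ => by
        rw [norm_smul, norm_pow, norm_norm]
        exact SchwartzMap.le_seminorm ℂ k l g ξ))
    (fun f g => by
      ext1 ξ
      have h : iteratedFDeriv ℝ l (f + g : 𝓢(E, ℂ)) ξ =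
          iteratedFDeriv ℝ l f ξ + iteratedFDeriv ℝ l g ξ :=
        iteratedFDeriv_add_apply (f.contDiffAt l) (g.contDiffAt l)
      change ‖ξ‖ ^ k • iteratedFDeriv ℝ l (f + g : 𝓢(E, ℂ)) ξ =
        ‖ξ‖ ^ k • iteratedFDeriv ℝ l f ξ + ‖ξ‖ ^ k • iteratedFDeriv ℝ l g ξ
      rw [h, smul_add])
    (fun a g => by
      ext1 ξ
      have h : iteratedFDeriv ℝ l (a • g : 𝓢(E, ℂ)) ξ = a • iteratedFDeriv ℝ l g ξ :=
        iteratedFDeriv_const_smul_apply (g.contDiffAt l)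
      change ‖ξ‖ ^ k • iteratedFDeriv ℝ l (a • g : 𝓢(E, ℂ)) ξ =
        a • (‖ξ‖ ^ k • iteratedFDeriv ℝ l g ξ)
      rw [h, smul_comm])
    ⟨{(k, l)}, 1, zero_le_one, fun g => by
      rw [Finset.sup_singleton, one_mul]
      refine BoundedContinuousFunction.norm_ofNormedAddCommGroup_le _ (apply_nonneg _ _) _⟩

@[simp]
theorem weightedJet_apply (k l : ℕ) (g : 𝓢(E, ℂ)) (ξ : E) :
    weightedJet E k l g ξ = ‖ξ‖ ^ k • iteratedFDeriv ℝ l g ξ := rfl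

theorem norm_weightedJet (k l : ℕ) (g : 𝓢(E, ℂ)) :
    ‖weightedJet E k l g‖ = SchwartzMap.seminorm ℂ k l g := by
  refine le_antisymm ((BoundedContinuousFunction.norm_le (apply_nonneg _ _)).2 fun ξ => ?_)
    (SchwartzMap.seminorm_le_bound ℂ k l g (norm_nonneg (weightedJet E k l g)) fun ξ => ?_)
  · rw [weightedJet_apply, norm_smul, norm_pow, norm_norm]
    exact SchwartzMap.le_seminorm ℂ k l g ξ
  · have h := (weightedJet E k l g).norm_coe_le_norm ξ
    rwa [weightedJet_apply, norm_smul, norm_pow, norm_norm] at h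

variable (E) in
/-- The Banach space of tuples of bounded continuous functions in which the weighted derivatives
with indices in `s` take their values. -/
def JetSpace (s : Finset (ℕ × ℕ)) : Type :=
  (i : s) → BoundedContinuousFunction E (E [×i.1.2]→L[ℝ] ℂ)

noncomputable instance (s : Finset (ℕ × ℕ)) : NormedAddCommGroup (JetSpace E s) :=
  inferInstanceAs (NormedAddCommGroup
    ((i : s) → BoundedContinuousFunction E (E [×i.1.2]→L[ℝ] ℂ)))

noncomputable instance (s : Finset (ℕ × ℕ)) : NormedSpace ℂ (JetSpace E s) :=
  inferInstanceAs (NormedSpace ℂ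
    ((i : s) → BoundedContinuousFunction E (E [×i.1.2]→L[ℝ] ℂ)))

instance (s : Finset (ℕ × ℕ)) : CompleteSpace (JetSpace E s) :=
  inferInstanceAs (CompleteSpace
    ((i : s) → BoundedContinuousFunction E (E [×i.1.2]→L[ℝ] ℂ)))

/-- The evaluation of a component of a tuple at a point. -/
noncomputable def JetSpace.eval (s : Finset (ℕ × ℕ)) (i : s) (ξ : E) :
    JetSpace E s →L[ℂ] (E [×i.1.2]→L[ℝ] ℂ) :=
  LinearMap.mkContinuous
    { toFun := fun y => y i ξ
      map_add' := fun _ _ => rfl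
      map_smul' := fun _ _ => rfl } 1 fun y => by
    rw [one_mul]
    exact ((y i).norm_coe_le_norm ξ).trans (norm_le_pi_norm
      (G := fun i : s => BoundedContinuousFunction E (E [×i.1.2]→L[ℝ] ℂ)) y i)

variable (E) in
/-- Finitely many of the maps `weightedJet`, as one map into a Banach space. -/
noncomputable def jetPi (s : Finset (ℕ × ℕ)) : 𝓢(E, ℂ) →L[ℂ] JetSpace E s where
  toFun g i := weightedJet E i.1.1 i.1.2 g
  map_add' f g := funext fun i => map_add (weightedJet E i.1.1 i.1.2) f g
  map_smul' a g := funext fun i => map_smul (weightedJet E i.1.1 i.1.2) a g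
  cont := continuous_pi fun i => (weightedJet E i.1.1 i.1.2).continuous

theorem norm_jetPi (s : Finset (ℕ × ℕ)) (g : 𝓢(E, ℂ)) :
    ‖jetPi E s g‖ = s.sup (schwartzSeminormFamily ℂ E ℂ) g := by
  refine le_antisymm ((pi_norm_le_iff_of_nonneg
    (G := fun i : s => BoundedContinuousFunction E (E [×i.1.2]→L[ℝ] ℂ))
    (apply_nonneg _ _)).2 fun i => ?_)
    (Seminorm.finset_sup_apply_le (norm_nonneg _) fun i hi => ?_)
  · change ‖weightedJet E i.1.1 i.1.2 g‖ ≤ _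
    rw [norm_weightedJet]
    exact Seminorm.le_finset_sup_apply (p := schwartzSeminormFamily ℂ E ℂ) i.2
  · rw [schwartzSeminormFamily_apply, ← norm_weightedJet]
    exact norm_le_pi_norm
      (G := fun i : s => BoundedContinuousFunction E (E [×i.1.2]→L[ℝ] ℂ)) (jetPi E s g) ⟨i, hi⟩

/-- By the Hahn-Banach theorem, a tempered distribution extends to a continuous functional of
finitely many weighted derivatives. -/
theorem exists_eq_comp_jetPi (F : 𝓢'(E, ℂ)) : ∃ (s : Finset (ℕ × ℕ))
    (f : JetSpace E s →L[ℂ] ℂ),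
      ∀ g, F g = f (jetPi E s g) := by
  obtain ⟨s, C, hC, h⟩ := exists_norm_apply_le F
  let J := (jetPi E s).toLinearMap
  let F₀ : 𝓢(E, ℂ) →ₗ[ℂ] ℂ := ContinuousLinearMap.toLinearMap (F : 𝓢(E, ℂ) →L[ℂ] ℂ)
  have hker : LinearMap.ker J ≤ LinearMap.ker F₀ := fun g hg => by
    have h1 := h g
    rw [← norm_jetPi, show jetPi E s g = 0 from hg, norm_zero, mul_zero] at h1
    exact norm_le_zero_iff.1 h1
  let f₁ : LinearMap.range J →ₗ[ℂ] ℂ :=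
    (LinearMap.ker J).liftQ F₀ hker ∘ₗ J.quotKerEquivRange.symm.toLinearMap
  have hf₁ : ∀ g, f₁ ⟨jetPi E s g, ⟨g, rfl⟩⟩ = F g := fun g => by
    have h1 : J.quotKerEquivRange.symm ⟨J g, ⟨g, rfl⟩⟩ = (LinearMap.ker J).mkQ g := by
      rw [LinearEquiv.symm_apply_eq]
      rfl
    change (LinearMap.ker J).liftQ F₀ hker (J.quotKerEquivRange.symm ⟨J g, ⟨g, rfl⟩⟩) = F g
    rw [h1]
    rfl
  let f₀ : LinearMap.range J →L[ℂ] ℂ := f₁.mkContinuous C fun y => by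
    obtain ⟨_, g, rfl⟩ := y
    refine (congrArg norm (hf₁ g)).trans_le ((h g).trans_eq ?_)
    rw [← norm_jetPi]
    rfl
  obtain ⟨f, hf, -⟩ := exists_extension_norm_eq (LinearMap.range J) f₀
  exact ⟨s, f, fun g => ((hf ⟨jetPi E s g, ⟨g, rfl⟩⟩).trans (hf₁ g)).symm⟩

variable [MeasurableSpace X] [BorelSpace X] [SecondCountableTopology X] (μ : Measure X)
  [μ.HasTemperateGrowth]

/-- A tempered distribution may be applied under the integral sign. By `exists_eq_comp_jetPi` it
suffices to integrate with values in a Banach space, where bounded functionals commute with the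
Bochner integral. -/
theorem CompactFamily.apply_eq_integral (F : 𝓢'(E, ℂ)) (b : CompactFamily X E) (φ : 𝓢(X, ℂ))
    (G : 𝓢(E, ℂ)) (hG : ∀ ξ, G ξ = ∫ x, φ x * b.toFun (x, ξ) ∂μ) :
    F G = ∫ x, φ x * F (b.slice x) ∂μ := by
  obtain ⟨s, f, hf⟩ := exists_eq_comp_jetPi F
  have hint : Integrable (fun x => φ x • jetPi E s (b.slice x)) μ := by
    obtain ⟨C, M, hC, h⟩ := b.sup_seminorm_slice_le s
    refine ((integrable_one_add_norm_pow_mul μ φ M).const_mul C).mono'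
      (φ.continuous.smul ((jetPi E s).continuous.comp b.continuous_slice)).aestronglyMeasurable
      (Eventually.of_forall fun x => ?_)
    rw [norm_smul, norm_jetPi, mul_comm, ← mul_assoc]
    exact mul_le_mul_of_nonneg_right (h x) (norm_nonneg _)
  have hdom := dominatedFamily_mul μ φ b.temperate
  have hJ : jetPi E s G = ∫ x, φ x • jetPi E s (b.slice x) ∂μ := by
    funext i
    ext1 ξ
    let ev := JetSpace.eval s i ξ
    have h1 := ev.integral_comp_comm hint
    have hGf : (G : E → ℂ) = fun ξ => ∫ x, φ x * b.toFun (x, ξ) ∂μ := funext hG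
    have h2 : ∀ x, ev (φ x • jetPi E s (b.slice x)) =
        ‖ξ‖ ^ i.1.1 • iteratedFDeriv ℝ i.1.2 (fun η => φ x * b.toFun (x, η)) ξ := fun x => by
      have h3 : iteratedFDeriv ℝ i.1.2 (fun η => φ x * b.toFun (x, η)) ξ =
          φ x • iteratedFDeriv ℝ i.1.2 (b.slice x) ξ := by
        rw [← iteratedFDeriv_const_smul_apply ((b.slice x).contDiffAt i.1.2)]
        rfl
      rw [h3, smul_comm, map_smul]
      rfl
    change ‖ξ‖ ^ i.1.1 • iteratedFDeriv ℝ i.1.2 G ξ = ev (∫ x, φ x • jetPi E s (b.slice x) ∂μ)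
    rw [← h1, hGf, hdom.iteratedFDeriv_integral]
    simp_rw [h2]
    rw [integral_smul]
  rw [hf, hJ, ← f.integral_comp_comm hint]
  simp_rw [map_smul, ← hf, smul_eq_mul]

end Exchange

/-! ### Tempered distributions given by polynomially bounded functions -/

section Represents

variable {n : ℕ}

theorem integrable_mul_of_norm_le {h : Rn n → ℂ} (hm : AEStronglyMeasurable h) {C : ℝ} {M : ℕ}
    (hb : ∀ x, ‖h x‖ ≤ C * (1 + ‖x‖) ^ M) (φ : 𝓢(Rn n, ℂ)) :
    Integrable (fun x => φ x * h x) := by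
  refine ((integrable_one_add_norm_pow_mul volume φ M).const_mul C).mono'
    (φ.continuous.aestronglyMeasurable.mul hm) (Eventually.of_forall fun x => ?_)
  rw [norm_mul, mul_comm, ← mul_assoc]
  exact mul_le_mul_of_nonneg_right (hb x) (norm_nonneg _)

/-- A measurable function of polynomial growth is a tempered distribution. -/
theorem exists_represents {h : Rn n → ℂ} (hm : AEStronglyMeasurable h) {C : ℝ} {M : ℕ}
    (hb : ∀ x, ‖h x‖ ≤ C * (1 + ‖x‖) ^ M) : ∃ w : 𝓢'(Rn n, ℂ), Represents w h := by
  have hC : 0 ≤ C := by simpa using (norm_nonneg _).trans (hb 0)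
  have hint := integrable_mul_of_norm_le hm hb
  set N := (volume : Measure (Rn n)).integrablePower
  have hN := Measure.integrable_pow_neg_integrablePower (volume : Measure (Rn n))
  let A : 𝓢(Rn n, ℂ) →L[ℂ] ℂ := SchwartzMap.mkCLMtoNormedSpace (𝕜 := ℂ) (𝕜' := ℂ)
    (σ := RingHom.id ℂ) (fun φ => ∫ x, φ x * h x)
    (fun f g => by
      rw [← integral_add (hint f) (hint g)]
      exact integral_congr_ae (Eventually.of_forall fun x => by simp [add_mul]))
    (fun a f => by
      rw [RingHom.id_apply, smul_eq_mul, ← integral_const_mul]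
      exact integral_congr_ae (Eventually.of_forall fun x => by simp [mul_assoc]))
    ⟨Finset.Iic (M + N, 0), C * 2 ^ (M + N) * ∫ x : Rn n, (1 + ‖x‖) ^ (-(N : ℝ)), by
      have : 0 ≤ ∫ x : Rn n, (1 + ‖x‖) ^ (-(N : ℝ)) :=
        integral_nonneg fun x => by positivity
      positivity, fun φ => by
      set p := (Finset.Iic (M + N, 0)).sup (schwartzSeminormFamily ℂ (Rn n) ℂ) φ with hp
      have hpt : ∀ x, ‖φ x * h x‖ ≤ C * 2 ^ (M + N) * p * (1 + ‖x‖) ^ (-(N : ℝ)) := fun x => by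
        have h1 := SchwartzMap.one_add_le_sup_seminorm_apply (𝕜 := ℂ) (m := (M + N, 0))
          (k := M + N) (n := 0) le_rfl le_rfl φ x
        rw [norm_iteratedFDeriv_zero] at h1
        change _ ≤ 2 ^ (M + N) * p at h1
        have hpos : (0 : ℝ) < 1 + ‖x‖ := by positivity
        rw [Real.rpow_neg hpos.le, Real.rpow_natCast, ← div_eq_mul_inv,
          le_div_iff₀ (by positivity), norm_mul]
        calc ‖φ x‖ * ‖h x‖ * (1 + ‖x‖) ^ N ≤ ‖φ x‖ * (C * (1 + ‖x‖) ^ M) * (1 + ‖x‖) ^ N := by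
              gcongr; exact hb x
          _ = C * ((1 + ‖x‖) ^ (M + N) * ‖φ x‖) := by rw [pow_add]; ring
          _ ≤ C * (2 ^ (M + N) * p) := by gcongr
          _ = _ := by ring
      refine (norm_integral_le_of_norm_le (hN.const_mul _) (Eventually.of_forall hpt)).trans_eq ?_
      rw [integral_const_mul]
      ring⟩
  exact ⟨ContinuousLinearMap.toPointwiseConvergenceCLM ℂ (RingHom.id ℂ) _ _ A,
    fun φ => ⟨hint φ, rfl⟩⟩

theorem Represents.eq {w w' : 𝓢'(Rn n, ℂ)} {h : Rn n → ℂ} (hw : Represents w h)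
    (hw' : Represents w' h) : w = w' := by
  ext φ
  rw [(hw φ).2, (hw' φ).2]

theorem Represents.add {w w' : 𝓢'(Rn n, ℂ)} {h h' : Rn n → ℂ} (hw : Represents w h)
    (hw' : Represents w' h') : Represents (w + w') (fun x => h x + h' x) := fun φ => by
  simp_rw [mul_add]
  refine ⟨(hw φ).1.add (hw' φ).1, ?_⟩
  rw [integral_add (hw φ).1 (hw' φ).1, ← (hw φ).2, ← (hw' φ).2]
  rfl

theorem Represents.smul {w : 𝓢'(Rn n, ℂ)} {h : Rn n → ℂ} (hw : Represents w h) (c : ℂ) :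
    Represents (c • w) (fun x => c * h x) := fun φ => by
  simp_rw [mul_left_comm _ c]
  refine ⟨(hw φ).1.const_mul c, ?_⟩
  rw [integral_const_mul, ← (hw φ).2]
  rfl

theorem represents_zero : Represents (0 : 𝓢'(Rn n, ℂ)) (fun _ => 0) := fun φ => by
  simp only [mul_zero, integral_zero]
  exact ⟨integrable_zero _ _ _, rfl⟩

theorem represents_sum {ι : Type*} (s : Finset ι) {w : ι → 𝓢'(Rn n, ℂ)} {h : ι → Rn n → ℂ}
    (hw : ∀ i ∈ s, Represents (w i) (h i)) :
    Represents (∑ i ∈ s, w i) (fun x => ∑ i ∈ s, h i x) := by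
  classical
  induction s using Finset.induction_on with
  | empty => simpa using represents_zero
  | insert i s hi ih =>
    simp_rw [Finset.sum_insert hi]
    exact (hw i (Finset.mem_insert_self _ _)).add
      (ih fun j hj => hw j (Finset.mem_insert_of_mem hj))

/-- Pointwise convergence with a uniform polynomial bound implies convergence of the corresponding
distributions. -/
theorem tendsto_of_represents {w : ℕ → 𝓢'(Rn n, ℂ)} {h : ℕ → Rn n → ℂ} {w₀ : 𝓢'(Rn n, ℂ)}
    {h₀ : Rn n → ℂ} (hw : ∀ N, Represents (w N) (h N)) (hw₀ : Represents w₀ h₀) {C : ℝ} {M : ℕ}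
    (hb : ∀ N x, ‖h N x‖ ≤ C * (1 + ‖x‖) ^ M)
    (hlim : ∀ x, Tendsto (fun N => h N x) atTop (𝓝 (h₀ x))) : Tendsto w atTop (𝓝 w₀) := by
  refine PointwiseConvergenceCLM.tendsto_iff_forall_tendsto.2 fun φ => ?_
  simp_rw [(hw₀ φ).2, fun N => (hw N φ).2]
  refine tendsto_integral_of_dominated_convergence (fun x => C * ((1 + ‖x‖) ^ M * ‖φ x‖))
    (fun N => (hw N φ).1.aestronglyMeasurable)
    ((integrable_one_add_norm_pow_mul volume φ M).const_mul C)
    (fun N => Eventually.of_forall fun x => ?_)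
    (Eventually.of_forall fun x => (hlim x).const_mul _)
  rw [norm_mul, mul_comm, ← mul_assoc]
  exact mul_le_mul_of_nonneg_right (hb N x) (norm_nonneg _)

/-- The Schwartz functions are dense in `S'` for the weak-* topology: a continuous functional on
`S'` is the evaluation at a Schwartz function, which is zero if its integrals against all test
functions vanish. -/
theorem continuousLinearMap_ext_of_schwartz {T T' : 𝓢'(Rn n, ℂ) →L[ℂ] 𝓢'(Rn n, ℂ)}
    (h : ∀ v : 𝓢(Rn n, ℂ), T (v : 𝓢'(Rn n, ℂ)) = T' (v : 𝓢'(Rn n, ℂ))) : T = T' := by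
  ext u φ
  let l : 𝓢'(Rn n, ℂ) →L[ℂ] ℂ :=
    (PointwiseConvergenceCLM.evalCLM (RingHom.id ℂ) ℂ φ).comp (T - T')
  let l' : WeakDual ℂ 𝓢(Rn n, ℂ) →L[ℂ] ℂ :=
    l.comp (PointwiseConvergenceCLM.equivWeakDual ℂ 𝓢(Rn n, ℂ)).symm.toContinuousLinearMap
  obtain ⟨ψ, hψ⟩ := LinearMap.dualEmbedding_surjective
    (topDualPairing ℂ 𝓢(Rn n, ℂ)) l'
  have hl : ∀ u : 𝓢'(Rn n, ℂ), l u = u ψ := fun u =>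
    (congrArg (fun f => f (PointwiseConvergenceCLM.equivWeakDual ℂ 𝓢(Rn n, ℂ) u)) hψ).symm
  have hlv : ∀ v : 𝓢(Rn n, ℂ), l (v : 𝓢'(Rn n, ℂ)) = 0 := fun v => by
    change (T (v : 𝓢'(Rn n, ℂ)) - T' (v : 𝓢'(Rn n, ℂ))) φ = 0
    rw [h v, sub_self]
    rfl
  have hψ0 : ψ = 0 := by
    have h1 : ∀ g : Rn n → ℝ, ContDiff ℝ ∞ g → HasCompactSupport g → ∫ x, g x • ψ x = 0 := by
      intro g hg hgc
      have hgc' : HasCompactSupport (fun x => (g x : ℂ)) := hgc.comp_left Complex.ofReal_zero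
      have h2 := hlv (hgc'.toSchwartzMap (Complex.ofRealCLM.contDiff.comp hg))
      rw [hl, SchwartzMap.coe_apply] at h2
      rw [← h2]
      refine integral_congr_ae (Eventually.of_forall fun x => ?_)
      exact (Complex.real_smul ..).trans (mul_comm _ _)
    have h2 := ae_eq_zero_of_integral_contDiff_smul_eq_zero (μ := volume)
      ψ.continuous.locallyIntegrable h1
    have h3 := (ψ.continuous.ae_eq_iff_eq volume continuous_zero).1 h2
    ext x
    exact congrFun h3 x
  have h1 : l u = 0 := by rw [hl, hψ0, map_zero]
  have h2 : (T u - T' u) φ = 0 := h1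
  exact sub_eq_zero.1 h2

end Represents

/-! ### The support of a tempered distribution -/

section Support

variable {E : Type} [NormedAddCommGroup E] [NormedSpace ℝ E]

/-- Multiplication by the members of a temperate family is bounded on a Schwartz function,
uniformly for bounded values of the parameter. -/
theorem norm_iteratedFDeriv_mul_schwartz_le {c : ℝ × E → ℂ} (hc : c.HasTemperateGrowth)
    (g : 𝓢(E, ℂ)) (k l : ℕ) : ∃ C : ℝ, 0 ≤ C ∧ ∀ t : ℝ, |t| ≤ 1 → ∀ ξ : E,
      ‖ξ‖ ^ k * ‖iteratedFDeriv ℝ l (fun η => c (t, η) * g η) ξ‖ ≤ C := by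
  obtain ⟨M, C, hC, hb⟩ := hc.norm_iteratedFDeriv_le_uniform l
  refine ⟨∑ i ∈ Finset.range (l + 1), l.choose i * (C * 2 ^ M) *
    (2 ^ (M + k) * (Finset.Iic (M + k, l)).sup (schwartzSeminormFamily ℂ E ℂ) g),
    Finset.sum_nonneg fun i _ => by positivity, fun t ht ξ => ?_⟩
  have hct : ContDiff ℝ ∞ (fun η => c (t, η)) := hc.1.comp (contDiff_prodMk_right t)
  have hpos : (0 : ℝ) < 1 + ‖ξ‖ := by positivity
  refine (mul_le_mul_of_nonneg_left (norm_iteratedFDeriv_mul_le hct (g.smooth ⊤) ξ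
    (by exact_mod_cast le_top)) (by positivity)).trans ?_
  rw [Finset.mul_sum]
  refine Finset.sum_le_sum fun i _ => ?_
  have h1 : ‖iteratedFDeriv ℝ i (fun η => c (t, η)) ξ‖ ≤ C * 2 ^ M * (1 + ‖ξ‖) ^ M := by
    refine (norm_iteratedFDeriv_prodMk_left_le hc.1 i t ξ).trans ((hb _ ?_ _).trans ?_)
    · rename_i hi
      exact Nat.lt_succ_iff.1 (Finset.mem_range.1 hi)
    · rw [mul_assoc, ← mul_pow]
      gcongr
      rw [Prod.norm_mk, Real.norm_eq_abs]
      have := norm_nonneg ξ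
      rcases max_cases |t| ‖ξ‖ with h | h <;> rw [h.1] <;> linarith
  have h2 := SchwartzMap.one_add_le_sup_seminorm_apply (𝕜 := ℂ) (m := (M + k, l))
          (k := M + k) (n := l - i) le_rfl (Nat.sub_le _ _) g ξ
  calc ‖ξ‖ ^ k * (l.choose i * ‖iteratedFDeriv ℝ i (fun η => c (t, η)) ξ‖ *
        ‖iteratedFDeriv ℝ (l - i) g ξ‖)
      ≤ (1 + ‖ξ‖) ^ k * (l.choose i * (C * 2 ^ M * (1 + ‖ξ‖) ^ M) *
        ‖iteratedFDeriv ℝ (l - i) g ξ‖) := by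
        gcongr
        linarith
    _ = l.choose i * (C * 2 ^ M) * ((1 + ‖ξ‖) ^ (M + k) * ‖iteratedFDeriv ℝ (l - i) g ξ‖) := by
        rw [pow_add]; ring
    _ ≤ _ := mul_le_mul_of_nonneg_left h2 (by positivity)

/-- The compactly supported functions `ψ(·/N) g` converge to `g` in the Schwartz space. -/
theorem tendsto_cutoff_mul {ψ : E → ℂ} (hψ : ContDiff ℝ ∞ ψ) (hψc : HasCompactSupport ψ)
    (hψ1 : ∀ ξ, ‖ξ‖ ≤ 1 → ψ ξ = 1) (g : 𝓢(E, ℂ)) (G : ℕ → 𝓢(E, ℂ))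
    (hG : ∀ N ξ, G N ξ = ψ ((N + 1 : ℝ)⁻¹ • ξ) * g ξ) : Tendsto G atTop (𝓝 g) := by
  refine ((schwartz_withSeminorms ℂ E ℂ).tendsto_nhds _ _).2 fun i ε hε => ?_
  have hc : Function.HasTemperateGrowth (fun z : ℝ × E => ψ (z.1 • z.2) - 1) := by
    have h1 := hψc.hasTemperateGrowth hψ
    have h2 : Function.HasTemperateGrowth (fun z : ℝ × E => z.1 • z.2) :=
      Function.HasTemperateGrowth.smul (ContinuousLinearMap.fst ℝ ℝ E).hasTemperateGrowth
        (ContinuousLinearMap.snd ℝ ℝ E).hasTemperateGrowth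
    exact (h1.comp h2).sub (.const 1)
  obtain ⟨C, hC, hb⟩ := norm_iteratedFDeriv_mul_schwartz_le hc g (i.1 + 1) i.2
  have hlim : Tendsto (fun N : ℕ => (N + 1 : ℝ)⁻¹ * C) atTop (𝓝 0) := by
    have h := (tendsto_one_div_add_atTop_nhds_zero_nat (𝕜 := ℝ)).mul_const C
    simpa using h
  filter_upwards [hlim.eventually_lt_const hε] with N hN
  refine lt_of_le_of_lt (SchwartzMap.seminorm_le_bound ℂ i.1 i.2 _ (by positivity) fun ξ => ?_) hN
  set t : ℝ := (N + 1 : ℝ)⁻¹ with ht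
  have ht0 : 0 < t := by positivity
  have hfun : (G N - g : 𝓢(E, ℂ)) = fun η => (ψ (t • η) - 1) * g η := by
    ext η
    simp [hG, sub_mul, ht]
  rw [hfun]
  by_cases hξ : t * ‖ξ‖ < 1
  · -- near the origin the cut-off function is constant
    have h0 : (fun η => (ψ (t • η) - 1) * g η) =ᶠ[𝓝 ξ] fun _ => (0 : ℂ) := by
      have hopen : ∀ᶠ η in 𝓝 ξ, t * ‖η‖ < 1 :=
        (continuous_const.mul continuous_norm).continuousAt.eventually_lt continuousAt_const hξ
      filter_upwards [hopen] with η hη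
      rw [hψ1 _ (by rw [norm_smul, Real.norm_of_nonneg ht0.le]; exact hη.le), sub_self, zero_mul]
    rw [(h0.iteratedFDeriv ℝ i.2).eq_of_nhds]
    simp only [iteratedFDeriv_fun_zero, Pi.zero_apply, norm_zero, mul_zero]
    positivity
  · have h1 := hb t (by
      rw [abs_of_pos ht0, ht]
      exact inv_le_one_of_one_le₀ (by have := N.cast_nonneg (α := ℝ); linarith)) ξ
    calc _ ≤ (t * ‖ξ‖) * (‖ξ‖ ^ i.1 *
          ‖iteratedFDeriv ℝ i.2 (fun η => (ψ (t • η) - 1) * g η) ξ‖) :=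
          le_mul_of_one_le_left (by positivity) (not_lt.1 hξ)
      _ = t * (‖ξ‖ ^ (i.1 + 1) *
          ‖iteratedFDeriv ℝ i.2 (fun η => (ψ (t • η) - 1) * g η) ξ‖) := by rw [pow_succ]; ring
      _ ≤ t * C := by gcongr

variable [FiniteDimensional ℝ E]

open Distribution in
/-- A tempered distribution vanishes on the test functions with compact support in the complement
of its support. -/
theorem apply_eq_zero_of_hasCompactSupport (F : 𝓢'(E, ℂ)) (g : 𝓢(E, ℂ)) (hg : HasCompactSupport g)
    (hd : Disjoint (tsupport g) (dsupport F)) : F g = 0 := by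
  have hcov : ∀ ξ : tsupport g, ∃ s : Set E, IsVanishingOn F s ∧ IsOpen s ∧ (ξ : E) ∈ s :=
    fun ξ => (notMem_dsupport_iff (f := F) _).1 (Set.disjoint_left.1 hd ξ.2)
  choose U hUv hUo hUm using hcov
  obtain ⟨t, ht⟩ := hg.isCompact.elim_finite_subcover U hUo
    (fun ξ hξ => Set.mem_iUnion.2 ⟨⟨ξ, hξ⟩, hUm ⟨ξ, hξ⟩⟩)
  -- a partition of unity splits `g` into pieces supported where `F` vanishes
  obtain ⟨f, hf⟩ := SmoothPartitionOfUnity.exists_isSubordinate (modelWithCornersSelf ℝ E)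
    (isClosed_tsupport g) (fun i : t => U i) (fun i => hUo i) (by
      intro ξ hξ
      obtain ⟨i, hi, hξi⟩ := Set.mem_iUnion₂.1 (ht hξ)
      exact Set.mem_iUnion.2 ⟨⟨i, hi⟩, hξi⟩)
  have hsm : ∀ i, ContDiff ℝ ∞ (fun ξ => (f i ξ : ℂ)) := fun i =>
    Complex.ofRealCLM.contDiff.comp (f i).contMDiff.contDiff
  let h : t → 𝓢(E, ℂ) := fun i =>
    HasCompactSupport.toSchwartzMap (f := fun ξ => (f i ξ : ℂ) * g ξ)
      (hg.mul_left) ((hsm i).mul (g.smooth ⊤))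
  have hsum : g = ∑ i, h i := by
    ext ξ
    have h1 : (∑ i, h i) ξ = (∑ i, (f i ξ : ℂ)) * g ξ := by
      rw [Finset.sum_mul]
      simp [h]
    rw [h1]
    by_cases hξ : ξ ∈ tsupport g
    · have h2 := f.sum_eq_one hξ
      rw [finsum_eq_sum_of_fintype] at h2
      rw [← Complex.ofReal_sum, h2, Complex.ofReal_one, one_mul]
    · rw [image_eq_zero_of_notMem_tsupport hξ, mul_zero]
  rw [hsum, map_sum]
  refine Finset.sum_eq_zero fun i _ => hUv i (h i) ?_
  refine Set.Subset.trans ?_ (hf i)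
  refine closure_mono fun ξ hξ => ?_
  intro h0
  apply hξ
  change (f i ξ : ℂ) * g ξ = 0
  rw [h0, Complex.ofReal_zero, zero_mul]

open Distribution in
/-- The value of a tempered distribution at a test function depends only on the test function near
the support of the distribution. -/
theorem apply_congr_of_eqOn (F : 𝓢'(E, ℂ)) {g g' : 𝓢(E, ℂ)} {s : Set E} (hs : IsOpen s)
    (hFs : dsupport F ⊆ s) (h : ∀ ξ ∈ s, g ξ = g' ξ) : F g = F g' := by
  rw [← sub_eq_zero, ← map_sub]
  set r := g - g' with hr
  have hrs : ∀ ξ ∈ s, r ξ = 0 := fun ξ hξ => by simp [hr, h ξ hξ]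
  -- the difference need not have compact support, so it is cut off at infinity first
  let ψ : ContDiffBump (0 : E) := ⟨1, 2, one_pos, one_lt_two⟩
  have hψ : ContDiff ℝ ∞ (fun ξ => (ψ ξ : ℂ)) := Complex.ofRealCLM.contDiff.comp ψ.contDiff
  have hψc : HasCompactSupport (fun ξ => (ψ ξ : ℂ)) :=
    ψ.hasCompactSupport.comp_left Complex.ofReal_zero
  have hsm : ∀ N : ℕ, ContDiff ℝ ∞ (fun ξ => (ψ ((N + 1 : ℝ)⁻¹ • ξ) : ℂ) * r ξ) := fun N =>
    (hψ.comp (contDiff_const_smul _)).mul (r.smooth ⊤)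
  have hcs : ∀ N : ℕ, HasCompactSupport (fun ξ => (ψ ((N + 1 : ℝ)⁻¹ • ξ) : ℂ) * r ξ) := fun N =>
    (hψc.comp_smul (by positivity : (N + 1 : ℝ)⁻¹ ≠ 0)).mul_right
  let G : ℕ → 𝓢(E, ℂ) := fun N => (hcs N).toSchwartzMap (hsm N)
  have hlim := tendsto_cutoff_mul hψ hψc (fun ξ hξ => by
    rw [ψ.one_of_mem_closedBall (by simpa using hξ), Complex.ofReal_one]) r G (fun _ _ => rfl)
  have hF := ((ContinuousLinearMap.continuous (F : 𝓢(E, ℂ) →L[ℂ] ℂ)).tendsto r).comp hlim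
  refine tendsto_nhds_unique hF ?_
  have h0 : ∀ N, F (G N) = 0 := fun N => by
    refine apply_eq_zero_of_hasCompactSupport F (G N) (hcs N) ?_
    refine Set.disjoint_left.2 fun ξ hξ hξF => ?_
    refine notMem_tsupport_iff_eventuallyEq.2 ?_ hξ
    filter_upwards [hs.mem_nhds (hFs hξF)] with η hη
    change (ψ ((N + 1 : ℝ)⁻¹ • η) : ℂ) * r η = 0
    rw [hrs η hη, mul_zero]
  exact tendsto_const_nhds.congr fun N => (h0 N).symm

end Support

/-! ### Bounds on the joint derivatives of a symbol -/

section Joint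

variable {X E V : Type u} [NormedAddCommGroup X] [NormedSpace ℝ X]
  [NormedAddCommGroup E] [NormedSpace ℝ E] [NormedAddCommGroup V] [NormedSpace ℝ V]

/-- Symmetry of higher derivatives: an additional derivative may be taken first or last. -/
theorem fderiv_iteratedFDeriv_apply {f : X → V} (hf : ContDiff ℝ ∞ f) (q : ℕ) (z w : X)
    (v : Fin q → X) :
    fderiv ℝ (iteratedFDeriv ℝ q f) z w v = iteratedFDeriv ℝ q (fderiv ℝ f) z v w := by
  induction q generalizing z w with
  | zero =>
    rw [iteratedFDeriv_zero_eq_comp, LinearIsometryEquiv.comp_fderiv]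
    simp
  | succ q ih =>
    have hg : ContDiff ℝ ∞ (iteratedFDeriv ℝ q f) :=
      hf.iteratedFDeriv_right (m := ∞) (by exact_mod_cast le_top)
    have hDg : ContDiff ℝ ∞ (fderiv ℝ (iteratedFDeriv ℝ q f)) := hg.fderiv_right (by simp)
    have hDf : ContDiff ℝ ∞ (fderiv ℝ f) := hf.fderiv_right (by simp)
    have hh : ContDiff ℝ ∞ (iteratedFDeriv ℝ q (fderiv ℝ f)) :=
      hDf.iteratedFDeriv_right (m := ∞) (by exact_mod_cast le_top)
    have hsymm : fderiv ℝ (fderiv ℝ (iteratedFDeriv ℝ q f)) z w (v 0) =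
        fderiv ℝ (fderiv ℝ (iteratedFDeriv ℝ q f)) z (v 0) w :=
      (hg.contDiffAt.isSymmSndFDerivAt
        (by rw [minSmoothness_of_isRCLikeNormedField]; exact WithTop.coe_le_coe.2 le_top)).eq
          w (v 0)
    have hsucc : fderiv ℝ (iteratedFDeriv ℝ (q + 1) f) z w v =
        fderiv ℝ (fderiv ℝ (iteratedFDeriv ℝ q f)) z w (v 0) (Fin.tail v) := by
      let e := (continuousMultilinearCurryLeftEquiv ℝ (fun _ : Fin (q + 1) => X) V).symm
      have h : HasFDerivAt (e ∘ fderiv ℝ (iteratedFDeriv ℝ q f)) _ z :=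
        e.toContinuousLinearEquiv.toContinuousLinearMap.hasFDerivAt.comp z
          (hDg.differentiable (by simp) z).hasFDerivAt
      rw [iteratedFDeriv_succ_eq_comp_left]
      exact congrArg (fun L : X →L[ℝ] (X [×(q + 1)]→L[ℝ] V) => L w v) h.fderiv
    rw [hsucc]
    rw [hsymm, iteratedFDeriv_succ_apply_left]
    have hfun : (fun y => fderiv ℝ (iteratedFDeriv ℝ q f) y w (Fin.tail v)) =
        fun y => iteratedFDeriv ℝ q (fderiv ℝ f) y (Fin.tail v) w := funext fun y => ih y w _
    let A₁ := ContinuousMultilinearMap.apply ℝ (fun _ : Fin q => X) V (Fin.tail v)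
    let A₂ : (X →L[ℝ] (X [×q]→L[ℝ] V)) →L[ℝ] (X [×q]→L[ℝ] V) := ContinuousLinearMap.apply ℝ _ w
    let B₁ := ContinuousMultilinearMap.apply ℝ (fun _ : Fin q => X) (X →L[ℝ] V) (Fin.tail v)
    let B₂ : (X →L[ℝ] V) →L[ℝ] V := ContinuousLinearMap.apply ℝ V w
    have h1 : HasFDerivAt (fun y => fderiv ℝ (iteratedFDeriv ℝ q f) y w (Fin.tail v))
        ((A₁.comp A₂).comp (fderiv ℝ (fderiv ℝ (iteratedFDeriv ℝ q f)) z)) z :=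
      HasFDerivAt.comp (g := A₁.comp A₂) z (A₁.comp A₂).hasFDerivAt
        (hDg.differentiable (by simp) z).hasFDerivAt
    have h2 : HasFDerivAt (fun y => iteratedFDeriv ℝ q (fderiv ℝ f) y (Fin.tail v) w)
        ((B₂.comp B₁).comp (fderiv ℝ (iteratedFDeriv ℝ q (fderiv ℝ f)) z)) z :=
      HasFDerivAt.comp (g := B₂.comp B₁) z (B₂.comp B₁).hasFDerivAt
        (hh.differentiable (by simp) z).hasFDerivAt
    rw [hfun] at h1
    exact congrArg (fun L : X →L[ℝ] V => L (v 0)) (h1.unique h2)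

/-- The norm of the mixed derivative of order `q` in `x` and order `p` in `ξ`. -/
noncomputable def mixedNorm (p q : ℕ) (f : X × E → V) (x : X) (ξ : E) : ℝ :=
  ‖iteratedFDeriv ℝ p (fun η => iteratedFDeriv ℝ q (fun y => f (y, η)) x) ξ‖

theorem mixedNorm_partial_left {f : X × E → V} (hf : ContDiff ℝ ∞ f) (p q : ℕ) (x : X) (ξ : E) :
    mixedNorm p q (fun z => (fderiv ℝ f z).comp (ContinuousLinearMap.inl ℝ X E)) x ξ =
      mixedNorm p (q + 1) f x ξ := by
  have hx : ∀ η, fderiv ℝ (fun y => f (y, η)) =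
      fun y => (fderiv ℝ f (y, η)).comp (ContinuousLinearMap.inl ℝ X E) := fun η =>
    funext fun y => ((hf.differentiable (by simp) (y, η)).hasFDerivAt.comp y
      (hasFDerivAt_prodMk_left y η)).fderiv
  have h : (fun η => iteratedFDeriv ℝ (q + 1) (fun y => f (y, η)) x) =
      (continuousMultilinearCurryRightEquiv' ℝ q X V).symm ∘ fun η => iteratedFDeriv ℝ q
        (fun y => (fderiv ℝ f (y, η)).comp (ContinuousLinearMap.inl ℝ X E)) x := by
    funext η
    rw [iteratedFDeriv_succ_eq_comp_right, Function.comp_apply, hx]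
    rfl
  let e := (continuousMultilinearCurryRightEquiv' ℝ q X V).symm
  have := e.norm_iteratedFDeriv_comp_left (fun η => iteratedFDeriv ℝ q
    (fun y => (fderiv ℝ f (y, η)).comp (ContinuousLinearMap.inl ℝ X E)) x) ξ p
  unfold mixedNorm
  rw [h]
  exact this.symm

-- the instances on iterated spaces of continuous multilinear maps need nested synthesis
set_option maxSynthPendingDepth 3 in
/-- The derivative in `ξ` is taken before the `q` derivatives in `x` on the left and after them on
the right, so that the two sides differ by a transposition of arguments. -/
theorem mixedNorm_partial_right_le {f : X × E → V} (hf : ContDiff ℝ ∞ f) (p q : ℕ) (x : X)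
    (ξ : E) :
    mixedNorm p q (fun z => (fderiv ℝ f z).comp (ContinuousLinearMap.inr ℝ X E)) x ξ ≤
      mixedNorm (p + 1) q f x ξ := by
  let L : (E →L[ℝ] (X [×q]→L[ℝ] V)) →L[ℝ] (X [×q]→L[ℝ] (E →L[ℝ] V)) :=
    (ContinuousLinearMap.flipMultilinearEquiv ℝ (fun _ : Fin q => X) E V).toContinuousLinearMap
  have hL : ‖L‖ ≤ 1 := ContinuousLinearMap.opNorm_le_bound _ zero_le_one fun g => by
    rw [one_mul]
    refine ContinuousMultilinearMap.opNorm_le_bound (norm_nonneg g) fun v => ?_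
    refine ContinuousLinearMap.opNorm_le_bound _
      (mul_nonneg (norm_nonneg g) (Finset.prod_nonneg fun i _ => norm_nonneg (v i))) fun w => ?_
    refine ((g w).le_opNorm v).trans ?_
    rw [mul_right_comm]
    gcongr
    exact g.le_opNorm w
  have hD : ContDiff ℝ ∞ (fderiv ℝ f) := hf.fderiv_right (by simp)
  have hq : ContDiff ℝ ∞ (iteratedFDeriv ℝ q f) :=
    hf.iteratedFDeriv_right (m := ∞) (by exact_mod_cast le_top)
  let P := ContinuousMultilinearMap.compContinuousLinearMapL (F := V)
    (fun _ : Fin q => ContinuousLinearMap.inl ℝ X E)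
  have hg : (fun η => iteratedFDeriv ℝ q (fun y => f (y, η)) x) =
      fun η => P (iteratedFDeriv ℝ q f (x, η)) :=
    funext fun η => iteratedFDeriv_prodMk_right hf q x η
  have hgs : ContDiff ℝ ∞ (fun η => iteratedFDeriv ℝ q (fun y => f (y, η)) x) := by
    rw [hg]
    exact P.contDiff.comp (hq.comp (contDiff_prodMk_right x))
  let R : (X × E →L[ℝ] V) →L[ℝ] (E →L[ℝ] V) :=
    (ContinuousLinearMap.compL ℝ E (X × E) V).flip (ContinuousLinearMap.inr ℝ X E)
  have hRf : ContDiff ℝ ∞ (fun z => (fderiv ℝ f z).comp (ContinuousLinearMap.inr ℝ X E)) :=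
    R.contDiff.comp hD
  have key : (fun η => iteratedFDeriv ℝ q
      (fun y => (fderiv ℝ f (y, η)).comp (ContinuousLinearMap.inr ℝ X E)) x) =
      L ∘ fderiv ℝ (fun η => iteratedFDeriv ℝ q (fun y => f (y, η)) x) := by
    funext η
    ext v w
    have h1 := iteratedFDeriv_prodMk_right hRf q x η
    have h2 : iteratedFDeriv ℝ q (R ∘ fderiv ℝ f) (x, η) =
        R.compContinuousMultilinearMap (iteratedFDeriv ℝ q (fderiv ℝ f) (x, η)) :=
      R.iteratedFDeriv_comp_left hD.contDiffAt (by exact_mod_cast le_top)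
    have h3 : HasFDerivAt (fun η => P (iteratedFDeriv ℝ q f (x, η)))
        (P.comp ((fderiv ℝ (iteratedFDeriv ℝ q f) (x, η)).comp
          (ContinuousLinearMap.inr ℝ X E))) η :=
      P.hasFDerivAt.comp η ((hq.differentiable (by simp) (x, η)).hasFDerivAt.comp η
        (hasFDerivAt_prodMk_right x η))
    rw [Function.comp_apply, hg, h3.fderiv, h1]
    change iteratedFDeriv ℝ q (R ∘ fderiv ℝ f) (x, η) _ w =
      fderiv ℝ (iteratedFDeriv ℝ q f) (x, η) (ContinuousLinearMap.inr ℝ X E w)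
        (fun i => ContinuousLinearMap.inl ℝ X E (v i))
    rw [h2, fderiv_iteratedFDeriv_apply hf]
    rfl
  unfold mixedNorm
  rw [key, ← norm_iteratedFDeriv_fderiv]
  refine (L.norm_iteratedFDeriv_comp_left (hgs.fderiv_right (m := ∞) (by simp)).contDiffAt
    (by exact_mod_cast le_top)).trans ?_
  exact mul_le_of_le_one_left (norm_nonneg _) hL

/-- The joint derivative of order `m` splits into `2 ^ m` mixed derivatives. -/
theorem norm_iteratedFDeriv_le_of_mixedNorm_le (m : ℕ) {f : X × E → V} (hf : ContDiff ℝ ∞ f)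
    (x : X) (ξ : E) {B : ℝ} (hB : ∀ p q, p + q = m → mixedNorm p q f x ξ ≤ B) :
    ‖iteratedFDeriv ℝ m f (x, ξ)‖ ≤ 2 ^ m * B := by
  induction m generalizing V with
  | zero =>
    have := hB 0 0 rfl
    simpa [mixedNorm] using this
  | succ m ih =>
    have hD : ContDiff ℝ ∞ (fderiv ℝ f) := hf.fderiv_right (by simp)
    let R₁ : (X × E →L[ℝ] V) →L[ℝ] (X →L[ℝ] V) :=
      (ContinuousLinearMap.compL ℝ X (X × E) V).flip (ContinuousLinearMap.inl ℝ X E)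
    let R₂ : (X × E →L[ℝ] V) →L[ℝ] (E →L[ℝ] V) :=
      (ContinuousLinearMap.compL ℝ E (X × E) V).flip (ContinuousLinearMap.inr ℝ X E)
    let S₁ : (X →L[ℝ] V) →L[ℝ] (X × E →L[ℝ] V) :=
      (ContinuousLinearMap.compL ℝ (X × E) X V).flip (ContinuousLinearMap.fst ℝ X E)
    let S₂ : (E →L[ℝ] V) →L[ℝ] (X × E →L[ℝ] V) :=
      (ContinuousLinearMap.compL ℝ (X × E) E V).flip (ContinuousLinearMap.snd ℝ X E)
    have h₁ : ContDiff ℝ ∞ (R₁ ∘ fderiv ℝ f) := R₁.contDiff.comp hD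
    have h₂ : ContDiff ℝ ∞ (R₂ ∘ fderiv ℝ f) := R₂.contDiff.comp hD
    have hS₁ : ‖S₁‖ ≤ 1 := ContinuousLinearMap.opNorm_le_bound _ zero_le_one fun g => by
      rw [one_mul]
      exact (g.opNorm_comp_le _).trans
        (mul_le_of_le_one_right (norm_nonneg _) (ContinuousLinearMap.norm_fst_le ℝ X E))
    have hS₂ : ‖S₂‖ ≤ 1 := ContinuousLinearMap.opNorm_le_bound _ zero_le_one fun g => by
      rw [one_mul]
      exact (g.opNorm_comp_le _).trans
        (mul_le_of_le_one_right (norm_nonneg _) (ContinuousLinearMap.norm_snd_le ℝ X E))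
    have hsplit : fderiv ℝ f = (S₁ ∘ (R₁ ∘ fderiv ℝ f)) + (S₂ ∘ (R₂ ∘ fderiv ℝ f)) := by
      funext z
      ext w
      · change _ = fderiv ℝ f z (w, 0) + fderiv ℝ f z (0, 0)
        rw [show ((0 : X), (0 : E)) = 0 from rfl, map_zero, add_zero]
        rfl
      · change _ = fderiv ℝ f z (0, 0) + fderiv ℝ f z (0, w)
        rw [show ((0 : X), (0 : E)) = 0 from rfl, map_zero, zero_add]
        rfl
    have e₁ := ih h₁ fun p q hpq =>
      (mixedNorm_partial_left hf p q x ξ).trans_le (hB p (q + 1) (by omega))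
    have e₂ := ih h₂ fun p q hpq =>
      (mixedNorm_partial_right_le hf p q x ξ).trans (hB (p + 1) q (by omega))
    have n₁ := S₁.norm_iteratedFDeriv_comp_left (x := (x, ξ)) (n := m) h₁.contDiffAt
      (by exact_mod_cast le_top)
    have n₂ := S₂.norm_iteratedFDeriv_comp_left (x := (x, ξ)) (n := m) h₂.contDiffAt
      (by exact_mod_cast le_top)
    rw [← norm_iteratedFDeriv_fderiv, hsplit, iteratedFDeriv_add_apply
      ((S₁.contDiff.comp h₁).of_le (by exact_mod_cast le_top)).contDiffAt
      ((S₂.contDiff.comp h₂).of_le (by exact_mod_cast le_top)).contDiffAt]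
    refine (norm_add_le _ _).trans ?_
    have k₁ := n₁.trans (mul_le_of_le_one_left (norm_nonneg _) hS₁)
    have k₂ := n₂.trans (mul_le_of_le_one_left (norm_nonneg _) hS₂)
    rw [pow_succ]
    linarith

end Joint

section Symbol

variable {n : ℕ} {d δ : ℝ} {a : Rn n → Rn n → ℂ}

/-- The joint derivatives of order `m` of a symbol, `ξ`-derivatives being no worse than
`x`-derivatives. -/
theorem IsSymbol.norm_iteratedFDeriv_le (ha : IsSymbol d 1 δ a) (hδ : 0 ≤ δ) (m : ℕ) :
    ∃ C : ℝ, 0 ≤ C ∧ ∀ x ξ : Rn n,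
      ‖iteratedFDeriv ℝ m (fun z : Rn n × Rn n => a z.1 z.2) (x, ξ)‖ ≤
        C * (1 + ‖ξ‖) ^ (|d| + δ * m) := by
  choose C hC using ha.2
  let S : ℝ := ∑ p ∈ Finset.range (m + 1), ∑ q ∈ Finset.range (m + 1), |C p q|
  refine ⟨2 ^ m * S, by positivity, fun x ξ => ?_⟩
  rw [mul_assoc]
  refine norm_iteratedFDeriv_le_of_mixedNorm_le m ha.1 x ξ fun p q hpq => (hC p q x ξ).trans ?_
  have h1 : (1 : ℝ) ≤ 1 + ‖ξ‖ := by simp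
  have h2 : C p q ≤ S := by
    refine (le_abs_self _).trans ?_
    refine le_trans ?_ (Finset.single_le_sum (f := fun p => ∑ q ∈ Finset.range (m + 1), |C p q|)
      (fun i _ => Finset.sum_nonneg fun j _ => abs_nonneg _)
      (Finset.mem_range.2 (by omega : p < m + 1)))
    exact Finset.single_le_sum (f := fun q => |C p q|) (fun i _ => abs_nonneg _)
      (Finset.mem_range.2 (by omega : q < m + 1))
  have h3 : d - 1 * p + δ * q ≤ |d| + δ * m := by
    have := le_abs_self d
    have hp : (0 : ℝ) ≤ p := p.cast_nonneg
    have hq : (q : ℝ) ≤ m := by exact_mod_cast (by omega : q ≤ m)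
    have := mul_le_mul_of_nonneg_left hq hδ
    linarith
  exact mul_le_mul h2 (Real.rpow_le_rpow_of_exponent_le h1 h3) (by positivity) (by positivity)

theorem IsSymbol.hasTemperateGrowth (ha : IsSymbol d 1 δ a) (hδ : 0 ≤ δ) :
    Function.HasTemperateGrowth (fun z : Rn n × Rn n => a z.1 z.2) := by
  refine ⟨ha.1, fun m => ?_⟩
  obtain ⟨C, hC, h⟩ := ha.norm_iteratedFDeriv_le hδ m
  refine ⟨⌈|d| + δ * m⌉₊, C, fun z => (h z.1 z.2).trans ?_⟩
  have h1 : (1 : ℝ) ≤ 1 + ‖z.2‖ := by simp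
  rw [← Real.rpow_natCast]
  refine mul_le_mul_of_nonneg_left ?_ hC
  refine (Real.rpow_le_rpow_of_exponent_le h1 (Nat.le_ceil _)).trans ?_
  exact Real.rpow_le_rpow (by positivity) (by have := norm_snd_le z; linarith) (by positivity)

end Symbol

/-! ### Plane waves and the Fourier normalization -/

theorem hasTemperateGrowth_cexp_mul_I :
    Function.HasTemperateGrowth (fun t : ℝ => Complex.exp (t * Complex.I)) := by
  have hd : ∀ t : ℝ, HasDerivAt (fun t : ℝ => Complex.exp (t * Complex.I))
      (Complex.I * Complex.exp (t * Complex.I)) t := fun t => by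
    have h := ((Complex.ofRealCLM.hasDerivAt (x := t)).mul_const Complex.I).cexp
    simpa [mul_comm] using h
  have hi : ∀ m : ℕ, iteratedDeriv m (fun t : ℝ => Complex.exp (t * Complex.I)) =
      fun t : ℝ => Complex.I ^ m * Complex.exp (t * Complex.I) := fun m => by
    induction m with
    | zero => simp
    | succ m ih =>
      rw [iteratedDeriv_succ, ih]
      funext t
      rw [((hd t).const_mul _).deriv, pow_succ, mul_assoc]
  refine ⟨(Complex.ofRealCLM.contDiff.mul contDiff_const).cexp, fun m => ⟨0, 1, fun t => ?_⟩⟩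
  rw [norm_iteratedFDeriv_eq_norm_iteratedDeriv, hi]
  simp [Complex.norm_exp_ofReal_mul_I]

section

variable {n : ℕ}

/-- The character `e^{2πi x·ξ}`. -/
noncomputable def planeWave (x ξ : Rn n) : ℂ :=
  Complex.exp ((2 * Real.pi * inner ℝ x ξ : ℝ) * Complex.I)

theorem norm_planeWave (x ξ : Rn n) : ‖planeWave x ξ‖ = 1 :=
  Complex.norm_exp_ofReal_mul_I _

theorem planeWave_ne_zero (x ξ : Rn n) : planeWave x ξ ≠ 0 := Complex.exp_ne_zero _

theorem planeWave_comm (x ξ : Rn n) : planeWave x ξ = planeWave ξ x := by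
  unfold planeWave
  rw [real_inner_comm]

theorem planeWave_add (x y ξ : Rn n) : planeWave (x + y) ξ = planeWave x ξ * planeWave y ξ := by
  unfold planeWave
  rw [← Complex.exp_add, inner_add_left]
  push_cast
  ring_nf

theorem planeWave_hasTemperateGrowth {D : Type*} [NormedAddCommGroup D] [NormedSpace ℝ D]
    {f g : D → Rn n} (hf : f.HasTemperateGrowth) (hg : g.HasTemperateGrowth) :
    Function.HasTemperateGrowth (fun z => planeWave (f z) (g z)) := by
  have h1 : Function.HasTemperateGrowth (fun z => inner ℝ (f z) (g z)) :=
    (innerSL ℝ (E := Rn n)).bilinear_hasTemperateGrowth hf hg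
  exact hasTemperateGrowth_cexp_mul_I.comp
    ((Function.HasTemperateGrowth.const (2 * Real.pi)).mul h1)

theorem fourierCheck_eq (g : Rn n → ℂ) (x : Rn n) :
    fourierCheck g x = ∫ ξ, planeWave x ξ * g ((2 * Real.pi) • ξ) := by
  have h := Measure.integral_comp_smul (volume : Measure (Rn n))
    (fun ξ => Complex.exp (Complex.I * (inner ℝ x ξ : ℝ)) * g ξ) (2 * Real.pi)
  have hpos : (0 : ℝ) < ((2 * Real.pi) ^ n)⁻¹ := by positivity
  rw [finrank_euclideanSpace_fin, abs_of_pos hpos] at h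
  unfold fourierCheck
  rw [inv_pow, ← Complex.ofReal_pow, ← Complex.ofReal_inv, ← Complex.real_smul, ← h]
  refine integral_congr_ae (Eventually.of_forall fun ξ => ?_)
  simp only [inner_smul_right, planeWave]
  congr 2
  push_cast
  ring

/-- The factor `2π` turns `fourierHat` into Mathlib's Fourier transform. -/
theorem fourierHat_smul (u : 𝓢(Rn n, ℂ)) (ξ : Rn n) :
    fourierHat u ((2 * Real.pi) • ξ) = 𝓕 u ξ := by
  rw [SchwartzMap.fourier_coe, Real.fourier_eq']
  unfold fourierHat
  refine integral_congr_ae (Eventually.of_forall fun y => ?_)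
  simp only [inner_smul_right, smul_eq_mul]
  congr 2
  push_cast
  ring

theorem fourier_eq_integral (g : 𝓢(Rn n, ℂ)) (x : Rn n) :
    𝓕 g x = ∫ ξ, planeWave (-x) ξ * g ξ := by
  rw [SchwartzMap.fourier_coe, Real.fourier_eq']
  refine integral_congr_ae (Eventually.of_forall fun ξ => ?_)
  simp only [planeWave, smul_eq_mul, inner_neg_left, real_inner_comm x ξ]
  congr 2
  push_cast
  ring

theorem fourierInv_eq_integral (g : 𝓢(Rn n, ℂ)) (x : Rn n) :
    𝓕⁻ g x = ∫ ξ, planeWave x ξ * g ξ := by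
  rw [SchwartzMap.fourierInv_coe, Real.fourierInv_eq']
  refine integral_congr_ae (Eventually.of_forall fun ξ => ?_)
  simp only [planeWave, smul_eq_mul, real_inner_comm x ξ]

theorem op_eq (a : Rn n → Rn n → ℂ) (u : 𝓢(Rn n, ℂ)) (x : Rn n) :
    op a u x = ∫ ξ, planeWave x ξ * (a x ((2 * Real.pi) • ξ) * 𝓕 u ξ) := by
  unfold op
  rw [fourierCheck_eq]
  simp_rw [fourierHat_smul]

theorem hasTemperateGrowth_smul_comp {a : Rn n → Rn n → ℂ}
    (ha : Function.HasTemperateGrowth (fun z : Rn n × Rn n => a z.1 z.2)) (r : ℝ)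
    {D : Type*} [NormedAddCommGroup D] [NormedSpace ℝ D] {f g : D → Rn n}
    (hf : f.HasTemperateGrowth) (hg : g.HasTemperateGrowth) :
    Function.HasTemperateGrowth (fun z => a (f z) (r • g z)) := by
  let L₁ := ContinuousLinearMap.inl ℝ (Rn n) (Rn n)
  let L₂ := r • ContinuousLinearMap.inr ℝ (Rn n) (Rn n)
  have h := ha.comp ((L₁.hasTemperateGrowth.comp hf).add (L₂.hasTemperateGrowth.comp hg))
  have he : ((fun z : Rn n × Rn n => a z.1 z.2) ∘ (L₁ ∘ f + L₂ ∘ g)) =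
      fun z => a (f z) (r • g z) := by
    funext z
    simp [L₁, L₂]
  rwa [he] at h

/-- A symbol is determined by its operator: the functions `û` include all test functions, so that
`e^{i x·ξ} (a(x,ξ) - a'(x,ξ))` is orthogonal to all of them for each `x`. -/
theorem op_injective {a a' : Rn n → Rn n → ℂ}
    (ha : Function.HasTemperateGrowth (fun z : Rn n × Rn n => a z.1 z.2))
    (ha' : Function.HasTemperateGrowth (fun z : Rn n × Rn n => a' z.1 z.2))
    (h : op a = op a') : a = a' := by
  have hx : ∀ x : Rn n, ∀ ξ, planeWave x ξ * (a x ((2 * Real.pi) • ξ) -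
      a' x ((2 * Real.pi) • ξ)) = 0 := by
    intro x
    have hc : ∀ {b : Rn n → Rn n → ℂ}, Function.HasTemperateGrowth
        (fun z : Rn n × Rn n => b z.1 z.2) →
        Continuous fun ξ : Rn n => planeWave x ξ * b x ((2 * Real.pi) • ξ) := fun {b} hb =>
      ((planeWave_hasTemperateGrowth (.const x) .id').mul
        (hasTemperateGrowth_smul_comp hb (2 * Real.pi) (.const x) .id')).1.continuous
    have hcd : Continuous fun ξ : Rn n => planeWave x ξ * (a x ((2 * Real.pi) • ξ) -
        a' x ((2 * Real.pi) • ξ)) := by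
      simp_rw [mul_sub]
      exact (hc ha).sub (hc ha')
    have hae := ae_eq_zero_of_integral_contDiff_smul_eq_zero
      (hcd.locallyIntegrable (μ := (volume : Measure (Rn n)))) ?_
    · exact fun ξ => congrFun (Continuous.ae_eq_iff_eq volume hcd continuous_const |>.1 hae) ξ
    intro g hg hgc
    let G : 𝓢(Rn n, ℂ) := HasCompactSupport.toSchwartzMap (f := fun ξ => (g ξ : ℂ))
      (hgc.comp_left Complex.ofReal_zero) (Complex.ofRealCLM.contDiff.comp hg)
    have hG : ∀ ξ, G ξ = g ξ := fun ξ => rfl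
    have hgi : ∀ {b : Rn n → Rn n → ℂ}, Function.HasTemperateGrowth
        (fun z : Rn n × Rn n => b z.1 z.2) →
        Integrable fun ξ : Rn n => planeWave x ξ * (b x ((2 * Real.pi) • ξ) * G ξ) :=
        fun {b} hb => by
      have hs : HasCompactSupport fun ξ : Rn n => planeWave x ξ * b x ((2 * Real.pi) • ξ) * G ξ :=
        (hgc.comp_left (g := Complex.ofReal) Complex.ofReal_zero).mul_left
      simp_rw [← mul_assoc]
      exact ((hc hb).mul G.continuous).integrable_of_hasCompactSupport hs
    have h1 := congrFun (congrFun h (𝓕⁻ G)) x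
    rw [op_eq, op_eq, fourier_fourierInv_eq] at h1
    rw [← sub_eq_zero, ← integral_sub (hgi ha) (hgi ha')] at h1
    rw [← h1]
    refine integral_congr_ae (Eventually.of_forall fun ξ => ?_)
    simp only [hG, Complex.real_smul]
    ring
  funext x ξ
  have h1 := hx x ((2 * Real.pi)⁻¹ • ξ)
  rw [smul_inv_smul₀ (by positivity)] at h1
  exact sub_eq_zero.1 ((mul_eq_zero.1 h1).resolve_left (planeWave_ne_zero _ _))

end

/-! ### Families cut off in the frequency variable -/

section

variable {X : Type*} {E : Type} [NormedAddCommGroup X] [NormedSpace ℝ X]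
  [NormedAddCommGroup E] [NormedSpace ℝ E]

/-- The family `c(x, ξ) χ(ξ)` for a function `c` of temperate growth and a test function `χ`. -/
def CompactFamily.ofMul (c : X × E → ℂ) (hc : c.HasTemperateGrowth) (χ : E → ℂ)
    (hχ : ContDiff ℝ ∞ χ) (hχc : HasCompactSupport χ) : CompactFamily X E where
  toFun z := c z * χ z.2
  temperate := hc.mul ((hχc.toSchwartzMap hχ).hasTemperateGrowth.comp
    (ContinuousLinearMap.snd ℝ X E).hasTemperateGrowth)
  carrier := tsupport χ
  isCompact_carrier := hχc
  eq_zero x ξ hξ := by rw [image_eq_zero_of_notMem_tsupport hξ, mul_zero]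

theorem CompactFamily.ofMul_slice_apply (c : X × E → ℂ) (hc : c.HasTemperateGrowth) (χ : E → ℂ)
    (hχ : ContDiff ℝ ∞ χ) (hχc : HasCompactSupport χ) (x : X) (ξ : E) :
    (CompactFamily.ofMul c hc χ hχ hχc).slice x ξ = c (x, ξ) * χ ξ :=
  CompactFamily.slice_apply _ x ξ

end

/-! ### The Littlewood–Paley partition -/

namespace Cutoff

variable {n : ℕ} (Ψ : Cutoff n)

theorem dilate_of_neg {j : ℤ} (hj : j < 0) (ξ : Rn n) : Ψ.dilate j ξ = 0 := if_pos hj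

theorem part_of_neg {j : ℤ} (hj : j < 0) (ξ : Rn n) : Ψ.part j ξ = 0 := by
  unfold part
  rw [Ψ.dilate_of_neg hj, Ψ.dilate_of_neg (by omega), sub_zero]

theorem dilate_eq_one {j : ℤ} (hj : 0 ≤ j) {ξ : Rn n} (h : ‖ξ‖ ≤ 11 / 10 * (2 : ℝ) ^ j) :
    Ψ.dilate j ξ = 1 := by
  unfold dilate
  rw [if_neg hj.not_gt, Ψ.eq_one, Complex.ofReal_one]
  have h2 : (0 : ℝ) < 2 ^ j := by positivity
  rw [norm_smul, zpow_neg, norm_inv, Real.norm_of_nonneg h2.le, ← div_eq_inv_mul,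
    div_le_iff₀ h2]
  exact h

theorem part_eq_zero_of_norm_le {k : ℤ} (hk : 1 ≤ k) {ξ : Rn n}
    (h : ‖ξ‖ ≤ 11 / 10 * (2 : ℝ) ^ (k - 1)) : Ψ.part k ξ = 0 := by
  unfold part
  rw [Ψ.dilate_eq_one (by omega) h, Ψ.dilate_eq_one (by omega), sub_self]
  refine h.trans ?_
  gcongr
  · norm_num
  · omega

/-- The function `Φ̃_k = Ψ_{k+1} - Ψ_{k-2}` is `1` on the support of `Φ_k`. -/
theorem fatPart_mul_part (k : ℤ) (ξ : Rn n) : Ψ.fatPart k ξ * Ψ.part k ξ = Ψ.part k ξ := by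
  by_cases h0 : Ψ.part k ξ = 0
  · rw [h0, mul_zero]
  have hk : 0 ≤ k := not_lt.1 fun h => h0 (Ψ.part_of_neg h ξ)
  have hlt : ‖ξ‖ < 13 / 10 * (2 : ℝ) ^ k := not_le.1 fun h => h0 (Ψ.part_eq_zero k ξ h)
  have hpos : (0 : ℝ) < 2 ^ (k - 2) := by positivity
  have e0 : (2 : ℝ) ^ k = 4 * 2 ^ (k - 2) := by
    rw [show k = (k - 2) + 2 by ring, zpow_add₀ two_ne_zero]
    norm_num
    ring
  have e1 : (2 : ℝ) ^ (k + 1) = 8 * 2 ^ (k - 2) := by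
    rw [zpow_add_one₀ two_ne_zero, e0]
    ring
  have e2 : (2 : ℝ) ^ (k - 1) = 2 * 2 ^ (k - 2) := by
    rw [show k - 1 = (k - 2) + 1 by ring, zpow_add_one₀ two_ne_zero]
    ring
  have h1 : Ψ.dilate (k + 1) ξ = 1 := Ψ.dilate_eq_one (by omega) (by
    rw [e1]
    rw [e0] at hlt
    linarith)
  have h2 : Ψ.dilate (k - 2) ξ = 0 := by
    rcases hk.eq_or_lt with rfl | hk1
    · exact Ψ.dilate_of_neg (by norm_num) ξ
    · refine Ψ.dilate_eq_zero _ ξ ?_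
      by_contra hn
      exact h0 (Ψ.part_eq_zero_of_norm_le (by omega) (by rw [e2]; linarith))
  have h3 : Ψ.fatPart k ξ = 1 := by
    unfold fatPart part
    rw [show k - 1 - 1 = k - 2 by ring, show k + 1 - 1 = k by ring, h1, h2]
    ring
  rw [h3, one_mul]

theorem sum_part (N : ℕ) (ξ : Rn n) :
    ∑ k ∈ Finset.range N, Ψ.part k ξ = Ψ.dilate ((N : ℤ) - 1) ξ := by
  induction N with
  | zero => rw [Finset.sum_range_zero, Ψ.dilate_of_neg (by norm_num)]
  | succ N ih =>
    rw [Finset.sum_range_succ, ih]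
    unfold part
    push_cast
    rw [add_sub_cancel_right]
    ring

/-- The function `Ψ_j(2π ·)`, which is `1` for `|ξ| < 2^j/8`; the factor `2π` accounts for
Mathlib's normalization of the Fourier transform. -/
noncomputable def localizer (j : ℤ) (ξ : Rn n) : ℂ := Ψ.dilate j ((2 * Real.pi) • ξ)

theorem localizer_contDiff (j : ℤ) : ContDiff ℝ ∞ (Ψ.localizer j) :=
  (Ψ.dilate_contDiff j).comp (contDiff_const_smul _)

theorem localizer_hasCompactSupport (j : ℤ) : HasCompactSupport (Ψ.localizer j) := by
  refine HasCompactSupport.intro (isCompact_closedBall (0 : Rn n) (13 / 10 * (2 : ℝ) ^ j)) ?_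
  intro ξ hξ
  apply Ψ.dilate_eq_zero
  simp only [Metric.mem_closedBall, dist_zero_right, not_le] at hξ
  have h1 : (1 : ℝ) ≤ 2 * Real.pi := by linarith [Real.pi_gt_three]
  rw [norm_smul, Real.norm_of_nonneg (by positivity)]
  nlinarith [norm_nonneg ξ]

theorem norm_two_pi_smul_le {r : ℝ} {ξ : Rn n} (hξ : ξ ∈ Metric.ball (0 : Rn n) (r / 8)) :
    ‖(2 * Real.pi) • ξ‖ ≤ r := by
  rw [mem_ball_zero_iff] at hξ
  rw [norm_smul, Real.norm_of_nonneg (by positivity)]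
  have := Real.pi_lt_four
  nlinarith [norm_nonneg ξ]

theorem localizer_eq_one {j : ℤ} (hj : 0 ≤ j) {ξ : Rn n}
    (hξ : ξ ∈ Metric.ball (0 : Rn n) ((2 : ℝ) ^ j / 8)) : Ψ.localizer j ξ = 1 := by
  refine Ψ.dilate_eq_one hj ((norm_two_pi_smul_le hξ).trans ?_)
  have : (0 : ℝ) < 2 ^ j := by positivity
  linarith

theorem part_smul_eq_zero {k : ℤ} (hk : 1 ≤ k) {ξ : Rn n}
    (hξ : ξ ∈ Metric.ball (0 : Rn n) ((2 : ℝ) ^ (k - 1) / 8)) :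
    Ψ.part k ((2 * Real.pi) • ξ) = 0 := by
  refine Ψ.part_eq_zero_of_norm_le hk ((norm_two_pi_smul_le hξ).trans ?_)
  have : (0 : ℝ) < 2 ^ (k - 1) := by positivity
  linarith

theorem kernel_eq_integral (j : ℤ) (x : Rn n) :
    Ψ.kernel j x = ∫ ξ, planeWave x ξ * Ψ.part j ((2 * Real.pi) • ξ) := by
  rw [kernel_eq, fourierCheck_eq]

theorem kernel_of_neg {j : ℤ} (hj : j < 0) : Ψ.kernel j = 0 := by
  ext x
  simp [kernel_eq_integral, Ψ.part_of_neg hj]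

/-- The integral of `F⁻¹Φ_0` is the value `Φ_0(0) = 1`. -/
theorem integral_kernel_zero : ∫ x, Ψ.kernel 0 x = 1 := by
  have h := fourier_eq_integral (Ψ.kernel 0) 0
  unfold kernel at h
  rw [fourier_fourierInv_eq] at h
  have h1 : ∀ x, planeWave (-0) x * Ψ.kernel 0 x = Ψ.kernel 0 x := fun x => by
    simp [planeWave]
  unfold kernel at h1
  simp_rw [h1] at h
  unfold kernel
  rw [← h]
  change Ψ.part 0 ((2 * Real.pi) • 0) = 1
  unfold part
  rw [smul_zero, Ψ.dilate_eq_one le_rfl (by rw [norm_zero]; positivity),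
    Ψ.dilate_of_neg (by norm_num), sub_zero]

/-- The kernels of the dilated cut-offs `∑_{j ≤ M} Φ_j = Ψ(2^{-M} ·)` are dilations of a single
function, so that they form an approximate identity. -/
theorem sum_kernel (M : ℕ) (x : Rn n) :
    ∑ j ∈ Finset.range (M + 1), Ψ.kernel j x =
      ((2 : ℝ) ^ M) ^ n • Ψ.kernel 0 ((2 : ℝ) ^ M • x) := by
  have hi : ∀ j : ℕ, Integrable fun ξ => planeWave x ξ * Ψ.part j ((2 * Real.pi) • ξ) := fun j =>
    ((((planeWave_hasTemperateGrowth (.const x) .id').1.continuous.mul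
      (Ψ.part_scaled_contDiff j).continuous)).integrable_of_hasCompactSupport
        (Ψ.part_scaled_hasCompactSupport j).mul_left)
  simp_rw [kernel_eq_integral]
  rw [← integral_finsetSum _ fun j _ => hi j]
  simp_rw [← Finset.mul_sum, Ψ.sum_part]
  push_cast
  rw [add_sub_cancel_right]
  have h2 : (0 : ℝ) < 2 ^ M := by positivity
  have h := Measure.integral_comp_smul (volume : Measure (Rn n))
    (fun ξ => planeWave x ξ * Ψ.dilate M ((2 * Real.pi) • ξ)) ((2 : ℝ) ^ M)
  rw [finrank_euclideanSpace_fin, abs_of_pos (by positivity)] at h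
  rw [← inv_smul_eq_iff₀ (by positivity), ← h]
  refine integral_congr_ae (Eventually.of_forall fun ξ => ?_)
  have e1 : planeWave x ((2 : ℝ) ^ M • ξ) = planeWave ((2 : ℝ) ^ M • x) ξ := by
    simp only [planeWave, inner_smul_right, inner_smul_left]
    simp
  have e2 : Ψ.dilate M ((2 * Real.pi) • (2 : ℝ) ^ M • ξ) = Ψ.part 0 ((2 * Real.pi) • ξ) := by
    unfold part
    rw [Ψ.dilate_of_neg (j := 0 - 1) (by norm_num), sub_zero]
    unfold dilate
    rw [if_neg (by omega), if_neg (by norm_num)]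
    congr 2
    simp only [smul_smul]
    congr 1
    rw [zpow_neg, zpow_natCast, neg_zero, zpow_zero]
    field_simp
  simp only [e1, e2]

end Cutoff

/-! ### The terms of the paradifferential splitting -/

section

variable {n : ℕ} {a : Rn n → Rn n → ℂ}

/-- The family `e^{2πi x·ξ} a(x - z, 2πξ) χ(ξ)`, with parameter `(x, z)`. -/
noncomputable def shiftFamily
    (ha : Function.HasTemperateGrowth (fun z : Rn n × Rn n => a z.1 z.2)) (χ : Rn n → ℂ)
    (hχ : ContDiff ℝ ∞ χ) (hχc : HasCompactSupport χ) : CompactFamily (Rn n × Rn n) (Rn n) :=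
  CompactFamily.ofMul
    (fun w => planeWave w.1.1 w.2 * a (w.1.1 - w.1.2) ((2 * Real.pi) • w.2))
    (by
      have h11 : Function.HasTemperateGrowth (fun w : (Rn n × Rn n) × Rn n => w.1.1) :=
        ((ContinuousLinearMap.fst ℝ (Rn n) (Rn n)).comp
          (ContinuousLinearMap.fst ℝ (Rn n × Rn n) (Rn n))).hasTemperateGrowth
      have h12 : Function.HasTemperateGrowth (fun w : (Rn n × Rn n) × Rn n => w.1.2) :=
        ((ContinuousLinearMap.snd ℝ (Rn n) (Rn n)).comp
          (ContinuousLinearMap.fst ℝ (Rn n × Rn n) (Rn n))).hasTemperateGrowth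
      have h2 : Function.HasTemperateGrowth (fun w : (Rn n × Rn n) × Rn n => w.2) :=
        (ContinuousLinearMap.snd ℝ (Rn n × Rn n) (Rn n)).hasTemperateGrowth
      exact (planeWave_hasTemperateGrowth h11 h2).mul
        (hasTemperateGrowth_smul_comp ha _ (h11.sub h12) h2))
    χ hχ hχc

theorem shiftFamily_slice_apply
    (ha : Function.HasTemperateGrowth (fun z : Rn n × Rn n => a z.1 z.2)) (χ : Rn n → ℂ)
    (hχ : ContDiff ℝ ∞ χ) (hχc : HasCompactSupport χ) (x z ξ : Rn n) :
    (shiftFamily ha χ hχ hχc).slice (x, z) ξ =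
      planeWave x ξ * a (x - z) ((2 * Real.pi) • ξ) * χ ξ :=
  CompactFamily.ofMul_slice_apply _ _ _ _ _ _ _

/-- The function `u_k` is `û` applied to `e^{2πi y·ξ} Φ_k(2πξ)`. -/
theorem dyadicPiece_eq (Ψ : Cutoff n) (u : 𝓢'(Rn n, ℂ)) (k : ℤ) (y : Rn n) :
    dyadicPiece Ψ u k y = (𝓕 u : 𝓢'(Rn n, ℂ)) ((CompactFamily.ofMul
      (fun z : Rn n × Rn n => planeWave z.1 z.2)
      (planeWave_hasTemperateGrowth (ContinuousLinearMap.fst ℝ (Rn n) (Rn n)).hasTemperateGrowth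
        (ContinuousLinearMap.snd ℝ (Rn n) (Rn n)).hasTemperateGrowth) _
      (Ψ.part_scaled_contDiff k) (Ψ.part_scaled_hasCompactSupport k)).slice y) := by
  rw [TemperedDistribution.fourier_apply]
  unfold dyadicPiece
  congr 1
  ext z
  rw [dyadicPiece_testFunction, Ψ.kernel_eq_integral, fourier_eq_integral]
  refine integral_congr_ae (Eventually.of_forall fun ξ => ?_)
  simp only [CompactFamily.ofMul_slice_apply]
  rw [sub_eq_add_neg, planeWave_add]
  ring

theorem symbolPiece_scaled_contDiff
    (ha : Function.HasTemperateGrowth (fun z : Rn n × Rn n => a z.1 z.2)) (Ψ : Cutoff n)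
    (j k : ℤ) (x : Rn n) :
    ContDiff ℝ ∞ (fun ξ => symbolPiece Ψ a j k x ((2 * Real.pi) • ξ)) := by
  have h1 : Function.HasTemperateGrowth (fun z : Rn n × Rn n => z.1) :=
    (ContinuousLinearMap.fst ℝ (Rn n) (Rn n)).hasTemperateGrowth
  have h2 : Function.HasTemperateGrowth (fun z : Rn n × Rn n => z.2) :=
    (ContinuousLinearMap.snd ℝ (Rn n) (Rn n)).hasTemperateGrowth
  have h := (dominatedFamily_mul (volume : Measure (Rn n)) (Ψ.kernel j)
    (hasTemperateGrowth_smul_comp ha (2 * Real.pi) ((Function.HasTemperateGrowth.const x).sub h1)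
      h2)).contDiff_integral
  exact h.mul (((Ψ.part_scaled_contDiff (k - 1)).add (Ψ.part_scaled_contDiff k)).add
    (Ψ.part_scaled_contDiff (k + 1)))

theorem symbolPiece_scaled_hasCompactSupport (Ψ : Cutoff n) (j k : ℤ) (x : Rn n) :
    HasCompactSupport (fun ξ => symbolPiece Ψ a j k x ((2 * Real.pi) • ξ)) :=
  (((Ψ.part_scaled_hasCompactSupport (k - 1)).add (Ψ.part_scaled_hasCompactSupport k)).add
    (Ψ.part_scaled_hasCompactSupport (k + 1))).mul_left

/-- The function `a_{j,k}(x,D)u_k` in terms of `û`: both the integration against the kernel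
`K_{j,k}` and the convolution with `F⁻¹Φ_j` are interchanged with the action of `û`, and
`Φ̃_k Φ_k = Φ_k`. -/
theorem term_eq (ha : Function.HasTemperateGrowth (fun z : Rn n × Rn n => a z.1 z.2))
    (Ψ : Cutoff n) (u : 𝓢'(Rn n, ℂ)) (j k : ℤ) (x : Rn n) :
    term Ψ a u j k x = ∫ z, Ψ.kernel j z * (𝓕 u : 𝓢'(Rn n, ℂ)) ((shiftFamily ha _
      (Ψ.part_scaled_contDiff k) (Ψ.part_scaled_hasCompactSupport k)).slice (x, z)) := by
  -- `φ = K_{j,k}(x, ·)`, while `G` is the test function to which `û` is applied in the end; it is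
  -- an average both of the members of `b₁` and of those of `b₂`
  let g : 𝓢(Rn n, ℂ) := (symbolPiece_scaled_hasCompactSupport Ψ j k x).toSchwartzMap
    (symbolPiece_scaled_contDiff ha Ψ j k x)
  have hg : ∀ ξ, g ξ = symbolPiece Ψ a j k x ((2 * Real.pi) • ξ) := fun ξ => rfl
  let φ : 𝓢(Rn n, ℂ) := (compCLMOfContinuousLinearEquiv ℂ (ContinuousLinearEquiv.neg ℝ)
    (𝓕⁻ g)).compSubConstCLM ℂ x
  have hφ : ∀ y, φ y = 𝓕⁻ g (x - y) := fun y => by simp [φ]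
  have hφK : ∀ y, φ y = pieceKernel Ψ a j k x y := fun y => by
    rw [hφ, fourierInv_eq_integral]
    unfold pieceKernel
    rw [fourierCheck_eq]
    simp_rw [hg]
  have h1 : Function.HasTemperateGrowth (fun z : Rn n × Rn n => z.1) :=
    (ContinuousLinearMap.fst ℝ (Rn n) (Rn n)).hasTemperateGrowth
  have h2 : Function.HasTemperateGrowth (fun z : Rn n × Rn n => z.2) :=
    (ContinuousLinearMap.snd ℝ (Rn n) (Rn n)).hasTemperateGrowth
  let P : Rn n → ℂ := fun ξ => Ψ.part k ((2 * Real.pi) • ξ)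
  let G : 𝓢(Rn n, ℂ) := HasCompactSupport.toSchwartzMap (f := fun ξ => planeWave x ξ * g ξ * P ξ)
    (Ψ.part_scaled_hasCompactSupport k).mul_left
    (((planeWave_hasTemperateGrowth (.const x) .id').1.mul
      (symbolPiece_scaled_contDiff ha Ψ j k x)).mul (Ψ.part_scaled_contDiff k))
  have hG : ∀ ξ, G ξ = planeWave x ξ * g ξ * P ξ := fun ξ => rfl
  let b₁ : CompactFamily (Rn n) (Rn n) := CompactFamily.ofMul
    (fun z : Rn n × Rn n => planeWave z.1 z.2) (planeWave_hasTemperateGrowth h1 h2) P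
    (Ψ.part_scaled_contDiff k) (Ψ.part_scaled_hasCompactSupport k)
  let b₂ : CompactFamily (Rn n) (Rn n) := CompactFamily.ofMul
    (fun z : Rn n × Rn n => planeWave x z.2 * a (x - z.1) ((2 * Real.pi) • z.2))
    ((planeWave_hasTemperateGrowth (.const x) h2).mul
      (hasTemperateGrowth_smul_comp ha _ ((Function.HasTemperateGrowth.const x).sub h1) h2)) P
    (Ψ.part_scaled_contDiff k) (Ψ.part_scaled_hasCompactSupport k)
  have hG₁ : ∀ ξ, G ξ = ∫ y, φ y * b₁.toFun (y, ξ) := fun ξ => by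
    have e : ∫ y, φ y * b₁.toFun (y, ξ) = ∫ z, φ (x - z) * b₁.toFun (x - z, ξ) :=
      (integral_sub_left_eq_self (fun y => φ y * b₁.toFun (y, ξ)) volume x).symm
    have e' : ∀ z, φ (x - z) * b₁.toFun (x - z, ξ) =
        planeWave x ξ * P ξ * (planeWave (-ξ) z * 𝓕⁻ g z) := fun z => by
      change φ (x - z) * (planeWave (x - z) ξ * P ξ) = _
      have e'' : planeWave (-z) ξ = planeWave (-ξ) z := by
        simp only [planeWave, inner_neg_left, real_inner_comm ξ z]
      rw [hφ, sub_sub_cancel, sub_eq_add_neg, planeWave_add, e'']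
      ring
    simp_rw [e, e']
    rw [integral_const_mul, ← fourier_eq_integral, fourier_fourierInv_eq, hG]
    ring
  have hG₂ : ∀ ξ, G ξ = ∫ z, Ψ.kernel j z * b₂.toFun (z, ξ) := fun ξ => by
    have e : ∀ z, Ψ.kernel j z * b₂.toFun (z, ξ) =
        planeWave x ξ * P ξ * (Ψ.kernel j z * a (x - z) ((2 * Real.pi) • ξ)) := fun z => by
      change Ψ.kernel j z * (planeWave x ξ * a (x - z) ((2 * Real.pi) • ξ) * P ξ) = _
      ring
    simp_rw [e]
    rw [integral_const_mul, hG, hg]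
    unfold symbolPiece
    have hP : Ψ.fatPart k ((2 * Real.pi) • ξ) * P ξ = P ξ := Ψ.fatPart_mul_part k _
    linear_combination (planeWave x ξ *
      ∫ y, Ψ.kernel j y * a (x - y) ((2 * Real.pi) • ξ)) * hP
  have k₁ := b₁.apply_eq_integral volume (𝓕 u) φ G hG₁
  have k₂ := b₂.apply_eq_integral volume (𝓕 u) (Ψ.kernel j) G hG₂
  have k₃ : term Ψ a u j k x = ∫ y, φ y * (𝓕 u : 𝓢'(Rn n, ℂ)) (b₁.slice y) := by
    unfold term
    refine integral_congr_ae (Eventually.of_forall fun y => ?_)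
    simp only [hφK, dyadicPiece_eq]
    rfl
  rw [k₃, ← k₁, k₂]
  refine integral_congr_ae (Eventually.of_forall fun z => ?_)
  have e : b₂.slice z = (shiftFamily ha _ (Ψ.part_scaled_contDiff k)
      (Ψ.part_scaled_hasCompactSupport k)).slice (x, z) := by
    ext ξ
    rw [shiftFamily_slice_apply]
    exact CompactFamily.ofMul_slice_apply _ _ _ _ _ _ _
  simp only [e]

end

/-! ### Averages of a family over a shrinking kernel -/

section Average

variable {n : ℕ} (b : CompactFamily (Rn n × Rn n) (Rn n)) (F : 𝓢'(Rn n, ℂ)) (κ : 𝓢(Rn n, ℂ))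

theorem continuous_average_integrand (r : ℝ) :
    Continuous fun z : Rn n × Rn n => κ z.2 * F (b.slice (z.1, r • z.2)) :=
  (κ.continuous.comp continuous_snd).mul ((b.continuous_apply_slice F).comp
    (continuous_fst.prodMk (continuous_snd.const_smul r)))

theorem aestronglyMeasurable_average (r : ℝ) :
    AEStronglyMeasurable (fun x => ∫ w, κ w * F (b.slice (x, r • w))) volume :=
  (StronglyMeasurable.integral_prod_right
    (f := fun x w => κ w * F (b.slice (x, r • w)))
    (continuous_average_integrand b F κ r).stronglyMeasurable).aestronglyMeasurable

theorem exists_average_integrand_bound :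
    ∃ (C : ℝ) (M : ℕ), 0 ≤ C ∧ ∀ (r : ℝ), |r| ≤ 1 → ∀ x w : Rn n,
      ‖κ w * F (b.slice (x, r • w))‖ ≤ C * (1 + ‖x‖) ^ M * ((1 + ‖w‖) ^ M * ‖κ w‖) := by
  obtain ⟨C, M, hC, h⟩ := b.norm_apply_slice_le F
  refine ⟨C, M, hC, fun r hr x w => ?_⟩
  have h1 : ‖r • w‖ ≤ ‖w‖ := by
    rw [norm_smul]
    exact mul_le_of_le_one_left (norm_nonneg _) hr
  have h2 := pow_le_pow_left₀ (by positivity) (one_add_norm_prodMk_le (x := x) h1) M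
  rw [norm_mul]
  calc ‖κ w‖ * ‖F (b.slice (x, r • w))‖
      ≤ ‖κ w‖ * (C * ((1 + ‖w‖) * (1 + ‖x‖)) ^ M) := by
        refine mul_le_mul_of_nonneg_left ((h _).trans ?_) (norm_nonneg _)
        exact mul_le_mul_of_nonneg_left h2 hC
    _ = C * (1 + ‖x‖) ^ M * ((1 + ‖w‖) ^ M * ‖κ w‖) := by
        rw [mul_pow]
        ring

theorem exists_average_bound :
    ∃ (C : ℝ) (M : ℕ), ∀ (r : ℝ), |r| ≤ 1 → ∀ x : Rn n,
      ‖∫ w, κ w * F (b.slice (x, r • w))‖ ≤ C * (1 + ‖x‖) ^ M := by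
  obtain ⟨C, M, -, h⟩ := exists_average_integrand_bound b F κ
  refine ⟨C * ∫ w, (1 + ‖w‖) ^ M * ‖κ w‖, M, fun r hr x => ?_⟩
  refine (norm_integral_le_of_norm_le
    ((integrable_one_add_norm_pow_mul volume κ M).const_mul _)
    (Eventually.of_forall fun w => h r hr x w)).trans_eq ?_
  rw [integral_const_mul]
  ring

theorem integrable_average_integrand {r : ℝ} (hr : |r| ≤ 1) (x : Rn n) :
    Integrable fun w => κ w * F (b.slice (x, r • w)) := by
  obtain ⟨C, M, -, h⟩ := exists_average_integrand_bound b F κ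
  refine ((integrable_one_add_norm_pow_mul volume κ M).const_mul (C * (1 + ‖x‖) ^ M)).mono'
    ((continuous_average_integrand b F κ r).comp (continuous_const.prodMk
      continuous_id)).aestronglyMeasurable (Eventually.of_forall fun w => h r hr x w)

/-- The averages converge to the value at the centre, times the mass of `κ`. -/
theorem tendsto_average {r : ℕ → ℝ} (hr : ∀ N, |r N| ≤ 1) (hr0 : Tendsto r atTop (𝓝 0))
    (x : Rn n) : Tendsto (fun N => ∫ w, κ w * F (b.slice (x, r N • w))) atTop
      (𝓝 ((∫ w, κ w) * F (b.slice (x, 0)))) := by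
  obtain ⟨C, M, -, h⟩ := exists_average_integrand_bound b F κ
  rw [← integral_mul_const]
  refine tendsto_integral_of_dominated_convergence
    (fun w => C * (1 + ‖x‖) ^ M * ((1 + ‖w‖) ^ M * ‖κ w‖))
    (fun N => (integrable_average_integrand b F κ (hr N) x).aestronglyMeasurable)
    ((integrable_one_add_norm_pow_mul volume κ M).const_mul _)
    (fun N => Eventually.of_forall fun w => h _ (hr N) x w)
    (Eventually.of_forall fun w => ?_)
  refine tendsto_const_nhds.mul ((b.continuous_apply_slice F).tendsto (x, 0) |>.comp ?_)
  refine tendsto_const_nhds.prodMk_nhds ?_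
  simpa using hr0.smul_const w

end Average

/-! ### Convergence of the paradifferential splitting -/

section Splitting

variable {n : ℕ} {a : Rn n → Rn n → ℂ}

theorem exists_represents_term
    (ha : Function.HasTemperateGrowth (fun z : Rn n × Rn n => a z.1 z.2)) (Ψ : Cutoff n)
    (u : 𝓢'(Rn n, ℂ)) (j k : ℤ) : ∃ w, Represents w (term Ψ a u j k) := by
  let b := shiftFamily ha _ (Ψ.part_scaled_contDiff k) (Ψ.part_scaled_hasCompactSupport k)
  have he : term Ψ a u j k = fun x => ∫ z, Ψ.kernel j z * (𝓕 u : 𝓢'(Rn n, ℂ))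
      (b.slice (x, (1 : ℝ) • z)) := by
    funext x
    rw [term_eq ha]
    simp only [one_smul]
    rfl
  obtain ⟨C, M, h⟩ := exists_average_bound b (𝓕 u) (Ψ.kernel j)
  rw [he]
  exact exists_represents (aestronglyMeasurable_average b (𝓕 u) (Ψ.kernel j) 1)
    fun x => h 1 (by simp) x

theorem term_eq_zero_of_left_neg
    (ha : Function.HasTemperateGrowth (fun z : Rn n × Rn n => a z.1 z.2)) (Ψ : Cutoff n)
    (u : 𝓢'(Rn n, ℂ)) {j : ℤ} (hj : j < 0) (k : ℤ) : term Ψ a u j k = fun _ => 0 := by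
  funext x
  rw [term_eq ha, Ψ.kernel_of_neg hj]
  simp

/-- The terms vanish for those `k` for which `Φ_k` is zero near the spectrum of `u`. -/
theorem term_eq_zero_of_part_eq_zero
    (ha : Function.HasTemperateGrowth (fun z : Rn n × Rn n => a z.1 z.2)) (Ψ : Cutoff n)
    (u : 𝓢'(Rn n, ℂ)) (j : ℤ) {k : ℤ} {r : ℝ}
    (hu : Distribution.dsupport (𝓕 u : 𝓢'(Rn n, ℂ)) ⊆ Metric.ball 0 r)
    (hk : ∀ ξ ∈ Metric.ball (0 : Rn n) r, Ψ.part k ((2 * Real.pi) • ξ) = 0) :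
    term Ψ a u j k = fun _ => 0 := by
  funext x
  rw [term_eq ha, ← integral_zero (α := Rn n) (G := ℂ)]
  refine integral_congr_ae (Eventually.of_forall fun z => ?_)
  have h : (𝓕 u : 𝓢'(Rn n, ℂ)) ((shiftFamily ha _ (Ψ.part_scaled_contDiff k)
      (Ψ.part_scaled_hasCompactSupport k)).slice (x, z)) = (𝓕 u : 𝓢'(Rn n, ℂ)) 0 := by
    refine apply_congr_of_eqOn _ Metric.isOpen_ball hu fun ξ hξ => ?_
    rw [shiftFamily_slice_apply, hk ξ hξ, mul_zero]
    rfl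
  simp only [h, map_zero, mul_zero]

/-- The function `x ↦ ⟨û, e^{2πi x·ξ} a(x, 2πξ) Ψ_N(2πξ)⟩`, the value of `a(x,D)u` when `N` is so
large that `Ψ_N(2π ·)` is `1` near the support of `û` (Mathlib's normalization). -/
noncomputable def localizedOp
    (ha : Function.HasTemperateGrowth (fun z : Rn n × Rn n => a z.1 z.2)) (Ψ : Cutoff n) (N : ℕ)
    (u : 𝓢'(Rn n, ℂ)) (x : Rn n) : ℂ :=
  (𝓕 u : 𝓢'(Rn n, ℂ)) ((shiftFamily ha _ (Ψ.localizer_contDiff N)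
    (Ψ.localizer_hasCompactSupport N)).slice (x, 0))

theorem exists_represents_localizedOp
    (ha : Function.HasTemperateGrowth (fun z : Rn n × Rn n => a z.1 z.2)) (Ψ : Cutoff n) (N : ℕ)
    (u : 𝓢'(Rn n, ℂ)) : ∃ w, Represents w (localizedOp ha Ψ N u) := by
  let b := shiftFamily ha _ (Ψ.localizer_contDiff N) (Ψ.localizer_hasCompactSupport N)
  obtain ⟨C, M, -, h⟩ := b.norm_apply_slice_le (𝓕 u)
  refine exists_represents ((b.continuous_apply_slice (𝓕 u)).comp
    (continuous_id.prodMk continuous_const)).aestronglyMeasurable (C := C) (M := M) fun x => ?_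
  have h' := h (x, 0)
  rwa [show ‖(x, (0 : Rn n))‖ = ‖x‖ by simp [Prod.norm_def]] at h'

theorem exists_dsupport_subset_ball (u : FinvE' n) : ∃ N₀ : ℕ, ∀ N : ℕ, N₀ ≤ N →
    Distribution.dsupport (𝓕 (u : 𝓢'(Rn n, ℂ)) : 𝓢'(Rn n, ℂ)) ⊆
      Metric.ball 0 ((2 : ℝ) ^ N / 8) := by
  obtain ⟨R, hR⟩ := (show IsCompact (Distribution.dsupport
    (𝓕 (u : 𝓢'(Rn n, ℂ)) : 𝓢'(Rn n, ℂ))) from u.2).isBounded.subset_ball 0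
  obtain ⟨N₀, hN₀⟩ := pow_unbounded_of_one_lt (8 * R) (one_lt_two (α := ℝ))
  refine ⟨N₀, fun N hN => hR.trans (Metric.ball_subset_ball ?_)⟩
  have := pow_le_pow_right₀ (one_le_two (α := ℝ)) hN
  linarith

/-- The choice of the cut-off is immaterial. -/
theorem localizedOp_congr
    (ha : Function.HasTemperateGrowth (fun z : Rn n × Rn n => a z.1 z.2)) (Ψ Ψ' : Cutoff n)
    {N N' : ℕ} (u : 𝓢'(Rn n, ℂ)) (hN : N ≤ N')
    (hu : Distribution.dsupport (𝓕 u : 𝓢'(Rn n, ℂ)) ⊆ Metric.ball 0 ((2 : ℝ) ^ N / 8)) :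
    localizedOp ha Ψ N u = localizedOp ha Ψ' N' u := by
  funext x
  refine apply_congr_of_eqOn _ Metric.isOpen_ball hu fun ξ hξ => ?_
  have hξ' : ξ ∈ Metric.ball (0 : Rn n) ((2 : ℝ) ^ N' / 8) := by
    refine Metric.ball_subset_ball ?_ hξ
    have := pow_le_pow_right₀ (one_le_two (α := ℝ)) hN
    linarith
  rw [shiftFamily_slice_apply, shiftFamily_slice_apply,
    Ψ.localizer_eq_one (by omega) (by simpa using hξ),
    Ψ'.localizer_eq_one (by omega) (by simpa using hξ')]

/-- A square partial sum of all terms is an average over translates of the symbol with the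
approximate identity `F⁻¹Ψ_M`. -/
theorem sum_term_eq (ha : Function.HasTemperateGrowth (fun z : Rn n × Rn n => a z.1 z.2))
    (Ψ : Cutoff n) (u : 𝓢'(Rn n, ℂ)) {N M : ℕ} (hNM : N ≤ M)
    (hu : Distribution.dsupport (𝓕 u : 𝓢'(Rn n, ℂ)) ⊆ Metric.ball 0 ((2 : ℝ) ^ N / 8))
    (x : Rn n) :
    ∑ j ∈ Finset.range (M + 1), ∑ k ∈ Finset.range (M + 1), term Ψ a u j k x =
      ∫ w, Ψ.kernel 0 w * (𝓕 u : 𝓢'(Rn n, ℂ)) ((shiftFamily ha _ (Ψ.localizer_contDiff N)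
        (Ψ.localizer_hasCompactSupport N)).slice (x, ((2 : ℝ) ^ M)⁻¹ • w)) := by
  let F : 𝓢'(Rn n, ℂ) := 𝓕 u
  let b := shiftFamily ha _ (Ψ.localizer_contDiff N) (Ψ.localizer_hasCompactSupport N)
  let c := fun k : ℤ =>
    shiftFamily ha _ (Ψ.part_scaled_contDiff k) (Ψ.part_scaled_hasCompactSupport k)
  have hslice : ∀ z, ∑ k ∈ Finset.range (M + 1), F ((c k).slice (x, z)) = F (b.slice (x, z)) := by
    intro z
    rw [← map_sum]
    refine apply_congr_of_eqOn _ Metric.isOpen_ball hu fun ξ hξ => ?_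
    have hξ' : ξ ∈ Metric.ball (0 : Rn n) ((2 : ℝ) ^ M / 8) := by
      refine Metric.ball_subset_ball ?_ hξ
      have := pow_le_pow_right₀ (one_le_two (α := ℝ)) hNM
      linarith
    rw [_root_.sum_apply]
    simp only [c, b, shiftFamily_slice_apply]
    rw [← Finset.mul_sum, Ψ.sum_part, Ψ.localizer_eq_one (by omega) (by simpa using hξ)]
    push_cast
    rw [add_sub_cancel_right]
    congr 1
    exact Ψ.localizer_eq_one (by omega) (by simpa using hξ')
  have hint : ∀ j k : ℕ, Integrable fun z => Ψ.kernel j z * F ((c k).slice (x, z)) := fun j k => by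
    simpa using integrable_average_integrand (c k) F (Ψ.kernel j) (r := 1) (by simp) x
  have h1 : ∀ j k : ℕ, term Ψ a u j k x = ∫ z, Ψ.kernel j z * F ((c k).slice (x, z)) :=
    fun j k => term_eq ha Ψ u j k x
  simp_rw [h1]
  have h2 : ∀ j : ℕ, ∑ k ∈ Finset.range (M + 1), ∫ z, Ψ.kernel j z * F ((c k).slice (x, z)) =
      ∫ z, Ψ.kernel j z * F (b.slice (x, z)) := fun j => by
    rw [← integral_finsetSum _ fun k _ => hint j k]
    simp_rw [← Finset.mul_sum, hslice]
  have hint' : ∀ j : ℕ, Integrable fun z => Ψ.kernel j z * F (b.slice (x, z)) := fun j => by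
    simpa using integrable_average_integrand b F (Ψ.kernel j) (r := 1) (by simp) x
  simp_rw [h2]
  rw [← integral_finsetSum _ fun j _ => hint' j]
  simp_rw [← Finset.sum_mul, Ψ.sum_kernel]
  have hpos : (0 : ℝ) < 2 ^ M := by positivity
  have h := Measure.integral_comp_smul (volume : Measure (Rn n))
    (fun w => Ψ.kernel 0 w * F (b.slice (x, ((2 : ℝ) ^ M)⁻¹ • w))) ((2 : ℝ) ^ M)
  rw [finrank_euclideanSpace_fin, abs_of_pos (by positivity), eq_inv_smul_iff₀ (by positivity),
    ← integral_smul] at h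
  rw [← h]
  refine integral_congr_ae (Eventually.of_forall fun z => ?_)
  simp only [inv_smul_smul₀ hpos.ne', smul_mul_assoc]

/-- The partial sums of the three series add up to a square partial sum; the second series is taken
two steps further, to include the corner of the square. -/
theorem sum_splitting {V : Type*} [AddCommGroup V] (t : ℤ → ℤ → V)
    (h₁ : ∀ k, t (-1) k = 0) (h₂ : ∀ j, t j (-1) = 0) (N : ℕ) :
    ∑ m ∈ Finset.range N, ∑ j ∈ Finset.range (m + 1), t j (m + 2) +
      ∑ m ∈ Finset.range (N + 2), (t m m + t (m - 1) m + t m (m - 1)) +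
      ∑ m ∈ Finset.range N, ∑ k ∈ Finset.range (m + 1), t (m + 2) k =
    ∑ j ∈ Finset.range (N + 2), ∑ k ∈ Finset.range (N + 2), t j k := by
  induction N with
  | zero =>
    simp [Finset.sum_range_succ, h₁, h₂]
    abel
  | succ N ih =>
    have e : ∑ j ∈ Finset.range (N + 1 + 2), ∑ k ∈ Finset.range (N + 1 + 2), t j k =
        ∑ j ∈ Finset.range (N + 2), ∑ k ∈ Finset.range (N + 2), t j k +
        (∑ j ∈ Finset.range (N + 1), t j (N + 2) + t (N + 1) (N + 2)) +
        (∑ k ∈ Finset.range (N + 1), t (N + 2) k + t (N + 2) (N + 1)) + t (N + 2) (N + 2) := by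
      have h3 : ∀ j : ℤ, ∑ k ∈ Finset.range (N + 1 + 2), t j k =
          ∑ k ∈ Finset.range (N + 2), t j k + t j (N + 2) := fun j => by
        rw [show N + 1 + 2 = N + 2 + 1 by ring, Finset.sum_range_succ]
        push_cast
        rfl
      simp_rw [h3]
      rw [show N + 1 + 2 = N + 2 + 1 by ring, Finset.sum_range_succ, Finset.sum_add_distrib,
        Finset.sum_range_succ (fun k => t ((N + 2 : ℕ) : ℤ) k),
        Finset.sum_range_succ (fun j => t (j : ℤ) (N + 2))]
      push_cast
      abel
    rw [e, ← ih, Finset.sum_range_succ (fun m : ℕ => ∑ j ∈ Finset.range (m + 1), t j (m + 2)) N,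
      Finset.sum_range_succ (fun m : ℕ => ∑ k ∈ Finset.range (m + 1), t (m + 2) k) N,
      show N + 1 + 2 = N + 2 + 1 by ring,
      Finset.sum_range_succ (fun m : ℕ => t m m + t (m - 1) m + t m (m - 1)) (N + 2)]
    have e' : (((N + 2 : ℕ) : ℤ) - 1) = N + 1 := by
      push_cast
      ring
    rw [e', show ((N + 2 : ℕ) : ℤ) = N + 2 by push_cast; rfl]
    generalize ∑ m ∈ Finset.range N, ∑ j ∈ Finset.range (m + 1), t j (m + 2) = s₁
    generalize ∑ m ∈ Finset.range (N + 2), (t m m + t (m - 1) m + t m (m - 1)) = s₂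
    generalize ∑ m ∈ Finset.range N, ∑ k ∈ Finset.range (m + 1), t (m + 2) k = s₃
    abel

/-- The first two series are finite sums since the spectrum of `u` is bounded. The square partial
sums converge as averages with an approximate identity, hence so does the third series. -/
theorem isParadifferentialSum_of_represents
    (ha : Function.HasTemperateGrowth (fun z : Rn n × Rn n => a z.1 z.2)) (Ψ : Cutoff n)
    (u : 𝓢'(Rn n, ℂ)) {N : ℕ}
    (hu : Distribution.dsupport (𝓕 u : 𝓢'(Rn n, ℂ)) ⊆ Metric.ball 0 ((2 : ℝ) ^ N / 8))
    {w : 𝓢'(Rn n, ℂ)} (hw : Represents w (localizedOp ha Ψ N u)) :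
    IsParadifferentialSum Ψ a u w := by
  choose t ht using exists_represents_term ha Ψ u
  have ht₀ : ∀ {j k : ℤ}, term Ψ a u j k = (fun _ => 0) → t j k = 0 := fun {j k} h => by
    have := ht j k
    rw [h] at this
    exact this.eq represents_zero
  have hleft : ∀ k, t (-1) k = 0 := fun k => ht₀ (term_eq_zero_of_left_neg ha Ψ u (by norm_num) k)
  have hright : ∀ j, t j (-1) = 0 := fun j => ht₀
    (term_eq_zero_of_part_eq_zero ha Ψ u j hu fun ξ _ => Ψ.part_of_neg (by norm_num) _)
  have hlarge : ∀ (j k : ℤ), (N : ℤ) + 1 ≤ k → t j k = 0 := fun j k hk => ht₀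
    (term_eq_zero_of_part_eq_zero ha Ψ u j hu fun ξ hξ =>
      Ψ.part_smul_eq_zero (by omega) (Metric.ball_subset_ball (by
        have : (2 : ℝ) ^ N ≤ 2 ^ (k - 1) := by
          rw [← zpow_natCast]
          exact zpow_le_zpow_right₀ one_le_two (by omega)
        linarith) hξ))
  let G₁ : ℕ → 𝓢'(Rn n, ℂ) := fun m => ∑ j ∈ Finset.range (m + 1), t j (m + 2)
  let G₂ : ℕ → 𝓢'(Rn n, ℂ) := fun m => t m m + t (m - 1) m + t m (m - 1)
  let G₃ : ℕ → 𝓢'(Rn n, ℂ) := fun m => ∑ k ∈ Finset.range (m + 1), t (m + 2) k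
  have hG₁ : Tendsto (fun M => ∑ m ∈ Finset.range M, G₁ m) atTop
      (𝓝 (∑ m ∈ Finset.range (N + 2), G₁ m)) := by
    refine (hasSum_sum_of_ne_finset_zero fun m hm => ?_).tendsto_sum_nat
    rw [Finset.mem_range, not_lt] at hm
    exact Finset.sum_eq_zero fun j _ => hlarge _ _ (by omega)
  have hG₂ : Tendsto (fun M => ∑ m ∈ Finset.range M, G₂ m) atTop
      (𝓝 (∑ m ∈ Finset.range (N + 2), G₂ m)) := by
    refine (hasSum_sum_of_ne_finset_zero fun m hm => ?_).tendsto_sum_nat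
    rw [Finset.mem_range, not_lt] at hm
    simp only [G₂]
    rw [hlarge _ _ (by omega), hlarge _ _ (by omega), hlarge _ _ (by omega), add_zero, add_zero]
  have hsq : Tendsto (fun M => ∑ j ∈ Finset.range (M + 1), ∑ k ∈ Finset.range (M + 1), t j k)
      atTop (𝓝 w) := by
    rw [← tendsto_add_atTop_iff_nat N]
    let b := shiftFamily ha _ (Ψ.localizer_contDiff N) (Ψ.localizer_hasCompactSupport N)
    let r : ℕ → ℝ := fun M => ((2 : ℝ) ^ (M + N))⁻¹
    have hr : ∀ M, |r M| ≤ 1 := fun M => by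
      rw [abs_of_pos (by positivity)]
      exact inv_le_one_of_one_le₀ (one_le_pow₀ one_le_two)
    have hr0 : Tendsto r atTop (𝓝 0) := by
      have h := tendsto_inv_atTop_zero.comp
        (tendsto_pow_atTop_atTop_of_one_lt (one_lt_two (α := ℝ)))
      exact (tendsto_add_atTop_iff_nat N).2 h
    obtain ⟨C, M, hC⟩ := exists_average_bound b (𝓕 u) (Ψ.kernel 0)
    refine tendsto_of_represents (h := fun M x => ∫ w, Ψ.kernel 0 w * (𝓕 u : 𝓢'(Rn n, ℂ))
      (b.slice (x, r M • w))) (fun M => ?_) hw (fun K x => hC _ (hr K) x) fun x => ?_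
    · have h := represents_sum (Finset.range (M + N + 1)) fun j _ =>
        represents_sum (Finset.range (M + N + 1)) fun k _ => ht j k
      have he : (fun x => ∑ j ∈ Finset.range (M + N + 1), ∑ k ∈ Finset.range (M + N + 1),
          term Ψ a u j k x) = fun x => ∫ w, Ψ.kernel 0 w * (𝓕 u : 𝓢'(Rn n, ℂ))
            (b.slice (x, r M • w)) :=
        funext fun x => sum_term_eq ha Ψ u (Nat.le_add_left N M) hu x
      rw [← he]
      exact h
    · have h := tendsto_average b (𝓕 u) (Ψ.kernel 0) hr hr0 x
      rwa [Ψ.integral_kernel_zero, one_mul] at h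
  have hG₃ : Tendsto (fun M => ∑ m ∈ Finset.range M, G₃ m) atTop
      (𝓝 (w - ∑ m ∈ Finset.range (N + 2), G₁ m - ∑ m ∈ Finset.range (N + 2), G₂ m)) := by
    refine (((hsq.comp (tendsto_add_atTop_nat 1)).sub hG₁).sub
      (hG₂.comp (tendsto_add_atTop_nat 2))).congr fun M => ?_
    have h := sum_splitting t hleft hright M
    simp only [Function.comp_apply]
    rw [← h]
    simp only [G₁, G₂, G₃]
    abel
  refine ⟨_, _, _, ⟨G₁, fun m => ?_, hG₁⟩, ⟨G₂, fun m => ?_, hG₂⟩, ⟨G₃, fun m => ?_, hG₃⟩, ?_⟩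
  · exact represents_sum _ fun j _ => ht j (m + 2)
  · exact ((ht m m).add (ht (m - 1) m)).add (ht m (m - 1))
  · exact represents_sum _ fun k _ => ht (m + 2) k
  · abel

end Splitting

/-! ### The extended operator -/

section Extension

variable {n : ℕ} {a : Rn n → Rn n → ℂ}

/-- The extension of `a(x,D)` to distributions with compact spectrum, characterized by
`localizedOp` for all sufficiently large `N` and all cut-off functions. -/
theorem exists_extension (ha : Function.HasTemperateGrowth (fun z : Rn n × Rn n => a z.1 z.2)) :
    ∃ L : FinvE' n →ₗ[ℂ] 𝓢'(Rn n, ℂ), ∀ (u : FinvE' n) (N : ℕ),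
      Distribution.dsupport (𝓕 (u : 𝓢'(Rn n, ℂ)) : 𝓢'(Rn n, ℂ)) ⊆
        Metric.ball 0 ((2 : ℝ) ^ N / 8) →
          ∀ Ψ : Cutoff n, Represents (L u) (localizedOp ha Ψ N u) := by
  have hex : ∀ u : FinvE' n, ∃ w : 𝓢'(Rn n, ℂ), ∀ N : ℕ,
      Distribution.dsupport (𝓕 (u : 𝓢'(Rn n, ℂ)) : 𝓢'(Rn n, ℂ)) ⊆
        Metric.ball 0 ((2 : ℝ) ^ N / 8) →
          ∀ Ψ : Cutoff n, Represents w (localizedOp ha Ψ N u) := by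
    intro u
    obtain ⟨N₀, hN₀⟩ := exists_dsupport_subset_ball u
    let Ψ₀ : Cutoff n := Classical.arbitrary _
    obtain ⟨w, hw⟩ := exists_represents_localizedOp ha Ψ₀ N₀ u
    refine ⟨w, fun N hN Ψ => ?_⟩
    rcases le_total N₀ N with h | h
    · rwa [← localizedOp_congr ha Ψ₀ Ψ u h (hN₀ N₀ le_rfl)]
    · rwa [localizedOp_congr ha Ψ Ψ₀ u h hN]
  choose L hL using hex
  let Ψ₀ : Cutoff n := Classical.arbitrary _
  refine ⟨{ toFun := L, map_add' := fun u v => ?_, map_smul' := fun c u => ?_ }, hL⟩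
  · obtain ⟨N₁, h₁⟩ := exists_dsupport_subset_ball u
    obtain ⟨N₂, h₂⟩ := exists_dsupport_subset_ball v
    obtain ⟨N₃, h₃⟩ := exists_dsupport_subset_ball (u + v)
    let N := max N₁ (max N₂ N₃)
    have r₁ := hL u N (h₁ N (by omega)) Ψ₀
    have r₂ := hL v N (h₂ N (by omega)) Ψ₀
    exact (hL (u + v) N (h₃ N (by omega)) Ψ₀).eq (r₁.add r₂)
  · obtain ⟨N₁, h₁⟩ := exists_dsupport_subset_ball u
    obtain ⟨N₂, h₂⟩ := exists_dsupport_subset_ball (c • u)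
    let N := max N₁ N₂
    exact (hL (c • u) N (h₂ N (by omega)) Ψ₀).eq ((hL u N (h₁ N (by omega)) Ψ₀).smul c)

theorem coe_schwartz_apply (v φ : 𝓢(Rn n, ℂ)) :
    (v : 𝓢'(Rn n, ℂ)) φ = ∫ x, φ x * v x :=
  toTemperedDistributionCLM_apply_apply volume v φ

/-- A Schwartz function vanishes outside its support as a distribution. -/
theorem eq_zero_ae_of_notMem_dsupport (v : 𝓢(Rn n, ℂ)) : ∀ᵐ ξ : Rn n,
    ξ ∈ (Distribution.dsupport ((v : 𝓢'(Rn n, ℂ))))ᶜ → v ξ = 0 := by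
  refine Distribution.isClosed_dsupport.isOpen_compl.ae_eq_zero_of_integral_contDiff_smul_eq_zero
    (v.continuous.locallyIntegrable.locallyIntegrableOn _) fun g hg hgc hgs => ?_
  let G : 𝓢(Rn n, ℂ) := HasCompactSupport.toSchwartzMap (f := fun ξ => (g ξ : ℂ))
    (hgc.comp_left Complex.ofReal_zero) (Complex.ofRealCLM.contDiff.comp hg)
  have hG : ∀ ξ, G ξ = g ξ := fun ξ => rfl
  have hsub : tsupport G ⊆ tsupport g := closure_mono fun ξ hξ h => hξ (by rw [hG, h]; rfl)
  have h := apply_eq_zero_of_hasCompactSupport (v : 𝓢'(Rn n, ℂ)) G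
    (hgc.comp_left (g := Complex.ofReal) Complex.ofReal_zero)
    (Set.disjoint_left.2 fun ξ hξ => hgs (hsub hξ))
  rw [← h, coe_schwartz_apply]
  refine integral_congr_ae (Eventually.of_forall fun ξ => ?_)
  simp only [hG, Complex.real_smul]

/-- For a Schwartz function the cut-off is `1` where `û` is non-zero. -/
theorem localizedOp_eq_op
    (ha : Function.HasTemperateGrowth (fun z : Rn n × Rn n => a z.1 z.2)) (Ψ : Cutoff n) {N : ℕ}
    (v : 𝓢(Rn n, ℂ))
    (hv : Distribution.dsupport (𝓕 (v : 𝓢'(Rn n, ℂ)) : 𝓢'(Rn n, ℂ)) ⊆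
      Metric.ball 0 ((2 : ℝ) ^ N / 8)) :
    localizedOp ha Ψ N (v : 𝓢'(Rn n, ℂ)) = op a v := by
  funext x
  unfold localizedOp
  rw [op_eq]
  rw [TemperedDistribution.fourier_toTemperedDistributionCLM_eq] at hv ⊢
  rw [coe_schwartz_apply]
  refine integral_congr_ae ?_
  filter_upwards [eq_zero_ae_of_notMem_dsupport (𝓕 v)] with ξ hξ
  rw [shiftFamily_slice_apply, sub_zero]
  by_cases h : ξ ∈ Distribution.dsupport ((𝓕 v : 𝓢(Rn n, ℂ)) : 𝓢'(Rn n, ℂ))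
  · rw [Ψ.localizer_eq_one (by omega) (by simpa using hv h)]
    ring
  · rw [hξ h]
    ring

end Extension

/-! ### Uniform estimates by Schwartz seminorms -/

section Controlled

variable {ι : Type*} {E : Type*} [NormedAddCommGroup E] [NormedSpace ℝ E]

/-- The functionals `Q i` on the Schwartz space are bounded, uniformly in `i`, by a multiple of
finitely many Schwartz seminorms. -/
def SeminormControlled (Q : ι → 𝓢(E, ℂ) → ℝ) : Prop :=
  ∃ (s : Finset (ℕ × ℕ)) (C : ℝ), 0 ≤ C ∧
    ∀ i φ, Q i φ ≤ C * (s.sup (schwartzSeminormFamily ℂ E ℂ)) φ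

namespace SeminormControlled

variable {Q Q' : ι → 𝓢(E, ℂ) → ℝ}

theorem mono (h : SeminormControlled Q) (hle : ∀ i φ, Q' i φ ≤ Q i φ) : SeminormControlled Q' := by
  obtain ⟨s, C, hC, h⟩ := h
  exact ⟨s, C, hC, fun i φ => (hle i φ).trans (h i φ)⟩

theorem zero : SeminormControlled (fun (_ : ι) (_ : 𝓢(E, ℂ)) => (0 : ℝ)) :=
  ⟨∅, 0, le_rfl, fun i φ => by simp⟩

theorem add (h : SeminormControlled Q) (h' : SeminormControlled Q') :
    SeminormControlled (fun i φ => Q i φ + Q' i φ) := by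
  obtain ⟨s, C, hC, h⟩ := h
  obtain ⟨s', C', hC', h'⟩ := h'
  refine ⟨s ∪ s', C + C', by positivity, fun i φ => ?_⟩
  have h1 : (s.sup (schwartzSeminormFamily ℂ E ℂ)) φ ≤
      ((s ∪ s').sup (schwartzSeminormFamily ℂ E ℂ)) φ :=
    (Finset.sup_mono Finset.subset_union_left :
      s.sup (schwartzSeminormFamily ℂ E ℂ) ≤ _) φ
  have h2 : (s'.sup (schwartzSeminormFamily ℂ E ℂ)) φ ≤
      ((s ∪ s').sup (schwartzSeminormFamily ℂ E ℂ)) φ :=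
    (Finset.sup_mono Finset.subset_union_right :
      s'.sup (schwartzSeminormFamily ℂ E ℂ) ≤ _) φ
  rw [add_mul]
  exact add_le_add ((h i φ).trans (mul_le_mul_of_nonneg_left h1 hC))
    ((h' i φ).trans (mul_le_mul_of_nonneg_left h2 hC'))

theorem sum {κ : Type*} (t : Finset κ) {Q : κ → ι → 𝓢(E, ℂ) → ℝ}
    (h : ∀ k ∈ t, SeminormControlled (Q k)) :
    SeminormControlled (fun i φ => ∑ k ∈ t, Q k i φ) := by
  classical
  induction t using Finset.induction_on with
  | empty => simpa using zero
  | insert k t hk ih =>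
    simp only [Finset.sum_insert hk]
    exact (h k (Finset.mem_insert_self k t)).add
      (ih fun j hj => h j (Finset.mem_insert_of_mem hj))

theorem const_mul (h : SeminormControlled Q) {c : ℝ} (hc : 0 ≤ c) :
    SeminormControlled (fun i φ => c * Q i φ) := by
  obtain ⟨s, C, hC, h⟩ := h
  refine ⟨s, c * C, by positivity, fun i φ => ?_⟩
  rw [mul_assoc]
  exact mul_le_mul_of_nonneg_left (h i φ) hc

theorem of_continuous {q : Seminorm ℂ 𝓢(E, ℂ)} (hq : Continuous q) :
    SeminormControlled (fun (_ : ι) φ => q φ) := by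
  obtain ⟨s, C, -, h⟩ := Seminorm.bound_of_continuous (schwartz_withSeminorms ℂ E ℂ) q hq
  exact ⟨s, C, C.2, fun _ φ => h φ⟩

theorem seminorm (k l : ℕ) :
    SeminormControlled (fun (_ : ι) (φ : 𝓢(E, ℂ)) => SchwartzMap.seminorm ℂ k l φ) :=
  ⟨{(k, l)}, 1, zero_le_one, fun i φ => by simp⟩

theorem comp (h : SeminormControlled Q) (A : 𝓢(E, ℂ) →L[ℂ] 𝓢(E, ℂ)) :
    SeminormControlled (fun i φ => Q i (A φ)) := by
  obtain ⟨s, C, hC, h⟩ := h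
  have hq : Continuous ((s.sup (schwartzSeminormFamily ℂ E ℂ)).comp A.toLinearMap) :=
    (Seminorm.continuous_finsetSup fun i _ =>
      (schwartz_withSeminorms ℂ E ℂ).continuous_seminorm i).comp A.continuous
  exact ((of_continuous (ι := ι) hq).const_mul hC).mono fun i φ => h i (A φ)

end SeminormControlled

end Controlled

/-! ### The transposed operator for type `1,0` -/

section Transpose

variable {n : ℕ}

/-- All derivatives of `f(x, ξ)` are bounded by multiples of one and the same power of `1 + |ξ|`.
This is what remains of the symbol estimates of type `1,0` and suffices for the transposed
operator to preserve the Schwartz space. -/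
def UniformGrowth (N : ℕ) (f : Rn n × Rn n → ℂ) : Prop :=
  ContDiff ℝ ∞ f ∧ ∀ m : ℕ, ∃ C : ℝ, 0 ≤ C ∧
    ∀ z : Rn n × Rn n, ‖iteratedFDeriv ℝ m f z‖ ≤ C * (1 + ‖z.2‖) ^ N

namespace UniformGrowth

variable {N : ℕ} {f : Rn n × Rn n → ℂ}

theorem hasTemperateGrowth (hf : UniformGrowth N f) : f.HasTemperateGrowth := by
  refine ⟨hf.1, fun m => ?_⟩
  obtain ⟨C, hC, h⟩ := hf.2 m
  refine ⟨N, C, fun z => (h z).trans (mul_le_mul_of_nonneg_left ?_ hC)⟩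
  gcongr
  exact norm_snd_le z

theorem lineDeriv (hf : UniformGrowth N f) (v : Rn n) :
    UniformGrowth N (fun z => fderiv ℝ f z (0, v)) := by
  have hD : ContDiff ℝ ∞ (fderiv ℝ f) := hf.1.fderiv_right (by simp)
  let L : (Rn n × Rn n →L[ℝ] ℂ) →L[ℝ] ℂ := ContinuousLinearMap.apply ℝ ℂ ((0 : Rn n), v)
  refine ⟨L.contDiff.comp hD, fun m => ?_⟩
  obtain ⟨C, hC, h⟩ := hf.2 (m + 1)
  refine ⟨‖L‖ * C, by positivity, fun z => ?_⟩
  refine (L.norm_iteratedFDeriv_comp_left (hD.of_le (m := ∞) le_rfl).contDiffAt (n := m)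
    (by exact_mod_cast le_top)).trans ?_
  rw [norm_iteratedFDeriv_fderiv, mul_assoc]
  exact mul_le_mul_of_nonneg_left (h z) (norm_nonneg _)

theorem slice_hasTemperateGrowth (hf : UniformGrowth N f) (ξ : Rn n) :
    Function.HasTemperateGrowth (fun x => f (x, ξ)) := by
  have h1 : Function.HasTemperateGrowth (fun x : Rn n => (x, ξ)) := by
    have h := (ContinuousLinearMap.inl ℝ (Rn n) (Rn n)).hasTemperateGrowth.add
      (Function.HasTemperateGrowth.const ((0 : Rn n), ξ))
    have he : ⇑(ContinuousLinearMap.inl ℝ (Rn n) (Rn n)) + (fun _ => ((0 : Rn n), ξ)) =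
        fun x : Rn n => (x, ξ) := by
      funext x
      simp
    rwa [he] at h
  exact hf.hasTemperateGrowth.comp h1

end UniformGrowth

theorem IsSymbol.uniformGrowth {d : ℝ} {b : Rn n → Rn n → ℂ} (hb : IsSymbol d 1 0 b) (r : ℝ) :
    ∃ N : ℕ, UniformGrowth N (fun z : Rn n × Rn n => b z.1 (r • z.2)) := by
  let L : Rn n × Rn n →L[ℝ] Rn n × Rn n := (ContinuousLinearMap.fst ℝ (Rn n) (Rn n)).prod
    (r • ContinuousLinearMap.snd ℝ (Rn n) (Rn n))
  refine ⟨⌈|d|⌉₊, hb.1.comp L.contDiff, fun m => ?_⟩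
  obtain ⟨C, hC, h⟩ := hb.norm_iteratedFDeriv_le le_rfl m
  refine ⟨C * (1 + |r|) ^ ⌈|d|⌉₊ * ‖L‖ ^ m, by positivity, fun z => ?_⟩
  have h1 : ‖iteratedFDeriv ℝ m (fun z : Rn n × Rn n => b z.1 z.2) (L z)‖ ≤
      C * (1 + |r|) ^ ⌈|d|⌉₊ * (1 + ‖z.2‖) ^ ⌈|d|⌉₊ := by
    refine (h z.1 (r • z.2)).trans ?_
    rw [zero_mul, add_zero, mul_assoc, ← mul_pow]
    refine mul_le_mul_of_nonneg_left ?_ hC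
    refine (Real.rpow_le_rpow_of_exponent_le (by simp) (Nat.le_ceil _)).trans ?_
    rw [Real.rpow_natCast]
    refine pow_le_pow_left₀ (by positivity) ?_ _
    rw [norm_smul, Real.norm_eq_abs]
    have := abs_nonneg r
    have := norm_nonneg z.2
    nlinarith
  change ‖iteratedFDeriv ℝ m ((fun z : Rn n × Rn n => b z.1 z.2) ∘ L) z‖ ≤ _
  rw [L.iteratedFDeriv_comp_right hb.1 z (by exact_mod_cast le_top)]
  refine (ContinuousMultilinearMap.norm_compContinuousLinearMap_le _ _).trans ?_
  rw [Finset.prod_const, Finset.card_univ, Fintype.card_fin]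
  calc _ ≤ C * (1 + |r|) ^ ⌈|d|⌉₊ * (1 + ‖z.2‖) ^ ⌈|d|⌉₊ * ‖L‖ ^ m := by gcongr
    _ = _ := by ring

/-- The function `ξ ↦ ∫ φ(x) e^{2πi x·ξ} f(x, ξ) dx`. -/
noncomputable def oscIntegral (f : Rn n × Rn n → ℂ) (φ : 𝓢(Rn n, ℂ)) (ξ : Rn n) : ℂ :=
  ∫ x, φ x * (planeWave x ξ * f (x, ξ))

variable {N : ℕ} {f : Rn n × Rn n → ℂ}

theorem UniformGrowth.dominatedFamily (hf : UniformGrowth N f) (φ : 𝓢(Rn n, ℂ)) :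
    DominatedFamily (volume : Measure (Rn n)) (fun z => φ z.1 * (planeWave z.1 z.2 * f z)) :=
  dominatedFamily_mul volume φ ((planeWave_hasTemperateGrowth
    (ContinuousLinearMap.fst ℝ (Rn n) (Rn n)).hasTemperateGrowth
    (ContinuousLinearMap.snd ℝ (Rn n) (Rn n)).hasTemperateGrowth).mul hf.hasTemperateGrowth)

theorem contDiff_oscIntegral (hf : UniformGrowth N f) (φ : 𝓢(Rn n, ℂ)) :
    ContDiff ℝ ∞ (oscIntegral f φ) :=
  (hf.dominatedFamily φ).contDiff_integral

/-- The function `oscIntegral f φ` decays rapidly: at each `ξ` it is a value of the inverse Fourier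
transform of `f(·, ξ) φ`, whose seminorms grow at most like `(1 + |ξ|)^N`. -/
theorem seminormControlled_oscIntegral (hf : UniformGrowth N f) (k : ℕ) :
    SeminormControlled (fun (ξ : Rn n) φ => ‖ξ‖ ^ k * ‖oscIntegral f φ ξ‖) := by
  let K := k + N
  let A : 𝓢(Rn n, ℂ) →L[ℂ] 𝓢(Rn n, ℂ) := FourierTransform.fourierInvCLM ℂ 𝓢(Rn n, ℂ)
  let h : Rn n → 𝓢(Rn n, ℂ) → 𝓢(Rn n, ℂ) := fun ξ => smulLeftCLM ℂ (fun x => f (x, ξ))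
  have hh : ∀ ξ φ x, h ξ φ x = f (x, ξ) * φ x := fun ξ φ x => by
    simp only [h]
    rw [smulLeftCLM_apply_apply (hf.slice_hasTemperateGrowth ξ), smul_eq_mul]
  have hval : ∀ ξ φ, oscIntegral f φ ξ = A (h ξ φ) ξ := fun ξ φ => by
    change _ = 𝓕⁻ (h ξ φ) ξ
    rw [fourierInv_eq_integral]
    unfold oscIntegral
    refine integral_congr_ae (Eventually.of_forall fun x => ?_)
    simp only [hh]
    rw [planeWave_comm ξ x]
    ring
  have hfam : ∀ i : ℕ × ℕ, SeminormControlled (fun (ξ : Rn n) φ =>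
      ((1 + ‖ξ‖) ^ N)⁻¹ * SchwartzMap.seminorm ℂ i.1 i.2 (h ξ φ)) := by
    rintro ⟨p, q⟩
    choose C hC hCb using hf.2
    have hs : SeminormControlled (fun (_ : Rn n) (φ : 𝓢(Rn n, ℂ)) =>
        ∑ i ∈ Finset.range (q + 1), q.choose i * C i * SchwartzMap.seminorm ℂ p (q - i) φ) :=
      SeminormControlled.sum _ fun i _ =>
        (SeminormControlled.seminorm p (q - i)).const_mul (mul_nonneg (Nat.cast_nonneg _) (hC i))
    refine hs.mono fun ξ φ => ?_
    rw [inv_mul_le_iff₀ (by positivity)]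
    refine seminorm_le_bound ℂ p q _ (mul_nonneg (by positivity) (Finset.sum_nonneg fun i _ =>
      mul_nonneg (mul_nonneg (Nat.cast_nonneg _) (hC i)) (apply_nonneg _ _))) fun x => ?_
    have e : (h ξ φ : Rn n → ℂ) = fun x => f (x, ξ) * φ x := funext fun x => hh ξ φ x
    have hfs : ContDiff ℝ ∞ (fun x => f (x, ξ)) := (hf.slice_hasTemperateGrowth ξ).1
    rw [e, Finset.mul_sum]
    refine (mul_le_mul_of_nonneg_left (norm_iteratedFDeriv_mul_le hfs (φ.smooth _) x
      (by exact_mod_cast le_top)) (by positivity)).trans ?_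
    rw [Finset.mul_sum]
    refine Finset.sum_le_sum fun i _ => ?_
    have h1 := (norm_iteratedFDeriv_prodMk_right_le hf.1 i x ξ).trans (hCb i (x, ξ))
    have h2 := le_seminorm ℂ p (q - i) φ x
    calc _ = q.choose i * ‖iteratedFDeriv ℝ i (fun x => f (x, ξ)) x‖ *
          (‖x‖ ^ p * ‖iteratedFDeriv ℝ (q - i) φ x‖) := by ring
      _ ≤ q.choose i * (C i * (1 + ‖ξ‖) ^ N) * SchwartzMap.seminorm ℂ p (q - i) φ := by
        have := hC i
        gcongr
      _ = _ := by ring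
  obtain ⟨s, C, hC, hq⟩ : SeminormControlled (fun (_ : Unit) (φ : 𝓢(Rn n, ℂ)) =>
      ((Finset.Iic (K, 0)).sup fun m => SchwartzMap.seminorm ℂ m.1 m.2) (A φ)) :=
    (SeminormControlled.of_continuous (Seminorm.continuous_finsetSup fun i _ =>
      (schwartz_withSeminorms ℂ (Rn n) ℂ).continuous_seminorm i)).comp A
  refine ((SeminormControlled.sum s fun i _ => hfam i).const_mul
    (c := 2 ^ K * C) (by positivity)).mono fun ξ φ => ?_
  have h1 := one_add_le_sup_seminorm_apply (𝕜 := ℂ) (m := (K, 0)) (k := K) (n := 0) le_rfl le_rfl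
    (A (h ξ φ)) ξ
  rw [norm_iteratedFDeriv_zero, ← hval] at h1
  have h2 : (s.sup (schwartzSeminormFamily ℂ (Rn n) ℂ)) (h ξ φ) ≤
      ∑ i ∈ s, SchwartzMap.seminorm ℂ i.1 i.2 (h ξ φ) :=
    Seminorm.finset_sup_apply_le (Finset.sum_nonneg fun i _ => apply_nonneg _ _) fun i hi =>
      Finset.single_le_sum (f := fun i : ℕ × ℕ => SchwartzMap.seminorm ℂ i.1 i.2 (h ξ φ))
        (fun i _ => apply_nonneg _ _) hi
  have h3 : (1 + ‖ξ‖) ^ K * ‖oscIntegral f φ ξ‖ ≤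
      2 ^ K * (C * ∑ i ∈ s, SchwartzMap.seminorm ℂ i.1 i.2 (h ξ φ)) :=
    h1.trans (mul_le_mul_of_nonneg_left ((hq () _).trans (mul_le_mul_of_nonneg_left h2 hC))
      (by positivity))
  have h4 : ‖ξ‖ ^ k * ‖oscIntegral f φ ξ‖ ≤ (1 + ‖ξ‖) ^ k * ‖oscIntegral f φ ξ‖ := by
    gcongr
    linarith
  refine h4.trans ?_
  rw [← Finset.mul_sum]
  have h5 : (1 + ‖ξ‖) ^ k = ((1 + ‖ξ‖) ^ N)⁻¹ * (1 + ‖ξ‖) ^ K := by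
    simp only [K]
    rw [pow_add]
    field_simp
  rw [h5, mul_assoc]
  refine (mul_le_mul_of_nonneg_left h3 (by positivity)).trans_eq ?_
  ring

end Transpose

/-! ### Derivatives of the transposed operator -/

section Derivative

variable {n : ℕ} {N : ℕ} {f : Rn n × Rn n → ℂ}

theorem hasFDerivAt_planeWave (x ξ : Rn n) : HasFDerivAt (planeWave x)
    (planeWave x ξ • ((2 * Real.pi * Complex.I) •
      (Complex.ofRealCLM.comp (innerSL ℝ x)) : Rn n →L[ℝ] ℂ)) ξ := by
  have h1 : HasFDerivAt (fun η : Rn n => (2 * Real.pi * Complex.I) *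
      Complex.ofRealCLM (innerSL ℝ x η)) ((2 * Real.pi * Complex.I) •
        (Complex.ofRealCLM.comp (innerSL ℝ x)) : Rn n →L[ℝ] ℂ) ξ :=
    (Complex.ofRealCLM.comp (innerSL ℝ x)).hasFDerivAt.const_mul _
  have h2 := h1.cexp
  have e : planeWave x = fun η => Complex.exp ((2 * Real.pi * Complex.I) *
      Complex.ofRealCLM (innerSL ℝ x η)) := by
    funext η
    unfold planeWave
    congr 1
    simp only [Complex.ofRealCLM_apply, innerSL_apply_apply]
    push_cast
    ring
  rw [e]
  exact h2

/-- The function `2πi x·v`. -/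
noncomputable def linearWeight (v x : Rn n) : ℂ := 2 * Real.pi * Complex.I * (inner ℝ x v : ℝ)

theorem linearWeight_hasTemperateGrowth (v : Rn n) : (linearWeight v).HasTemperateGrowth :=
  (Function.HasTemperateGrowth.const (2 * Real.pi * Complex.I)).mul
    (Function.HasTemperateGrowth.comp Function.Complex.hasTemperateGrowth_ofReal
      (Function.hasTemperateGrowth_inner_left v))

/-- A derivative of `oscIntegral f φ` is a sum of two functions of the same kind, so that decay of
the functions gives decay of all derivatives. -/
theorem fderiv_oscIntegral_apply (hf : UniformGrowth N f) (φ : 𝓢(Rn n, ℂ)) (ξ v : Rn n) :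
    fderiv ℝ (oscIntegral f φ) ξ v = oscIntegral (fun z => fderiv ℝ f z (0, v)) φ ξ +
      oscIntegral f (smulLeftCLM ℂ (linearWeight v) φ) ξ := by
  have hD := hf.dominatedFamily φ
  have hD' : fderiv ℝ (oscIntegral f φ) ξ = _ := (hD.hasFDerivAt_integral ξ).fderiv
  rw [hD', ContinuousLinearMap.integral_apply (hD.partialFDeriv.integrable ξ)]
  unfold oscIntegral
  rw [← integral_add (((hf.lineDeriv v).dominatedFamily φ).integrable ξ)
    ((hf.dominatedFamily (smulLeftCLM ℂ (linearWeight v) φ)).integrable ξ)]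
  refine integral_congr_ae (Eventually.of_forall fun x => ?_)
  have h1 : HasFDerivAt (fun η => φ x * (planeWave x η * f (x, η)))
      ((fderiv ℝ (fun z : Rn n × Rn n => φ z.1 * (planeWave z.1 z.2 * f z)) (x, ξ)).comp
        (ContinuousLinearMap.inr ℝ (Rn n) (Rn n))) ξ :=
    ((hD.1.differentiable (by simp)) (x, ξ)).hasFDerivAt.comp ξ (hasFDerivAt_prodMk_right x ξ)
  have h2 : HasFDerivAt (fun η => f (x, η)) ((fderiv ℝ f (x, ξ)).comp
      (ContinuousLinearMap.inr ℝ (Rn n) (Rn n))) ξ :=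
    ((hf.1.differentiable (by simp)) (x, ξ)).hasFDerivAt.comp ξ (hasFDerivAt_prodMk_right x ξ)
  have h3 := ((hasFDerivAt_planeWave x ξ).mul h2).const_mul (φ x)
  have h4 := congrArg (fun L : Rn n →L[ℝ] ℂ => L v) (h1.unique h3)
  simp only at h4 ⊢
  rw [h4, smulLeftCLM_apply_apply (linearWeight_hasTemperateGrowth v)]
  simp only [linearWeight, _root_.smul_apply, _root_.add_apply,
    ContinuousLinearMap.comp_apply, smul_eq_mul, Complex.ofRealCLM_apply, innerSL_apply_apply,
    ContinuousLinearMap.inr_apply]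
  ring

theorem seminormControlled_iteratedFDeriv_oscIntegral (hf : UniformGrowth N f) (k l : ℕ) :
    SeminormControlled (fun (ξ : Rn n) φ =>
      ‖ξ‖ ^ k * ‖iteratedFDeriv ℝ l (oscIntegral f φ) ξ‖) := by
  induction l generalizing f with
  | zero => simpa using seminormControlled_oscIntegral hf k
  | succ l ih =>
    let e : Fin n → Rn n := fun i => EuclideanSpace.single i (1 : ℝ)
    let S : Fin n → (ℂ →L[ℝ] (Rn n →L[ℝ] ℂ)) := fun i =>
      ContinuousLinearMap.smulRightL ℝ (Rn n) ℂ (EuclideanSpace.proj i)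
    let g : Fin n → 𝓢(Rn n, ℂ) → Rn n → ℂ := fun i φ ξ => fderiv ℝ (oscIntegral f φ) ξ (e i)
    have hS : ∀ i c w, S i c w = w i • c := fun i c w => rfl
    have hg : ∀ i φ, g i φ = fun ξ => oscIntegral (fun z => fderiv ℝ f z (0, e i)) φ ξ +
        oscIntegral f (smulLeftCLM ℂ (linearWeight (e i)) φ) ξ := fun i φ =>
      funext fun ξ => fderiv_oscIntegral_apply hf φ ξ (e i)
    have hsmooth : ∀ i φ, ContDiff ℝ ∞ (g i φ) := fun i φ => by
      rw [hg]
      exact (contDiff_oscIntegral (hf.lineDeriv (e i)) φ).add (contDiff_oscIntegral hf _)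
    have hsplit : ∀ φ, fderiv ℝ (oscIntegral f φ) = fun ξ => ∑ i, (S i ∘ g i φ) ξ := fun φ => by
      funext ξ
      ext w
      have hw : w = ∑ i, w i • e i := by
        simpa [e] using ((EuclideanSpace.basisFun (Fin n) ℝ).sum_repr w).symm
      rw [_root_.sum_apply]
      conv_lhs => rw [hw, map_sum]
      refine Finset.sum_congr rfl fun i _ => ?_
      rw [map_smul, Function.comp_apply, hS]
    have hgc : ∀ i, SeminormControlled (fun (ξ : Rn n) φ =>
        ‖ξ‖ ^ k * ‖iteratedFDeriv ℝ l (g i φ) ξ‖) := fun i => by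
      refine ((ih (hf.lineDeriv (e i))).add
        ((ih hf).comp (smulLeftCLM ℂ (linearWeight (e i))))).mono fun ξ φ => ?_
      rw [hg, ← Pi.add_def, iteratedFDeriv_add_apply
        ((contDiff_oscIntegral (hf.lineDeriv (e i)) φ).of_le
          (by exact_mod_cast le_top)).contDiffAt
        ((contDiff_oscIntegral hf _).of_le (by exact_mod_cast le_top)).contDiffAt, ← mul_add]
      exact mul_le_mul_of_nonneg_left (norm_add_le _ _) (by positivity)
    refine (SeminormControlled.sum Finset.univ fun i _ =>
      (hgc i).const_mul (norm_nonneg (S i))).mono fun ξ φ => ?_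
    rw [← norm_iteratedFDeriv_fderiv, hsplit, iteratedFDeriv_fun_sum_apply fun i _ =>
      (((S i).contDiff.comp (hsmooth i φ)).of_le (by exact_mod_cast le_top)).contDiffAt]
    refine (mul_le_mul_of_nonneg_left (norm_sum_le _ _) (by positivity)).trans ?_
    rw [Finset.mul_sum]
    refine Finset.sum_le_sum fun i _ => ?_
    have h := (S i).norm_iteratedFDeriv_comp_left (x := ξ) (n := l) (hsmooth i φ).contDiffAt
      (by exact_mod_cast le_top)
    calc _ ≤ ‖ξ‖ ^ k * (‖S i‖ * ‖iteratedFDeriv ℝ l (g i φ) ξ‖) := by gcongr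
      _ = _ := by ring

/-- The operator `φ ↦ oscIntegral f φ` on the Schwartz space. -/
noncomputable def oscIntegralCLM (hf : UniformGrowth N f) : 𝓢(Rn n, ℂ) →L[ℂ] 𝓢(Rn n, ℂ) :=
  SchwartzMap.mkCLM (oscIntegral f)
    (fun φ ψ ξ => by
      unfold oscIntegral
      rw [← integral_add ((hf.dominatedFamily φ).integrable ξ)
        ((hf.dominatedFamily ψ).integrable ξ)]
      simp only [_root_.add_apply, add_mul])
    (fun c φ ξ => by
      unfold oscIntegral
      simp only [_root_.smul_apply, smul_eq_mul, mul_assoc, integral_const_mul,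
        RingHom.id_apply])
    (contDiff_oscIntegral hf)
    (fun m => by
      obtain ⟨s, C, hC, h⟩ := seminormControlled_iteratedFDeriv_oscIntegral hf m.1 m.2
      exact ⟨s, C, hC, fun φ ξ => h ξ φ⟩)

theorem oscIntegralCLM_apply (hf : UniformGrowth N f) (φ : 𝓢(Rn n, ℂ)) (ξ : Rn n) :
    oscIntegralCLM hf φ ξ = ∫ x, φ x * (planeWave x ξ * f (x, ξ)) := rfl

/-- The operator on tempered distributions that is dual to `φ ↦ 𝓕 (oscIntegral f φ)`. -/
noncomputable def dualOp (hf : UniformGrowth N f) : 𝓢'(Rn n, ℂ) →L[ℂ] 𝓢'(Rn n, ℂ) :=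
  PointwiseConvergenceCLM.precomp ℂ
    ((FourierTransform.fourierCLM ℂ 𝓢(Rn n, ℂ)).comp (oscIntegralCLM hf))

theorem dualOp_apply (hf : UniformGrowth N f) (u : 𝓢'(Rn n, ℂ)) (φ : 𝓢(Rn n, ℂ)) :
    dualOp hf u φ = (𝓕 u : 𝓢'(Rn n, ℂ)) (oscIntegralCLM hf φ) := rfl

end Derivative

/-! ### The extension to all tempered distributions for type `1,0` -/

section GlobalExtension

variable {n : ℕ} {N : ℕ} {b : Rn n → Rn n → ℂ}

/-- Fubini's theorem, applied to `φ(x) e^{2πi x·ξ} b(x, 2πξ) v̂(ξ)`. -/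
theorem isGlobalExtension_dualOp
    (hf : UniformGrowth N (fun z : Rn n × Rn n => b z.1 ((2 * Real.pi) • z.2))) :
    IsGlobalExtension (op b) (dualOp hf) := by
  intro v φ
  let h : Rn n × Rn n → ℂ := fun z =>
    φ z.1 * (planeWave z.1 z.2 * b z.1 ((2 * Real.pi) • z.2)) * 𝓕 v z.2
  have hcont : Continuous h :=
    (hf.dominatedFamily φ).1.continuous.mul ((𝓕 v).continuous.comp continuous_snd)
  have hint : Integrable h (volume.prod volume) := by
    obtain ⟨C, hC, hb⟩ := hf.2 0
    refine (((φ.integrable.norm).mul_prod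
      ((integrable_one_add_norm_pow_mul volume (𝓕 v) N).const_mul C))).mono'
        hcont.aestronglyMeasurable (Eventually.of_forall fun z => ?_)
    have h1 := hb z
    rw [norm_iteratedFDeriv_zero] at h1
    simp only [h, norm_mul, norm_planeWave, one_mul]
    calc _ ≤ ‖φ z.1‖ * (C * (1 + ‖z.2‖) ^ N) * ‖𝓕 v z.2‖ := by gcongr
      _ = _ := by ring
  have hin : ∀ x, ∫ ξ, h (x, ξ) = φ x * op b v x := fun x => by
    rw [op_eq, ← integral_const_mul]
    refine integral_congr_ae (Eventually.of_forall fun ξ => ?_)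
    simp only [h]
    ring
  refine ⟨hint.integral_prod_left.congr (Eventually.of_forall hin), ?_⟩
  rw [dualOp_apply, TemperedDistribution.fourier_toTemperedDistributionCLM_eq, coe_schwartz_apply]
  simp_rw [← hin]
  rw [integral_integral_swap hint]
  refine integral_congr_ae (Eventually.of_forall fun ξ => ?_)
  simp only [oscIntegralCLM_apply, h]
  rw [integral_mul_const]

/-- For `û` of compact support the test function `oscIntegral f φ` may be cut off in `ξ`, after
which `û` may be applied under the integral sign. -/
theorem eq_dualOp_of_represents
    (hb : Function.HasTemperateGrowth (fun z : Rn n × Rn n => b z.1 z.2))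
    (hf : UniformGrowth N (fun z : Rn n × Rn n => b z.1 ((2 * Real.pi) • z.2)))
    (Ψ : Cutoff n) (u : 𝓢'(Rn n, ℂ)) {M : ℕ}
    (hu : Distribution.dsupport (𝓕 u : 𝓢'(Rn n, ℂ)) ⊆ Metric.ball 0 ((2 : ℝ) ^ M / 8))
    {w : 𝓢'(Rn n, ℂ)} (hw : Represents w (localizedOp hb Ψ M u)) : w = dualOp hf u := by
  ext φ
  let G : 𝓢(Rn n, ℂ) := HasCompactSupport.toSchwartzMap
    (f := fun ξ => oscIntegralCLM hf φ ξ * Ψ.localizer M ξ)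
    (Ψ.localizer_hasCompactSupport M).mul_left
    (((oscIntegralCLM hf φ).smooth _).mul (Ψ.localizer_contDiff M))
  have hG : ∀ ξ, G ξ = oscIntegralCLM hf φ ξ * Ψ.localizer M ξ := fun ξ => rfl
  let B : CompactFamily (Rn n) (Rn n) := CompactFamily.ofMul
    (fun z : Rn n × Rn n => planeWave z.1 z.2 * b z.1 ((2 * Real.pi) • z.2))
    ((planeWave_hasTemperateGrowth (ContinuousLinearMap.fst ℝ (Rn n) (Rn n)).hasTemperateGrowth
      (ContinuousLinearMap.snd ℝ (Rn n) (Rn n)).hasTemperateGrowth).mul hf.hasTemperateGrowth)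
    _ (Ψ.localizer_contDiff M) (Ψ.localizer_hasCompactSupport M)
  have h1 : (𝓕 u : 𝓢'(Rn n, ℂ)) (oscIntegralCLM hf φ) = (𝓕 u : 𝓢'(Rn n, ℂ)) G :=
    apply_congr_of_eqOn _ Metric.isOpen_ball hu fun ξ hξ => by
      rw [hG, Ψ.localizer_eq_one (by omega) (by simpa using hξ), mul_one]
  have h2 := B.apply_eq_integral volume (𝓕 u) φ G fun ξ => by
    rw [hG, oscIntegralCLM_apply, ← integral_mul_const]
    refine integral_congr_ae (Eventually.of_forall fun x => ?_)
    exact mul_assoc _ _ _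
  rw [dualOp_apply, h1, h2, (hw φ).2]
  refine integral_congr_ae (Eventually.of_forall fun x => ?_)
  have h3 : B.slice x = (shiftFamily hb _ (Ψ.localizer_contDiff M)
      (Ψ.localizer_hasCompactSupport M)).slice (x, 0) := by
    ext ξ
    rw [shiftFamily_slice_apply, sub_zero]
    exact CompactFamily.ofMul_slice_apply _ _ _ _ _ _ _
  simp only [h3]
  rfl

end GlobalExtension

end TypeOneOne

theorem mainTheorem4 (n : ℕ) (A : 𝓢(TypeOneOne.Rn n, ℂ) → TypeOneOne.Rn n → ℂ)
    (hA : A ∈ TypeOneOne.OPInfty n 1 1) :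
    ∃ Aext : TypeOneOne.FinvE' n →ₗ[ℂ] 𝓢'(TypeOneOne.Rn n, ℂ),
      -- `Aext` agrees with `A` on the Schwartz functions in its domain
      (∀ (u : TypeOneOne.FinvE' n) (v : 𝓢(TypeOneOne.Rn n, ℂ)),
        (u : 𝓢'(TypeOneOne.Rn n, ℂ)) = (v : 𝓢'(TypeOneOne.Rn n, ℂ)) →
          TypeOneOne.Represents (Aext u) (A v)) ∧
      -- `Aext` is given by the paradifferential splitting, for every partition of unity
      (∀ (d : ℝ) (a : TypeOneOne.Rn n → TypeOneOne.Rn n → ℂ),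
        TypeOneOne.IsSymbol d 1 1 a → A = TypeOneOne.op a →
          ∀ (Ψ : TypeOneOne.Cutoff n) (u : TypeOneOne.FinvE' n),
            TypeOneOne.IsParadifferentialSum Ψ a u (Aext u)) ∧
      -- for type `1,0` the usual extension to `S'` exists, and `Aext` coincides with it
      (A ∈ TypeOneOne.OPInfty n 1 0 →
        (∃ T : 𝓢'(TypeOneOne.Rn n, ℂ) →L[ℂ] 𝓢'(TypeOneOne.Rn n, ℂ),
          TypeOneOne.IsGlobalExtension A T) ∧
        ∀ T : 𝓢'(TypeOneOne.Rn n, ℂ) →L[ℂ] 𝓢'(TypeOneOne.Rn n, ℂ),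
          TypeOneOne.IsGlobalExtension A T → ∀ u : TypeOneOne.FinvE' n, Aext u = T u) := by
  obtain ⟨d₀, a₀, ha₀, rfl⟩ := hA
  have h₀ := ha₀.hasTemperateGrowth zero_le_one
  obtain ⟨L, hL⟩ := TypeOneOne.exists_extension h₀
  let Ψ₀ : TypeOneOne.Cutoff n := Classical.arbitrary _
  refine ⟨L, fun u v huv => ?_, fun d a ha hop Ψ u => ?_, fun hA => ?_⟩
  · obtain ⟨N, hN⟩ := TypeOneOne.exists_dsupport_subset_ball u
    have h := hL u N (hN N le_rfl) Ψ₀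
    have hu := hN N le_rfl
    rw [huv] at h hu
    rwa [TypeOneOne.localizedOp_eq_op h₀ Ψ₀ v hu] at h
  · obtain rfl := TypeOneOne.op_injective h₀ (ha.hasTemperateGrowth zero_le_one) hop
    obtain ⟨N, hN⟩ := TypeOneOne.exists_dsupport_subset_ball u
    exact TypeOneOne.isParadifferentialSum_of_represents h₀ Ψ u (hN N le_rfl)
      (hL u N (hN N le_rfl) Ψ)
  · obtain ⟨d, b, hb, hop⟩ := hA
    obtain rfl := TypeOneOne.op_injective h₀ (hb.hasTemperateGrowth le_rfl) hop
    obtain ⟨N, hf⟩ := hb.uniformGrowth (2 * Real.pi)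
    refine ⟨⟨_, TypeOneOne.isGlobalExtension_dualOp hf⟩, fun T hT u => ?_⟩
    have hTT : T = TypeOneOne.dualOp hf := TypeOneOne.continuousLinearMap_ext_of_schwartz fun v =>
      (hT v).eq (TypeOneOne.isGlobalExtension_dualOp hf v)
    obtain ⟨M, hM⟩ := TypeOneOne.exists_dsupport_subset_ball u
    rw [hTT]
    exact TypeOneOne.eq_dualOp_of_represents h₀ hf Ψ₀ u (hM M le_rfl) (hL u M (hM M le_rfl) Ψ₀)
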